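/- **Setting.** Let $\mathsf T^2$ be the two-dimensional torus, $\Delta$ its Laplacian and $(P_t)_{t\ge 0}$ the heat semigroup. For $\gamma\in\mathbb R$ let $C^\gamma$ be the closure of the smooth functions in the Besov space $B^\gamma_{\infty,\infty}(\mathsf T^2)$ of real distributions, with the norm $\|v\|_{C^\gamma}=\sup_{j\ge -1}2^{j\gamma}\|\Delta_j v\|_{L^\infty}$ ($\Delta_j$ the Littlewood–Paley blocks). For $T>0$ let $C_TC^\gamma=C([0,T],C^\gamma)$, with the supremum norm. For a separable normed space $E$ and $1\le p<\infty$ let $\mathcal P_p(E)$ be the set of Borel probability measures on $E$ with a finite moment of order $p$, and $\mathcal W_{p,E}$ the $p$-Wasserstein distance on it. $\mathcal L(X)$ denotes the law of $X$. Fix $2/3<\alpha<1$, $0<T<\infty$, $1\le p<\infty$, an exponent $\gamma>\alpha-2$ and a map $g: C^\alpha\times\mathcal P_p(C^\alpha)\to C^\gamma$ for which there is a constant $L$ such that for all $v_1,v_2\in C^\alpha$ and $\nu_1,\nu_2\in\mathcal P_p(C^\alpha)$ $$\|g(v_1,\nu_1)-g(v_2,\nu_2)\|_{C^\gamma}^p\le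 L^p\big(\|v_1-v_2\|_{C^\alpha}^p+\mathcal W_{p,C^\alpha}(\nu_1,\nu_2)^p\big).$$ Let $(\zeta,u_0)$ be a random variable in $L^p(\Omega_0,\,C_TC^{\alpha-2}\times C^\alpha)$, and let $(\zeta^i,u^i_0)_{i\ge1}$ be independent random variables, on a probability space $(\Omega,\mathcal F,\mathbb P)$, each with the law of $(\zeta,u_0)$ ($\zeta$ and $u_0$ need not be independent). For a noise $z\in C_TC^{\alpha-2}$, an initial condition $v_0\in C^\alpha$ and a flow $(m_t)_{0\le t\le T}$ in $\mathcal P_p(C^\alpha)$, a path $v\in C_TC^\alpha$ is said to solve $(\partial_t-\Delta)v=z+g(v,m_t)$ with initial condition $v_0$ if $v_t=P_tv_0+\int_0^tP_{t-s}\big(z_s+g(v_s,m_s)\big)ds$ for all $t\in[0,T]$, as an identity between distributions. * A solution of the mean field equation $(\partial_t-\Delta)u=\zeta+g(u,\mathcal L(u_t))$ with initial condition $u_0$ is a random variable $u$ with values in $C_TC^\alpha$, with $\mathcal L(u)\in\mathcal P_p(C_TC^\alpha)$, that almost surely solves $(\partial_t-\Delta)u=\zeta+g(u,m_t)$ with $m_t=\mathcal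 L(u_t)$. * For $n\ge1$ and $\omega\in\Omega$ the interacting system of $n$ fields is $$(\partial_t-\Delta)u^{i,n}(\omega)=\zeta^i(\omega)+g\big(u^{i,n}(\omega),\mu^n_t(\omega)\big),\qquad \mu^n_t(\omega)=\frac1n\sum_{j=1}^n\delta_{u^{j,n}_t(\omega)},\qquad 1\le i\le n,$$ with initial conditions $u^i_0(\omega)$, to be solved in $C_TC^\alpha$. **Statement (propagation of chaos).** The mean field equation has a solution $u$, and it is almost surely unique; for each $n$ and each $\omega$ the interacting system has a unique solution $(u^{1,n}(\omega),\dots,u^{n,n}(\omega))$, and the $u^{i,n}$ are random variables. For every integer $k\ge1$, the law of $(u^{1,n},\dots,u^{k,n})$ on $(C_TC^\alpha)^k$ converges weakly to $\mathcal L(u)^{\otimes k}$ as $n\to\infty$. -/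

import Mathlib

open MeasureTheory ProbabilityTheory Filter Topology
open scoped NNReal ENNReal

noncomputable section

namespace MeanFieldSPDE

/-! ### Littlewood-Paley theory on the two-dimensional torus

The torus is `UnitAddTorus (Fin 2) = (ℝ/ℤ)²`.  A distribution on it is represented by the family of
its Fourier coefficients, indexed by `Fin 2 → ℤ`. -/

/-- Frequencies of the two-dimensional torus. -/
abbrev Freq : Type := Fin 2 → ℤ

/-- The squared Euclidean length of a frequency. -/
def freqSq (k : Freq) : ℝ := ∑ i, (k i : ℝ) ^ 2

/-- The radial profile of the low-frequency cutoff: smooth, equal to `1` on `[0,1]` and to `0` on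
`[2,∞)`. -/
def cutoff (r : ℝ) : ℝ := Real.smoothTransition (2 - r)

/-- The smooth dyadic partition of unity on frequencies.  The index `j : ℕ` is the customary
Littlewood-Paley index (which starts at `-1`) plus one. -/
def lpWeight : ℕ → Freq → ℝ
  | 0, k => cutoff (Real.sqrt (freqSq k))
  | j + 1, k => cutoff (Real.sqrt (freqSq k) / 2 ^ (j + 1)) - cutoff (Real.sqrt (freqSq k) / 2 ^ j)

/-- A finite box of frequencies that contains the support of `lpWeight j`. -/
def lpBox (j : ℕ) : Finset Freq := Finset.Icc (fun _ => -2 ^ (j + 1)) (fun _ => 2 ^ (j + 1))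

/-- The Littlewood-Paley block of the distribution with Fourier coefficients `c`, a
trigonometric polynomial. -/
def lpBlock (j : ℕ) (c : Freq → ℂ) : C(UnitAddTorus (Fin 2), ℂ) where
  toFun x := ∑ k ∈ lpBox j, (lpWeight j k : ℂ) * c k * UnitAddTorus.mFourier k x
  continuous_toFun := continuous_finsetSum _ fun k _ =>
    continuous_const.mul (UnitAddTorus.mFourier k).continuous

lemma lpBlock_apply (j : ℕ) (c : Freq → ℂ) (x : UnitAddTorus (Fin 2)) :
    lpBlock j c x = ∑ k ∈ lpBox j, (lpWeight j k : ℂ) * c k * UnitAddTorus.mFourier k x := rfl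

/-- The `j`-th term in the supremum that defines the norm of `B^γ_{∞,∞}`. -/
def besovTerm (γ : ℝ) (c : Freq → ℂ) (j : ℕ) : ℝ := (2 : ℝ) ^ (((j : ℝ) - 1) * γ) * ‖lpBlock j c‖

lemma lpBlock_add (j : ℕ) (c d : Freq → ℂ) : lpBlock j (c + d) = lpBlock j c + lpBlock j d := by
  ext x
  simp only [ContinuousMap.add_apply, lpBlock_apply, Pi.add_apply, mul_add, add_mul,
    Finset.sum_add_distrib]

lemma lpBlock_smul (j : ℕ) (a : ℝ) (c : Freq → ℂ) : lpBlock j (a • c) = a • lpBlock j c := by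
  ext x
  simp only [ContinuousMap.smul_apply, lpBlock_apply, Pi.smul_apply, Complex.real_smul,
    Finset.mul_sum]
  exact Finset.sum_congr rfl fun k _ => by ring

lemma lpBlock_zero (j : ℕ) : lpBlock j 0 = 0 := by
  ext x
  simp [lpBlock_apply]

lemma besovTerm_nonneg (γ : ℝ) (c : Freq → ℂ) (j : ℕ) : 0 ≤ besovTerm γ c j := by
  unfold besovTerm; positivity

lemma besovTerm_add_le (γ : ℝ) (c d : Freq → ℂ) (j : ℕ) :
    besovTerm γ (c + d) j ≤ besovTerm γ c j + besovTerm γ d j := by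
  unfold besovTerm
  rw [lpBlock_add, ← mul_add]
  gcongr
  exact norm_add_le _ _

lemma besovTerm_smul (γ a : ℝ) (c : Freq → ℂ) (j : ℕ) :
    besovTerm γ (a • c) j = |a| * besovTerm γ c j := by
  unfold besovTerm
  rw [lpBlock_smul, norm_smul, Real.norm_eq_abs]
  ring

lemma abs_le_of_freqSq_lt {k : Freq} {R : ℝ} (hR : 0 ≤ R) (h : freqSq k < R ^ 2) (i : Fin 2) :
    |(k i : ℝ)| ≤ R := by
  have h1 : (k i : ℝ) ^ 2 ≤ freqSq k :=
    Finset.single_le_sum (f := fun i => (k i : ℝ) ^ 2) (fun i _ => sq_nonneg _) (Finset.mem_univ i)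
  exact abs_le_of_sq_le_sq (by linarith) hR

/-- The dyadic weights form a partition of unity. -/
lemma sum_lpWeight (k : Freq) (J : ℕ) :
    ∑ j ∈ Finset.range (J + 1), lpWeight j k = cutoff (Real.sqrt (freqSq k) / 2 ^ J) := by
  induction J with
  | zero => simp [lpWeight]
  | succ J ih => rw [Finset.sum_range_succ, ih]; simp [lpWeight]

/-- The weight with index `j` vanishes outside the box `lpBox j`. -/
lemma lpWeight_eq_zero {j : ℕ} {k : Freq} (hk : k ∉ lpBox j) : lpWeight j k = 0 := by
  have key : (2 : ℝ) ^ (j + 1) ≤ Real.sqrt (freqSq k) := by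
    by_contra! hlt
    apply hk
    have hlt' : freqSq k < ((2 : ℝ) ^ (j + 1)) ^ 2 := (Real.sqrt_lt' (by positivity)).1 hlt
    rw [lpBox, Finset.mem_Icc]
    constructor
    · intro i
      have := (abs_le.1 (abs_le_of_freqSq_lt (by positivity) hlt' i)).1
      exact_mod_cast this
    · intro i
      have := (abs_le.1 (abs_le_of_freqSq_lt (by positivity) hlt' i)).2
      exact_mod_cast this
  have hz : ∀ r : ℝ, 2 ≤ r → cutoff r = 0 := fun r hr =>
    Real.smoothTransition.zero_of_nonpos (by linarith)
  cases j with
  | zero => exact hz _ (by simpa using key)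
  | succ j =>
    have h1 : 2 ≤ Real.sqrt (freqSq k) / 2 ^ (j + 1) := by
      rw [le_div_iff₀ (by positivity)]
      calc (2 : ℝ) * 2 ^ (j + 1) = 2 ^ (j + 1 + 1) := by ring
        _ ≤ _ := key
    have h2 : 2 ≤ Real.sqrt (freqSq k) / 2 ^ j := by
      rw [le_div_iff₀ (by positivity)]
      calc (2 : ℝ) * 2 ^ j = 2 ^ (j + 1) := by ring
        _ ≤ 2 ^ (j + 1 + 1) := pow_le_pow_right₀ (by norm_num) (by omega)
        _ ≤ _ := key
    simp only [lpWeight]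
    rw [hz _ h1, hz _ h2, sub_self]

/-- A trigonometric polynomial that vanishes identically has vanishing coefficients. -/
lemma coeff_eq_zero_of_sum_mFourier (s : Finset Freq) (a : Freq → ℂ)
    (h : ∀ x, ∑ k ∈ s, a k * UnitAddTorus.mFourier k x = 0) (k : Freq) (hk : k ∈ s) : a k = 0 := by
  let _ : MeasureSpace UnitAddCircle := ⟨AddCircle.haarAddCircle⟩
  have _ : IsProbabilityMeasure (volume : Measure UnitAddCircle) :=
    inferInstanceAs (IsProbabilityMeasure AddCircle.haarAddCircle)
  have hli := (UnitAddTorus.orthonormal_mFourier (d := Fin 2)).linearIndependent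
  refine (linearIndependent_iff'.1 hli) s a ?_ k hk
  have h0 : ∑ i ∈ s, a i • UnitAddTorus.mFourier i = (0 : C(UnitAddTorus (Fin 2), ℂ)) := by
    ext x
    rw [ContinuousMap.sum_apply]
    exact h x
  have h1 := congrArg (ContinuousMap.toLp (E := ℂ) 2
    (volume : Measure (UnitAddTorus (Fin 2))) ℂ) h0
  rw [map_sum, map_zero] at h1
  rw [← h1]
  exact Finset.sum_congr rfl fun i _ => (map_smul _ _ _).symm

/-- The Fourier coefficients vanish when all Littlewood-Paley blocks do. -/
lemma eq_zero_of_lpBlock_eq_zero {c : Freq → ℂ} (h : ∀ j, lpBlock j c = 0) : c = 0 := by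
  funext k
  obtain ⟨J, hJ⟩ := pow_unbounded_of_one_lt (Real.sqrt (freqSq k)) (by norm_num : (1 : ℝ) < 2)
  have hsum : ∑ j ∈ Finset.range (J + 1), lpWeight j k = 1 := by
    rw [sum_lpWeight]
    apply Real.smoothTransition.one_of_one_le
    have : Real.sqrt (freqSq k) / 2 ^ J ≤ 1 := (div_le_one (by positivity)).2 hJ.le
    linarith
  obtain ⟨j, -, hj⟩ := Finset.exists_ne_zero_of_sum_ne_zero (hsum.trans_ne one_ne_zero)
  have hmem : k ∈ lpBox j := by
    by_contra hk
    exact hj (lpWeight_eq_zero hk)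
  have := coeff_eq_zero_of_sum_mFourier (lpBox j) (fun k => (lpWeight j k : ℂ) * c k)
    (fun x => DFunLike.congr_fun (h j) x) k hmem
  rcases mul_eq_zero.1 this with h0 | h0
  · exact absurd (by exact_mod_cast h0) hj
  · exact h0

/-! ### Besov spaces -/

/-- The real distributions on the torus with finite `B^γ_{∞,∞}` norm, as a real vector space of
families of Fourier coefficients. -/
def besovSubmodule (γ : ℝ) : Submodule ℝ (Freq → ℂ) where
  carrier := {c | (∀ k, c (-k) = star (c k)) ∧ BddAbove (Set.range (besovTerm γ c))}
  add_mem' := by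
    rintro c d ⟨hc, C, hC⟩ ⟨hd, D, hD⟩
    refine ⟨fun k => by simp [hc, hd], C + D, ?_⟩
    rintro _ ⟨j, rfl⟩
    exact (besovTerm_add_le γ c d j).trans (add_le_add (hC ⟨j, rfl⟩) (hD ⟨j, rfl⟩))
  zero_mem' := by
    refine ⟨fun k => by simp, 0, ?_⟩
    rintro _ ⟨j, rfl⟩
    simp [besovTerm, lpBlock_zero]
  smul_mem' := by
    rintro a c ⟨hc, C, hC⟩
    refine ⟨fun k => by simp [hc], |a| * C, ?_⟩
    rintro _ ⟨j, rfl⟩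
    rw [besovTerm_smul]
    exact mul_le_mul_of_nonneg_left (hC ⟨j, rfl⟩) (abs_nonneg a)

/-- The Besov space `B^γ_{∞,∞}` of real distributions on the torus. -/
def Besov (γ : ℝ) : Type := besovSubmodule γ

namespace Besov

variable {γ : ℝ}

instance : AddCommGroup (Besov γ) := inferInstanceAs (AddCommGroup (besovSubmodule γ))

instance : Module ℝ (Besov γ) := inferInstanceAs (Module ℝ (besovSubmodule γ))

/-- The Fourier coefficients of a distribution. -/
def coeff (x : Besov γ) : Freq → ℂ := x.1

lemma bddAbove (x : Besov γ) : BddAbove (Set.range (besovTerm γ x.coeff)) := x.2.2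

lemma coeff_zero : (0 : Besov γ).coeff = 0 := rfl

lemma coeff_add (x y : Besov γ) : (x + y).coeff = x.coeff + y.coeff := rfl

lemma coeff_smul (a : ℝ) (x : Besov γ) : (a • x).coeff = a • x.coeff := rfl

lemma coeff_neg (x : Besov γ) : (-x).coeff = (-1 : ℝ) • x.coeff := by
  rw [← coeff_smul, neg_one_smul]

/-- The norm of `B^γ_{∞,∞}`: the supremum over `j ≥ -1` of `2^(jγ)` times the sup norm of the
`j`-th Littlewood-Paley block. -/
def addGroupNorm (γ : ℝ) : AddGroupNorm (Besov γ) where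
  toFun x := ⨆ j, besovTerm γ x.coeff j
  map_zero' := by simp [coeff_zero, besovTerm, lpBlock_zero]
  add_le' x y := by
    refine ciSup_le fun j => ?_
    rw [coeff_add]
    exact (besovTerm_add_le γ _ _ j).trans
      (add_le_add (le_ciSup x.bddAbove j) (le_ciSup y.bddAbove j))
  neg' x := by
    refine congrArg _ (funext fun j => ?_)
    rw [coeff_neg, besovTerm_smul]
    simp
  eq_zero_of_map_eq_zero' x hx := by
    have hx' : ⨆ j, besovTerm γ x.coeff j = 0 := hx
    have h : x.coeff = 0 := by
      refine eq_zero_of_lpBlock_eq_zero fun j => ?_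
      have h0 : besovTerm γ x.coeff j = 0 :=
        le_antisymm (hx' ▸ le_ciSup x.bddAbove j) (besovTerm_nonneg _ _ _)
      rcases mul_eq_zero.1 h0 with h1 | h1
      · exact absurd h1 (by positivity)
      · exact norm_eq_zero.1 h1
    exact Subtype.ext h

instance : NormedAddCommGroup (Besov γ) := (addGroupNorm γ).toNormedAddCommGroup

lemma norm_def (x : Besov γ) : ‖x‖ = ⨆ j, besovTerm γ x.coeff j := rfl

instance : NormedSpace ℝ (Besov γ) where
  norm_smul_le a x := by
    rw [norm_def, norm_def, Real.mul_iSup_of_nonneg (norm_nonneg a)]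
    simp only [coeff_smul, besovTerm_smul, Real.norm_eq_abs]
    exact le_rfl

instance : MeasurableSpace (Besov γ) := borel _

instance : BorelSpace (Besov γ) := ⟨rfl⟩

/-- The real trigonometric polynomials in `B^γ_{∞,∞}`. -/
def trigPoly (γ : ℝ) : Submodule ℝ (Besov γ) where
  carrier := {x | (Function.support x.coeff).Finite}
  add_mem' {x y} hx hy := (hx.union hy).subset (by
    rw [coeff_add]; exact Function.support_add _ _)
  zero_mem' := by simp [coeff_zero]
  smul_mem' a x hx := by
    refine Set.Finite.subset hx ?_
    rw [coeff_smul]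
    exact Function.support_const_smul_subset a _

end Besov

/-- The Hölder-Besov space `C^γ`: the closure of the smooth functions (equivalently, of the
trigonometric polynomials) in `B^γ_{∞,∞}`, with the norm, topology and Borel structure of
`B^γ_{∞,∞}`. -/
abbrev Holder (γ : ℝ) : Type := (Besov.trigPoly γ).topologicalClosure

/-- The Fourier coefficients of an element of `C^γ`. -/
def Holder.coeff {γ : ℝ} (x : Holder γ) : Freq → ℂ := Besov.coeff (x : Besov γ)

/-- The Banach space `C_T C^γ` of continuous paths in `C^γ` on `[0,T]`, with the supremum norm. -/
abbrev PathSpace (T γ : ℝ) : Type := C(Set.Icc (0 : ℝ) T, Holder γ)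

instance (T γ : ℝ) : MeasurableSpace (PathSpace T γ) := borel _

instance (T γ : ℝ) : BorelSpace (PathSpace T γ) := ⟨rfl⟩

/-! ### Wasserstein spaces -/

section Wasserstein

variable {E : Type*} [NormedAddCommGroup E] [MeasurableSpace E]

/-- `μ` belongs to `𝒫_p(E)`: it is a probability measure with a finite moment of order `p`. -/
def MemWasserstein (p : ℝ) (μ : Measure E) : Prop :=
  IsProbabilityMeasure μ ∧ ∫⁻ x, ‖x‖ₑ ^ p ∂μ < ∞

/-- The `p`-Wasserstein distance: the `p`-th root of the infimum of the transport cost over all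
couplings. -/
def wassersteinDist (p : ℝ) (μ ν : Measure E) : ℝ≥0∞ :=
  (⨅ (π : Measure (E × E)) (_ : π.map Prod.fst = μ) (_ : π.map Prod.snd = ν),
    ∫⁻ z, edist z.1 z.2 ^ p ∂π) ^ (1 / p)

/-- The empirical measure of a finite family. -/
def empiricalMeasure {n : ℕ} (x : Fin n → E) : Measure E :=
  (n : ℝ≥0∞)⁻¹ • ∑ i, Measure.dirac (x i)

end Wasserstein

/-! ### The equations -/

/-- The Lipschitz condition on the drift `g : C^α × 𝒫_p(C^α) → C^γ`.  Only the values of `g` at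
measures in `𝒫_p(C^α)` are constrained (and only these matter below). -/
def LipschitzDrift {α γ : ℝ} (p : ℝ) (L : ℝ≥0) (g : Holder α → Measure (Holder α) → Holder γ) :
    Prop :=
  ∀ (v₁ v₂ : Holder α) (ν₁ ν₂ : Measure (Holder α)), MemWasserstein p ν₁ → MemWasserstein p ν₂ →
    ‖g v₁ ν₁ - g v₂ ν₂‖ₑ ^ p ≤ (L : ℝ≥0∞) ^ p * (‖v₁ - v₂‖ₑ ^ p + wassersteinDist p ν₁ ν₂ ^ p)

/-- The Fourier multiplier of the heat semigroup `P_t = e^{tΔ}` on `(ℝ/ℤ)²`. -/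
def heatSymbol (t : ℝ) (k : Freq) : ℂ := (Real.exp (-(4 * Real.pi ^ 2 * freqSq k * t)) : ℂ)

/-- `u` is the solution, with initial condition `u₀`, of `(∂_t - Δ) u = ζ + g(u, m_t)` for a given
flow of measures `m`: one has `u_t = P_t u₀ + ∫₀ᵗ P_{t-s} (ζ_s + g(u_s, m_s)) ds` for all
`t ∈ [0,T]`, as an identity between distributions, that is, for all Fourier coefficients. -/
def IsSolution {T α γ : ℝ} (g : Holder α → Measure (Holder α) → Holder γ)
    (ζ : PathSpace T (α - 2)) (u₀ : Holder α) (m : Set.Icc (0 : ℝ) T → Measure (Holder α))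
    (u : PathSpace T α) : Prop :=
  ∀ (t : Set.Icc (0 : ℝ) T) (k : Freq),
    (u t).coeff k = heatSymbol t k * u₀.coeff k +
      ∫ s in Set.Iic t, heatSymbol (t - s) k * ((ζ s).coeff k + (g (u s) (m s)).coeff k)
        ∂(volume.comap ((↑) : Set.Icc (0 : ℝ) T → ℝ))

/-- `u` solves the interacting system of `n` fields
`(∂_t - Δ) u^i = ζ^i + g(u^i, n⁻¹ ∑_j δ_{u^j_t})`, with initial conditions `u^i_0 = u₀ i`. -/
def IsSystemSolution {T α γ : ℝ} (g : Holder α → Measure (Holder α) → Holder γ) {n : ℕ}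
    (ζ : Fin n → PathSpace T (α - 2)) (u₀ : Fin n → Holder α) (u : Fin n → PathSpace T α) : Prop :=
  ∀ i, IsSolution g (ζ i) (u₀ i) (fun t => empiricalMeasure fun j => u j t) (u i)

/-- The random path `u` solves the mean field equation `(∂_t - Δ) u = ζ + g(u, 𝓛(u_t))` with random
noise `ζ` and random initial condition `u₀`: its law `μ` belongs to `𝒫_p(C_T C^α)` and almost
surely `u` solves `(∂_t - Δ) u = ζ + g(u, μ_t)`, where `μ_t` is the law of `u_t`. -/
def IsMeanFieldSolution {Ω : Type*} [MeasurableSpace Ω] {T α γ : ℝ} (P : Measure Ω) (p : ℝ)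
    (g : Holder α → Measure (Holder α) → Holder γ)
    (ζ : Ω → PathSpace T (α - 2)) (u₀ : Ω → Holder α) (u : Ω → PathSpace T α) : Prop :=
  Measurable u ∧ MemWasserstein p (P.map u) ∧
    ∀ᵐ ω ∂P, IsSolution g (ζ ω) (u₀ ω) (fun t => (P.map u).map fun v => v t) (u ω)

end MeanFieldSPDE

end

open MeasureTheory ProbabilityTheory Filter Topology
open scoped NNReal ENNReal

noncomputable section

namespace MeanFieldSPDE

open FourierTransform SchwartzMap

/-! ### Fourier multipliers on trigonometric polynomials -/

/-! The noise is additive, so in mild form each equation reads v = a + B(g(v, m)). Here a = A(ζ, u₀)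
solves the linear heat equation and B is the Duhamel operator from C_T C^γ to C_T C^α. All
randomness enters through the path a, and the argument becomes deterministic fixed point theory plus
a law of large numbers.

Analytic input. On the j-th dyadic block the heat semigroup decays like (1 + 4^j t)⁻², which yields
the Schauder estimate in `exists_duhamel_operator`. The full gain of two derivatives defines A
(`exists_heatSolution`). Since γ > α - 2, some gain is left over for B, and in the norm sup_t
e^{-lt}‖v_t‖ it becomes a factor l^{-δ} with δ > 0. For large l the map (v, law) ↦ B(g(v, law)) is
therefore Lipschitz with constant 1/4 in each argument (`exists_isContractiveDrift`,
`norm_damp_driftPath_sub_le`), over the whole of [0,T] at once. The distance of laws is the weighted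
L^p distance under any coupling. With the law frozen there is a Lipschitz solution map S, with v =
S(a) (`exists_solutionMap`). Letting the law vary, u ↦ S_u(a) contracts on L^p(Ω₀), and its fixed
point solves the mean field equation.

The system as a mean field equation. For a fixed realization, regard the label i as the random
element: on `Fin n` with the uniform measure, i ↦ u^{i,n} is a random path whose law is the
empirical measure. The interacting system is thus itself a mean field equation
(`isAbstractSystem_iff`), so its existence, uniqueness and continuous dependence on the inputs,
hence measurability, come from the same lemmas.

Chaos. Let μ be the law of u, and put w^i = S(a^i) with the flow of μ frozen. The w^i are
independent copies of u driven by the same inputs as the system. The contraction gives sup_i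
‖u^{i,n} - w^i‖ ≤ W in the weighted norm for every W above the Wasserstein distance on path space
between the empirical measure of w¹,…,wⁿ and μ (`norm_damp_system_sub_le`). That distance tends to 0
almost surely (`ae_tendsto_wassersteinDist_empiricalMeasure`), so u^{i,n} → w^i almost surely, and
dominated convergence gives the weak limit (`tendsto_integral_system`). -/

/-- The frequency space. -/
abbrev FreqSpace : Type := EuclideanSpace ℝ (Fin 2)

/-- A lattice frequency as an element of the frequency space. -/
def freqVec (k : Freq) : FreqSpace := WithLp.toLp 2 fun i => (k i : ℝ)

lemma norm_freqVec_sq (k : Freq) : ‖freqVec k‖ ^ 2 = freqSq k := by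
  rw [EuclideanSpace.norm_sq_eq]
  simp [freqVec, freqSq]

lemma norm_freqVec (k : Freq) : ‖freqVec k‖ = Real.sqrt (freqSq k) := by
  rw [← norm_freqVec_sq, Real.sqrt_sq (norm_nonneg _)]

lemma freqSq_neg (k : Freq) : freqSq (-k) = freqSq k := by
  simp [freqSq]

/-- A point of the plane as a point of the torus. -/
def toTorus (y : FreqSpace) : UnitAddTorus (Fin 2) := fun i => ((y i : ℝ) : UnitAddCircle)

lemma mFourier_sub_toTorus (k : Freq) (x : UnitAddTorus (Fin 2)) (y : FreqSpace) :
    UnitAddTorus.mFourier k (x - toTorus y) =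
      (Real.fourierChar (-inner ℝ y (freqVec k)) : ℂ) * UnitAddTorus.mFourier k x := by
  have h : ∀ i, fourier (k i) ((x - toTorus y) i) =
      Complex.exp (2 * Real.pi * Complex.I * (k i) * (-(y i) : ℝ)) * fourier (k i) (x i) := by
    intro i
    have h1 := fourier_coe_apply (T := 1) (n := k i) (x := -(y i))
    have h2 : (x - toTorus y) i = ((-(y i) : ℝ) : UnitAddCircle) + x i := by
      simp [toTorus, sub_eq_add_neg, add_comm]
    rw [h2, fourier_apply, smul_add, AddCircle.toCircle_add, Circle.coe_mul, ← fourier_apply,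
      ← fourier_apply, h1]
    simp
  simp only [UnitAddTorus.mFourier, ContinuousMap.coe_mk, h, Fin.prod_univ_two]
  rw [Real.fourierChar_apply, mul_mul_mul_comm, ← Complex.exp_add]
  congr 2
  rw [EuclideanSpace.inner_eq_star_dotProduct]
  simp [freqVec, dotProduct, Fin.sum_univ_two]
  ring

/-- The `L¹` norm of the inverse Fourier transform. -/
def multNorm (h : 𝓢(FreqSpace, ℂ)) : ℝ := ∫ y, ‖(𝓕⁻ h : 𝓢(FreqSpace, ℂ)) y‖

lemma multNorm_nonneg (h : 𝓢(FreqSpace, ℂ)) : 0 ≤ multNorm h :=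
  integral_nonneg fun _ => norm_nonneg _

/-- A Schwartz function, sampled at any scale, is a Fourier multiplier that is bounded on
trigonometric polynomials, uniformly in the scale. -/
lemma norm_sum_multiplier_le (h : 𝓢(FreqSpace, ℂ)) (ρ : ℝ) (s : Finset Freq) (a : Freq → ℂ)
    {B : ℝ} (hB : ∀ x, ‖∑ k ∈ s, a k * UnitAddTorus.mFourier k x‖ ≤ B)
    (x : UnitAddTorus (Fin 2)) :
    ‖∑ k ∈ s, h (ρ • freqVec k) * a k * UnitAddTorus.mFourier k x‖ ≤
      multNorm h * B := by
  set H : 𝓢(FreqSpace, ℂ) := 𝓕⁻ h with hHdef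
  have hH : Integrable H := H.integrable
  have hrep : ∀ ξ, h ξ = ∫ y, Real.fourierChar (-inner ℝ y ξ) • H y := by
    intro ξ
    rw [← Real.fourier_eq, ← SchwartzMap.fourier_coe, FourierTransform.fourier_fourierInv_eq]
  have hint : ∀ ξ, Integrable fun y => Real.fourierChar (-inner ℝ y ξ) • H y := by
    intro ξ
    refine hH.norm.mono' ?_ (Eventually.of_forall fun y => by simp)
    have : Continuous fun y : FreqSpace => Real.fourierChar (-inner ℝ y ξ) :=
      Real.continuous_fourierChar.comp (by fun_prop)
    exact (this.smul H.continuous).aestronglyMeasurable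
  -- The multiplier averages translates of the polynomial against the inverse Fourier transform of
  -- h. The scale ρ only changes the size of the translations, so the bound by the L¹ norm does not
  -- see it.
  have hsum : ∑ k ∈ s, h (ρ • freqVec k) * a k * UnitAddTorus.mFourier k x =
      ∫ y, H y * ∑ k ∈ s, a k * UnitAddTorus.mFourier k (x - toTorus (ρ • y)) := by
    simp_rw [Finset.mul_sum]
    rw [integral_finsetSum]
    · refine Finset.sum_congr rfl fun k _ => ?_
      rw [hrep, mul_assoc, ← integral_mul_const]
      refine integral_congr_ae (Eventually.of_forall fun y => ?_)
      simp only [mFourier_sub_toTorus, inner_smul_left, inner_smul_right, Circle.smul_def,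
        smul_eq_mul, conj_trivial]
      ring
    · intro k _
      refine ((hint (ρ • freqVec k)).mul_const (a k * UnitAddTorus.mFourier k x)).congr
        (Eventually.of_forall fun y => ?_)
      simp only [mFourier_sub_toTorus, inner_smul_left, inner_smul_right, Circle.smul_def,
        smul_eq_mul, conj_trivial]
      ring
  rw [hsum, multNorm, ← integral_mul_const]
  refine norm_integral_le_of_norm_le (hH.norm.mul_const B) (Eventually.of_forall fun y => ?_)
  rw [norm_mul]
  gcongr
  exact hB _

/-- Schwartz multipliers act on Littlewood-Paley blocks, uniformly in the scale. -/
lemma norm_lpBlock_multiplier_le (h : 𝓢(FreqSpace, ℂ)) (ρ : ℝ) (j : ℕ) (c : Freq → ℂ) :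
    ‖lpBlock j fun k => h (ρ • freqVec k) * c k‖ ≤ multNorm h * ‖lpBlock j c‖ := by
  refine (ContinuousMap.norm_le _ (mul_nonneg (multNorm_nonneg h) (norm_nonneg _))).2 fun x => ?_
  have := norm_sum_multiplier_le h ρ (lpBox j) (fun k => (lpWeight j k : ℂ) * c k)
    (B := ‖lpBlock j c‖) (fun x => (lpBlock j c).norm_coe_le_norm x) x
  rw [lpBlock_apply]
  refine (congrArg norm (Finset.sum_congr rfl fun k _ => ?_)).trans_le this
  ring

/-! ### Particular multipliers -/

/-- A smooth function on the line which equals `exp (-r)` for `r ≥ 0` and vanishes for `r ≤ -1`. -/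
def expCut (r : ℝ) : ℝ := Real.smoothTransition (r + 1) * Real.exp (-r)

lemma expCut_of_nonneg {r : ℝ} (hr : 0 ≤ r) : expCut r = Real.exp (-r) := by
  rw [expCut, Real.smoothTransition.one_of_one_le (by linarith), one_mul]

lemma contDiff_expCut {n : ℕ∞} : ContDiff ℝ n expCut := by
  unfold expCut
  exact (Real.smoothTransition.contDiff.comp (by fun_prop)).mul (by fun_prop)

lemma norm_iteratedDeriv_exp_neg (n : ℕ) (r : ℝ) :
    ‖iteratedDeriv n (fun r => Real.exp (-r)) r‖ = Real.exp (-r) := by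
  rw [iteratedDeriv_comp_neg n Real.exp r, iteratedDeriv_eq_iterate, Real.iter_deriv_exp,
    norm_smul]
  simp

/-- Only r > 1 needs an estimate: there every derivative has modulus e^{-r}, and r^k / k! ≤ e^r. The
function vanishes below -1, and compactness covers the range between. -/
lemma expCut_decay (k n : ℕ) : ∃ C, ∀ r, ‖r‖ ^ k * ‖iteratedFDeriv ℝ n expCut r‖ ≤ C := by
  have hcont : Continuous fun r : ℝ => ‖r‖ ^ k * ‖iteratedFDeriv ℝ n expCut r‖ :=
    (continuous_norm.pow k).mul
      ((contDiff_expCut (n := n)).continuous_iteratedFDeriv le_rfl).norm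
  obtain ⟨C, hC⟩ := (isCompact_Icc (a := (-2 : ℝ)) (b := 1)).exists_bound_of_continuousOn
    hcont.continuousOn
  refine ⟨max C (k.factorial), fun r => ?_⟩
  rcases lt_or_ge r (-1) with h | h
  · have : expCut =ᶠ[𝓝 r] fun _ => 0 := by
      filter_upwards [eventually_lt_nhds h] with s hs
      simp [expCut, Real.smoothTransition.zero_of_nonpos (show s + 1 ≤ 0 by linarith)]
    rw [(this.iteratedFDeriv ℝ n).self_of_nhds]
    have h0 : iteratedFDeriv ℝ n (fun _ : ℝ => (0 : ℝ)) r = 0 := by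
      have := iteratedFDeriv_fun_zero (𝕜 := ℝ) (E := ℝ) (F := ℝ) (n := n)
      exact congrFun this r
    rw [h0]
    simp only [norm_zero, mul_zero]
    positivity
  rcases le_or_gt r 1 with h' | h'
  · exact ((le_abs_self _).trans (hC r ⟨by linarith, h'⟩)).trans (le_max_left _ _)
  · have : expCut =ᶠ[𝓝 r] fun r => Real.exp (-r) := by
      filter_upwards [eventually_gt_nhds (show 0 < r by linarith)] with s hs
      exact expCut_of_nonneg hs.le
    rw [(this.iteratedFDeriv ℝ n).self_of_nhds, norm_iteratedFDeriv_eq_norm_iteratedDeriv,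
      norm_iteratedDeriv_exp_neg]
    refine le_max_of_le_right ?_
    have hr : 0 ≤ r := by linarith
    rw [Real.norm_of_nonneg hr, Real.exp_neg, ← div_eq_mul_inv, div_le_iff₀ (Real.exp_pos _)]
    have := Real.pow_div_factorial_le_exp r hr k
    rwa [div_le_iff₀' (by positivity)] at this

/-- `expCut` as a complex Schwartz function. -/
def expCutSchwartz : 𝓢(ℝ, ℂ) :=
  SchwartzMap.postcompCLM Complex.ofRealCLM
    { toFun := expCut, smooth' := contDiff_expCut, decay' := expCut_decay }

lemma expCutSchwartz_apply (r : ℝ) : expCutSchwartz r = (expCut r : ℂ) := rfl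

/-- The Gaussian `exp (-‖ξ‖²)`. -/
def gaussianSchwartz : 𝓢(FreqSpace, ℂ) :=
  SchwartzMap.compCLM ℝ (g := fun ξ : FreqSpace => ‖ξ‖ ^ 2)
    (Function.hasTemperateGrowth_norm_sq _)
    ⟨1, 1, fun x => by simp; nlinarith [sq_nonneg (‖x‖ - 1), norm_nonneg x]⟩ expCutSchwartz

lemma gaussianSchwartz_apply (ξ : FreqSpace) :
    gaussianSchwartz ξ = (Real.exp (-‖ξ‖ ^ 2) : ℂ) := by
  rw [gaussianSchwartz, SchwartzMap.compCLM_apply, Function.comp_apply, expCutSchwartz_apply,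
    expCut_of_nonneg (by positivity)]

/-- The function `‖ξ‖⁴ exp (-‖ξ‖²)`. -/
def gaussianFourSchwartz : 𝓢(FreqSpace, ℂ) :=
  SchwartzMap.smulLeftCLM ℂ (fun ξ : FreqSpace => (‖ξ‖ ^ 2) ^ 2) gaussianSchwartz

lemma gaussianFourSchwartz_apply (ξ : FreqSpace) :
    gaussianFourSchwartz ξ = ((‖ξ‖ ^ 2) ^ 2 * Real.exp (-‖ξ‖ ^ 2) : ℝ) := by
  have hg : Function.HasTemperateGrowth fun ξ : FreqSpace => (‖ξ‖ ^ 2) ^ 2 :=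
    (Function.hasTemperateGrowth_norm_sq _).pow 2
  rw [gaussianFourSchwartz, SchwartzMap.smulLeftCLM_apply_apply hg, gaussianSchwartz_apply]
  simp

/-- A smooth bump function that equals `1` on the unit ball. -/
def bump : ContDiffBump (0 : FreqSpace) := ⟨1, 2, one_pos, one_lt_two⟩

/-- The bump function as a Schwartz function. -/
def bumpSchwartz : 𝓢(FreqSpace, ℂ) :=
  SchwartzMap.postcompCLM Complex.ofRealCLM
    (bump.hasCompactSupport.toSchwartzMap bump.contDiff)

lemma bump_eq_one {ξ : FreqSpace} (h : ‖ξ‖ ≤ 1) : bump ξ = 1 :=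
  bump.one_of_mem_closedBall (mem_closedBall_zero_iff.2 h)

lemma bump_eq_zero {ξ : FreqSpace} (h : 2 ≤ ‖ξ‖) : bump ξ = 0 :=
  bump.zero_of_le_dist (by rw [dist_zero_right]; exact h)

/-- A smooth function with compact support that equals `‖ξ‖⁻⁴` for `1 ≤ ‖ξ‖ ≤ 4`. -/
def annulusFun (ξ : FreqSpace) : ℝ :=
  bump ((4 : ℝ)⁻¹ • ξ) * (1 - bump ((2 : ℝ) • ξ)) * ((‖ξ‖ ^ 2) ^ 2)⁻¹

/-- After rescaling, every block except the lowest lives on the annulus 1 ≤ ‖ξ‖ ≤ 4. Division by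
‖ξ‖⁴ is a Schwartz multiplier there, which turns frequency size into decay in time. -/
lemma annulusFun_mul {ξ : FreqSpace} (h1 : 1 ≤ ‖ξ‖) (h4 : ‖ξ‖ ≤ 4) :
    annulusFun ξ * (‖ξ‖ ^ 2) ^ 2 = 1 := by
  rw [annulusFun, bump_eq_one, bump_eq_zero]
  · have : ‖ξ‖ ≠ 0 := by linarith
    field_simp
    simp
  · rw [norm_smul]; norm_num; linarith
  · rw [norm_smul]; norm_num; linarith

/-- Near the origin the factor 1 - bump(2ξ) vanishes identically; away from it the inverse power of
the norm is smooth. -/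
lemma contDiff_annulusFun {n : ℕ∞} : ContDiff ℝ n annulusFun := by
  rw [contDiff_iff_contDiffAt]
  intro ξ
  by_cases h : ξ = 0
  · have : annulusFun =ᶠ[𝓝 ξ] fun _ => 0 := by
      filter_upwards [Metric.ball_mem_nhds ξ (show (0 : ℝ) < 1 / 2 by norm_num)] with η hη
      rw [h, mem_ball_zero_iff] at hη
      rw [annulusFun, bump_eq_one (ξ := (2 : ℝ) • η)]
      · simp
      · rw [norm_smul]; norm_num; linarith
    exact contDiffAt_const.congr_of_eventuallyEq this
  · have h' : (‖ξ‖ ^ 2) ^ 2 ≠ 0 := by simpa using h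
    have hb : ∀ a : ℝ, ContDiffAt ℝ n (fun ξ : FreqSpace => bump (a • ξ)) ξ := fun a =>
      (bump.contDiff.comp (contDiff_const_smul a)).contDiffAt
    unfold annulusFun
    exact ((hb _).mul (contDiffAt_const.sub (hb _))).mul
      ((((contDiff_norm_sq ℝ).pow 2).contDiffAt).inv h')

lemma hasCompactSupport_annulusFun : HasCompactSupport annulusFun := by
  refine HasCompactSupport.of_support_subset_isCompact
    (isCompact_closedBall (0 : FreqSpace) 8) fun ξ hξ => ?_
  by_contra hcon
  apply hξ
  rw [mem_closedBall_zero_iff, not_le] at hcon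
  rw [annulusFun, bump_eq_zero (ξ := (4 : ℝ)⁻¹ • ξ)]
  · simp
  · rw [norm_smul]; norm_num; linarith

/-- `annulusFun` as a Schwartz function. -/
def annulusSchwartz : 𝓢(FreqSpace, ℂ) :=
  SchwartzMap.postcompCLM Complex.ofRealCLM
    (hasCompactSupport_annulusFun.toSchwartzMap contDiff_annulusFun)

lemma annulusSchwartz_apply (ξ : FreqSpace) : annulusSchwartz ξ = (annulusFun ξ : ℂ) := rfl

/-! ### Littlewood-Paley blocks -/

lemma lpBlock_congr {j : ℕ} {c d : Freq → ℂ} (h : ∀ k, lpWeight j k ≠ 0 → c k = d k) :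
    lpBlock j c = lpBlock j d := by
  ext x
  rw [lpBlock_apply, lpBlock_apply]
  refine Finset.sum_congr rfl fun k _ => ?_
  by_cases hk : lpWeight j k = 0
  · simp [hk]
  · rw [h k hk]

lemma cutoff_of_le_one {r : ℝ} (hr : r ≤ 1) : cutoff r = 1 :=
  Real.smoothTransition.one_of_one_le (by linarith)

lemma cutoff_of_two_le {r : ℝ} (hr : 2 ≤ r) : cutoff r = 0 :=
  Real.smoothTransition.zero_of_nonpos (by linarith)

lemma norm_freqVec_mem_of_lpWeight_ne_zero {j : ℕ} {k : Freq} (h : lpWeight (j + 1) k ≠ 0) :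
    2 ^ j ≤ ‖freqVec k‖ ∧ ‖freqVec k‖ ≤ 4 * 2 ^ j := by
  rw [norm_freqVec]
  constructor
  · by_contra! hlt
    apply h
    rw [lpWeight, cutoff_of_le_one, cutoff_of_le_one, sub_self]
    · rw [div_le_one (by positivity)]; exact hlt.le
    · rw [div_le_one (by positivity)]
      exact hlt.le.trans (pow_le_pow_right₀ one_le_two (Nat.le_succ j))
  · by_contra! hlt
    apply h
    rw [lpWeight, cutoff_of_two_le, cutoff_of_two_le, sub_self]
    · rw [le_div_iff₀ (by positivity)]
      linarith [pow_pos (zero_lt_two' ℝ) j]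
    · rw [le_div_iff₀ (by positivity), pow_succ]
      linarith

lemma abs_lpWeight_le_one (j : ℕ) (k : Freq) : |lpWeight j k| ≤ 1 := by
  have h0 : ∀ r, 0 ≤ cutoff r := fun r => Real.smoothTransition.nonneg _
  have h1 : ∀ r, cutoff r ≤ 1 := fun r => Real.smoothTransition.le_one _
  cases j with
  | zero => rw [lpWeight, abs_of_nonneg (h0 _)]; exact h1 _
  | succ j =>
    rw [lpWeight, abs_le]
    constructor <;> linarith [h0 (Real.sqrt (freqSq k) / 2 ^ (j + 1)),
      h1 (Real.sqrt (freqSq k) / 2 ^ (j + 1)), h0 (Real.sqrt (freqSq k) / 2 ^ j),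
      h1 (Real.sqrt (freqSq k) / 2 ^ j)]

lemma norm_mFourier_apply_le (k : Freq) (x : UnitAddTorus (Fin 2)) :
    ‖UnitAddTorus.mFourier k x‖ ≤ 1 :=
  ((UnitAddTorus.mFourier k).norm_coe_le_norm x).trans_eq UnitAddTorus.mFourier_norm

lemma norm_lpBlock_le_sum_lpBox (j : ℕ) (c : Freq → ℂ) :
    ‖lpBlock j c‖ ≤ ∑ k ∈ lpBox j, ‖c k‖ := by
  refine (ContinuousMap.norm_le _ (Finset.sum_nonneg fun _ _ => norm_nonneg _)).2 fun x => ?_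
  rw [lpBlock_apply]
  refine norm_sum_le_of_le _ fun k _ => ?_
  rw [norm_mul, norm_mul, Complex.norm_real, Real.norm_eq_abs]
  calc |lpWeight j k| * ‖c k‖ * ‖UnitAddTorus.mFourier k x‖ ≤ 1 * ‖c k‖ * 1 := by
        gcongr
        · exact abs_lpWeight_le_one j k
        · exact norm_mFourier_apply_le k x
    _ = ‖c k‖ := by ring

lemma norm_lpBlock_le_sum (j : ℕ) (c : Freq → ℂ) (s : Finset Freq) (hs : ∀ k ∉ s, c k = 0) :
    ‖lpBlock j c‖ ≤ ∑ k ∈ s, ‖c k‖ :=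
  calc ‖lpBlock j c‖ ≤ ∑ k ∈ lpBox j, ‖c k‖ := norm_lpBlock_le_sum_lpBox j c
    _ ≤ ∑ k ∈ lpBox j ∪ s, ‖c k‖ :=
      Finset.sum_le_sum_of_subset_of_nonneg Finset.subset_union_left fun _ _ _ => norm_nonneg _
    _ = ∑ k ∈ s, ‖c k‖ := by
      refine (Finset.sum_subset Finset.subset_union_right fun k _ hk => ?_).symm
      rw [hs k hk, norm_zero]

/-- The coefficients of a trigonometric polynomial are bounded by its sup norm. -/
lemma norm_coeff_le_of_sum_mFourier (s : Finset Freq) (a : Freq → ℂ)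
    (f : C(UnitAddTorus (Fin 2), ℂ)) (hf : ∀ x, f x = ∑ k ∈ s, a k * UnitAddTorus.mFourier k x)
    (k : Freq) (hk : k ∈ s) : ‖a k‖ ≤ ‖f‖ := by
  let _ : MeasureSpace UnitAddCircle := ⟨AddCircle.haarAddCircle⟩
  have _ : IsProbabilityMeasure (volume : Measure UnitAddCircle) :=
    inferInstanceAs (IsProbabilityMeasure AddCircle.haarAddCircle)
  have ho := UnitAddTorus.orthonormal_mFourier (d := Fin 2)
  have h0 : f = ∑ i ∈ s, a i • UnitAddTorus.mFourier i := by
    ext x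
    rw [ContinuousMap.sum_apply]
    exact hf x
  have h1 := congrArg (ContinuousMap.toLp (E := ℂ) 2
    (volume : Measure (UnitAddTorus (Fin 2))) ℂ) h0
  rw [map_sum] at h1
  have h2 : (ContinuousMap.toLp (E := ℂ) 2 (volume : Measure (UnitAddTorus (Fin 2))) ℂ) f =
      ∑ i ∈ s, a i • UnitAddTorus.mFourierLp 2 i := by
    rw [h1]
    exact Finset.sum_congr rfl fun i _ => map_smul _ _ _
  -- The coefficient is an inner product with a unit vector, and the L² norm is at most the sup norm
  -- because Haar measure is a probability.
  have h3 := ho.inner_right_sum a hk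
  rw [← h3]
  refine (norm_inner_le_norm _ _).trans ?_
  rw [ho.1 k, one_mul, ← h2]
  refine (ContinuousLinearMap.le_opNorm _ _).trans ?_
  refine (mul_le_mul_of_nonneg_right (ContinuousMap.toLp_norm_le _) (norm_nonneg f)).trans ?_
  simp [measureUnivNNReal]

lemma norm_lpWeight_mul_le (j : ℕ) (c : Freq → ℂ) (k : Freq) :
    ‖(lpWeight j k : ℂ) * c k‖ ≤ ‖lpBlock j c‖ := by
  by_cases hk : k ∈ lpBox j
  · exact norm_coeff_le_of_sum_mFourier (lpBox j) (fun k => (lpWeight j k : ℂ) * c k) _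
      (fun x => lpBlock_apply j c x) k hk
  · simp [lpWeight_eq_zero hk]

lemma norm_lpBlock_le_of_besovTerm_le {γ : ℝ} {c : Freq → ℂ} {j : ℕ} {B : ℝ}
    (h : besovTerm γ c j ≤ B) : ‖lpBlock j c‖ ≤ (2 : ℝ) ^ (-(((j : ℝ) - 1) * γ)) * B := by
  rw [besovTerm] at h
  rw [Real.rpow_neg two_pos.le, ← div_eq_inv_mul, le_div_iff₀' (by positivity)]
  exact h

/-- A Fourier coefficient is controlled by the Besov norm. -/
lemma exists_norm_coeff_le (γ : ℝ) (k : Freq) : ∃ C, 0 ≤ C ∧ ∀ (c : Freq → ℂ) (B : ℝ),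
    (∀ j, besovTerm γ c j ≤ B) → ‖c k‖ ≤ C * B := by
  obtain ⟨J, hJ⟩ := pow_unbounded_of_one_lt (Real.sqrt (freqSq k)) (one_lt_two (α := ℝ))
  refine ⟨∑ j ∈ Finset.range (J + 1), (2 : ℝ) ^ (-(((j : ℝ) - 1) * γ)), by positivity,
    fun c B hB => ?_⟩
  -- Since 2^J exceeds |k|, the first J + 1 weights already sum to 1 at k, so finitely many blocks
  -- recover the coefficient.
  have hsum : ∑ j ∈ Finset.range (J + 1), (lpWeight j k : ℂ) = 1 := by
    rw [← Complex.ofReal_sum, sum_lpWeight, cutoff_of_le_one, Complex.ofReal_one]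
    exact (div_le_one (by positivity)).2 hJ.le
  rw [← one_mul (c k), ← hsum, Finset.sum_mul, Finset.sum_mul]
  exact norm_sum_le_of_le _ fun j _ =>
    (norm_lpWeight_mul_le j c k).trans (norm_lpBlock_le_of_besovTerm_le (hB j))

/-- For finitely supported families the Besov norm is controlled by the coefficients. -/
lemma exists_besovTerm_le_sum (γ : ℝ) (s : Finset Freq) : ∃ C, 0 ≤ C ∧ ∀ (c : Freq → ℂ),
    (∀ k ∉ s, c k = 0) → ∀ j, besovTerm γ c j ≤ C * ∑ k ∈ s, ‖c k‖ := by
  obtain ⟨J, hJ⟩ := pow_unbounded_of_one_lt (∑ k ∈ s, ‖freqVec k‖) (one_lt_two (α := ℝ))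
  refine ⟨∑ j ∈ Finset.range (J + 1), (2 : ℝ) ^ (((j : ℝ) - 1) * γ), by positivity,
    fun c hc j => ?_⟩
  have h0 : 0 ≤ ∑ k ∈ s, ‖c k‖ := Finset.sum_nonneg fun _ _ => norm_nonneg _
  rcases lt_or_ge j (J + 1) with hj | hj
  · rw [besovTerm]
    gcongr
    · exact Finset.single_le_sum (f := fun j : ℕ => (2 : ℝ) ^ (((j : ℝ) - 1) * γ))
        (fun _ _ => by positivity) (Finset.mem_range.2 hj)
    · exact norm_lpBlock_le_sum j c s hc
  · have : lpBlock j c = 0 := by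
      rw [← lpBlock_zero j]
      refine lpBlock_congr fun k hk => ?_
      by_contra hck
      have hks : k ∈ s := by
        by_contra h
        exact hck (hc k h)
      obtain ⟨i, rfl⟩ : ∃ i, j = i + 1 := ⟨j - 1, by omega⟩
      have h1 := (norm_freqVec_mem_of_lpWeight_ne_zero hk).1
      have h2 : ‖freqVec k‖ ≤ ∑ k ∈ s, ‖freqVec k‖ :=
        Finset.single_le_sum (f := fun k => ‖freqVec k‖) (fun _ _ => norm_nonneg _) hks
      have h3 : (2 : ℝ) ^ J ≤ 2 ^ i := pow_le_pow_right₀ one_le_two (by omega)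
      linarith
    rw [besovTerm, this, norm_zero, mul_zero]
    positivity

/-! ### The heat semigroup on Littlewood-Paley blocks -/

/-- One fixed Schwartz function sampled at scale 2π√t: the scale-uniform multiplier bound becomes a
bound uniform in time. -/
lemma heatSymbol_eq_gaussian {t : ℝ} (ht : 0 ≤ t) (k : Freq) :
    heatSymbol t k = gaussianSchwartz ((2 * Real.pi * Real.sqrt t) • freqVec k) := by
  rw [gaussianSchwartz_apply, heatSymbol, norm_smul, mul_pow, norm_freqVec_sq, Real.norm_eq_abs,
    sq_abs, mul_pow, Real.sq_sqrt ht]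
  congr 3
  ring

lemma norm_lpBlock_heat_le {t : ℝ} (ht : 0 ≤ t) (j : ℕ) (c : Freq → ℂ) :
    ‖lpBlock j fun k => heatSymbol t k * c k‖ ≤ multNorm gaussianSchwartz * ‖lpBlock j c‖ := by
  simp_rw [heatSymbol_eq_gaussian ht]
  exact norm_lpBlock_multiplier_le _ _ _ _

/-- On the block, (4^j t)² e^{-4π²|k|²t} is (4π²)⁻² times ‖ξ‖⁴e^{-‖ξ‖²} at ξ = 2π√t k, times ‖η‖⁻⁴
at η = 2^{-j}k. Each factor is a Schwartz multiplier at its own scale. -/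
lemma sq_mul_norm_lpBlock_heat_le {t : ℝ} (ht : 0 ≤ t) (j : ℕ) (c : Freq → ℂ) :
    (4 ^ j * t) ^ 2 * ‖lpBlock (j + 1) fun k => heatSymbol t k * c k‖ ≤
      multNorm gaussianFourSchwartz * multNorm annulusSchwartz * ‖lpBlock (j + 1) c‖ := by
  have h1 : (4 ^ j * t) ^ 2 * ‖lpBlock (j + 1) fun k => heatSymbol t k * c k‖ =
      ‖lpBlock (j + 1) ((4 ^ j * t) ^ 2 • fun k => heatSymbol t k * c k)‖ := by
    rw [lpBlock_smul, norm_smul, Real.norm_of_nonneg (by positivity)]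
  have h2 : lpBlock (j + 1) ((4 ^ j * t) ^ 2 • fun k => heatSymbol t k * c k) =
      lpBlock (j + 1) (((4 * Real.pi ^ 2) ^ 2)⁻¹ • fun k =>
        gaussianFourSchwartz ((2 * Real.pi * Real.sqrt t) • freqVec k) *
          (annulusSchwartz (((2 : ℝ) ^ j)⁻¹ • freqVec k) * c k)) := by
    refine lpBlock_congr fun k hk => ?_
    obtain ⟨hk1, hk2⟩ := norm_freqVec_mem_of_lpWeight_ne_zero hk
    have hn : ‖((2 : ℝ) ^ j)⁻¹ • freqVec k‖ = ‖freqVec k‖ / 2 ^ j := by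
      rw [norm_smul, norm_inv, norm_pow, Real.norm_two, div_eq_inv_mul]
    have ha := annulusFun_mul (ξ := ((2 : ℝ) ^ j)⁻¹ • freqVec k)
      (by rw [hn]; exact (one_le_div (by positivity)).2 hk1)
      (by rw [hn]; exact (div_le_iff₀ (by positivity)).2 hk2)
    rw [hn, div_pow, norm_freqVec_sq] at ha
    have h4 : ((2 : ℝ) ^ j) ^ 2 = 4 ^ j := by rw [← pow_mul, mul_comm, pow_mul]; norm_num
    rw [h4] at ha
    have hsq : ‖(2 * Real.pi * Real.sqrt t) • freqVec k‖ ^ 2 =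
        (2 * Real.pi) ^ 2 * t * freqSq k := by
      rw [norm_smul, mul_pow, norm_freqVec_sq, Real.norm_eq_abs, sq_abs, mul_pow, Real.sq_sqrt ht]
    simp only [Pi.smul_apply, Complex.real_smul]
    rw [heatSymbol_eq_gaussian ht, gaussianFourSchwartz_apply, gaussianSchwartz_apply,
      annulusSchwartz_apply, hsq, ← mul_assoc, ← mul_assoc, ← mul_assoc]
    congr 1
    set E := Real.exp (-((2 * Real.pi) ^ 2 * t * freqSq k))
    set A := annulusFun (((2 : ℝ) ^ j)⁻¹ • freqVec k)
    have hpi := Real.pi_ne_zero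
    have hA : A * freqSq k ^ 2 = (4 ^ j) ^ 2 := by
      field_simp at ha
      linarith
    rw [← Complex.ofReal_mul, ← Complex.ofReal_mul, ← Complex.ofReal_mul]
    congr 1
    calc (4 ^ j * t) ^ 2 * E = A * freqSq k ^ 2 * t ^ 2 * E := by rw [← hA.symm]; ring
      _ = _ := by field_simp; ring
  rw [h1, h2, lpBlock_smul, norm_smul]
  have hpi : ‖((4 * Real.pi ^ 2) ^ 2)⁻¹‖ ≤ 1 := by
    rw [Real.norm_of_nonneg (by positivity)]
    refine inv_le_one_of_one_le₀ (one_le_pow₀ ?_)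
    nlinarith [Real.pi_gt_three]
  calc _ ≤ 1 * (multNorm gaussianFourSchwartz * (multNorm annulusSchwartz *
        ‖lpBlock (j + 1) c‖)) := by
        gcongr
        refine (norm_lpBlock_multiplier_le _ _ _ _).trans ?_
        exact mul_le_mul_of_nonneg_left (norm_lpBlock_multiplier_le _ _ _ _) (multNorm_nonneg _)
    _ = _ := by ring

/-- The decay of the heat semigroup on Littlewood-Paley blocks. -/
lemma exists_norm_lpBlock_heat_le (T : ℝ) : ∃ C, 0 ≤ C ∧ ∀ t, 0 ≤ t → t ≤ T →
    ∀ (j : ℕ) (c : Freq → ℂ), ‖lpBlock j fun k => heatSymbol t k * c k‖ ≤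
      C * ((1 + 4 ^ j * t) ^ 2)⁻¹ * ‖lpBlock j c‖ := by
  set C₁ := multNorm gaussianSchwartz
  set C₂ := multNorm gaussianFourSchwartz * multNorm annulusSchwartz
  have hC₁ : 0 ≤ C₁ := multNorm_nonneg _
  have hC₂ : 0 ≤ C₂ := mul_nonneg (multNorm_nonneg _) (multNorm_nonneg _)
  -- The first two terms come from (1 + 4x)² ≤ 2 + 32x² with x = 4^j t on block j + 1. The last
  -- serves the lowest block, where there is no decay and t ≤ T is used instead.
  refine ⟨2 * C₁ + 32 * C₂ + (1 + T) ^ 2 * C₁, by positivity, fun t ht htT j c => ?_⟩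
  have hx : 0 < (1 + 4 ^ j * t) ^ 2 := by positivity
  set N := ‖lpBlock j fun k => heatSymbol t k * c k‖
  have h1 : N ≤ C₁ * ‖lpBlock j c‖ := norm_lpBlock_heat_le ht j c
  suffices (1 + 4 ^ j * t) ^ 2 * N ≤
      (2 * C₁ + 32 * C₂ + (1 + T) ^ 2 * C₁) * ‖lpBlock j c‖ by
    rw [mul_right_comm, ← div_eq_mul_inv, le_div_iff₀' hx]
    exact this
  have hb := norm_nonneg (lpBlock j c)
  have hN : 0 ≤ N := norm_nonneg _
  cases j with
  | zero =>
    have h2 : (1 + 4 ^ 0 * t) ^ 2 * N ≤ (1 + T) ^ 2 * (C₁ * ‖lpBlock 0 c‖) := by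
      rw [pow_zero, one_mul]
      gcongr
    nlinarith [mul_nonneg hC₁ hb, mul_nonneg hC₂ hb]
  | succ j =>
    have h2 := sq_mul_norm_lpBlock_heat_le ht j c
    have h3 : (1 + 4 ^ (j + 1) * t) ^ 2 ≤ 2 + 32 * (4 ^ j * t) ^ 2 := by
      have h4 : (4 : ℝ) ^ (j + 1) * t = 4 * (4 ^ j * t) := by ring
      rw [h4]
      nlinarith [sq_nonneg (1 - 4 * (4 ^ j * t))]
    calc (1 + 4 ^ (j + 1) * t) ^ 2 * N ≤ (2 + 32 * (4 ^ j * t) ^ 2) * N := by gcongr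
      _ = 2 * N + 32 * ((4 ^ j * t) ^ 2 * N) := by ring
      _ ≤ 2 * (C₁ * ‖lpBlock (j + 1) c‖) + 32 * (C₂ * ‖lpBlock (j + 1) c‖) := by gcongr
      _ ≤ _ := by nlinarith [mul_nonneg (mul_nonneg (sq_nonneg (1 + T)) hC₁) hb]

/-! ### Smooth low-pass filters -/

/-- The smooth projection onto frequencies of size at most of the order of `2 ^ J`. -/
def lowPass (J : ℕ) (c : Freq → ℂ) : Freq → ℂ :=
  fun k => (bump (((2 : ℝ) ^ J)⁻¹ • freqVec k) : ℂ) * c k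

lemma besovTerm_lowPass_le (γ : ℝ) (J : ℕ) (c : Freq → ℂ) (j : ℕ) :
    besovTerm γ (lowPass J c) j ≤ multNorm bumpSchwartz * besovTerm γ c j := by
  have := norm_lpBlock_multiplier_le bumpSchwartz ((2 : ℝ) ^ J)⁻¹ j c
  rw [besovTerm, besovTerm, mul_left_comm]
  gcongr
  exact this

lemma lowPass_apply_eq_zero {J : ℕ} (c : Freq → ℂ) {k : Freq} (hk : k ∉ lpBox J) :
    lowPass J c k = 0 := by
  have key : (2 : ℝ) ^ (J + 1) ≤ Real.sqrt (freqSq k) := by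
    by_contra! hlt
    apply hk
    have hlt' : freqSq k < ((2 : ℝ) ^ (J + 1)) ^ 2 := (Real.sqrt_lt' (by positivity)).1 hlt
    rw [lpBox, Finset.mem_Icc]
    have := fun i => abs_le.1 (abs_le_of_freqSq_lt (by positivity) hlt' i)
    exact ⟨fun i => by exact_mod_cast (this i).1, fun i => by exact_mod_cast (this i).2⟩
  rw [lowPass, bump_eq_zero]
  · simp
  · rw [norm_smul, norm_inv, norm_pow, Real.norm_two, norm_freqVec, ← div_eq_inv_mul,
      le_div_iff₀ (by positivity), ← pow_succ']
    exact key

lemma exists_lowPass_eq {c : Freq → ℂ} (hc : (Function.support c).Finite) :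
    ∃ J₀, ∀ J ≥ J₀, lowPass J c = c := by
  obtain ⟨J₀, hJ₀⟩ := pow_unbounded_of_one_lt (∑ k ∈ hc.toFinset, ‖freqVec k‖)
    (one_lt_two (α := ℝ))
  refine ⟨J₀, fun J hJ => funext fun k => ?_⟩
  by_cases hk : c k = 0
  · simp [lowPass, hk]
  · have h2 : ‖freqVec k‖ ≤ ∑ k ∈ hc.toFinset, ‖freqVec k‖ :=
      Finset.single_le_sum (f := fun k => ‖freqVec k‖) (fun _ _ => norm_nonneg _)
        (hc.mem_toFinset.2 hk)
    have h3 : (2 : ℝ) ^ J₀ ≤ 2 ^ J := pow_le_pow_right₀ one_le_two hJ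
    rw [lowPass, bump_eq_one]
    · simp
    · rw [norm_smul, norm_inv, norm_pow, Real.norm_two, ← div_eq_inv_mul,
        div_le_one (by positivity)]
      linarith

lemma freqVec_neg (k : Freq) : freqVec (-k) = -freqVec k := by
  ext i
  simp [freqVec]

lemma lowPass_neg {c : Freq → ℂ} (hc : ∀ k, c (-k) = star (c k)) (J : ℕ) (k : Freq) :
    lowPass J c (-k) = star (lowPass J c k) := by
  rw [lowPass, lowPass, hc, freqVec_neg, smul_neg, bump.neg]
  simp

/-! ### Completeness of Besov spaces and separability of trigonometric polynomials -/

namespace Besov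

variable {γ : ℝ}

lemma ext_coeff {x y : Besov γ} (h : x.coeff = y.coeff) : x = y := Subtype.ext h

lemma coeff_sub (x y : Besov γ) : (x - y).coeff = x.coeff - y.coeff := rfl

lemma coeff_neg_freq (x : Besov γ) (k : Freq) : x.coeff (-k) = star (x.coeff k) := x.2.1 k

lemma besovTerm_le_norm (x : Besov γ) (j : ℕ) : besovTerm γ x.coeff j ≤ ‖x‖ :=
  le_ciSup x.bddAbove j

lemma norm_le {x : Besov γ} {B : ℝ} (h : ∀ j, besovTerm γ x.coeff j ≤ B) : ‖x‖ ≤ B :=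
  ciSup_le h

/-- The element of the Besov space with given Fourier coefficients. -/
def ofCoeff (c : Freq → ℂ) (hc : ∀ k, c (-k) = star (c k))
    (hb : BddAbove (Set.range (besovTerm γ c))) : Besov γ := ⟨c, hc, hb⟩

lemma coeff_ofCoeff (c : Freq → ℂ) (hc : ∀ k, c (-k) = star (c k))
    (hb : BddAbove (Set.range (besovTerm γ c))) : (ofCoeff c hc hb).coeff = c := rfl

lemma exists_lipschitzWith_coeff (k : Freq) :
    ∃ C, LipschitzWith C fun x : Besov γ => x.coeff k := by
  obtain ⟨C, hC, h⟩ := exists_norm_coeff_le γ k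
  refine ⟨C.toNNReal, LipschitzWith.of_dist_le_mul fun x y => ?_⟩
  rw [dist_eq_norm, dist_eq_norm, Real.coe_toNNReal _ hC]
  exact h (x - y).coeff ‖x - y‖ (besovTerm_le_norm _)

lemma continuous_coeff (k : Freq) : Continuous fun x : Besov γ => x.coeff k :=
  (exists_lipschitzWith_coeff k).choose_spec.continuous

/-- A family in the Besov space with uniformly finite spectrum is continuous when its coefficients
are. -/
lemma continuous_of_coeff {X : Type*} [TopologicalSpace X] {f : X → Besov γ} (s : Finset Freq)
    (hs : ∀ x, ∀ k ∉ s, (f x).coeff k = 0) (hc : ∀ k, Continuous fun x => (f x).coeff k) :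
    Continuous f := by
  obtain ⟨C, -, h⟩ := exists_besovTerm_le_sum γ s
  rw [continuous_iff_continuousAt]
  intro x
  rw [ContinuousAt, tendsto_iff_norm_sub_tendsto_zero]
  have hlim : Tendsto (fun y => C * ∑ k ∈ s, ‖(f y).coeff k - (f x).coeff k‖) (𝓝 x) (𝓝 0) := by
    have : Continuous fun y => C * ∑ k ∈ s, ‖(f y).coeff k - (f x).coeff k‖ := by
      refine continuous_const.mul (continuous_finsetSum _ fun k _ => ?_)
      exact ((hc k).sub continuous_const).norm
    simpa using this.tendsto x
  refine squeeze_zero (fun _ => norm_nonneg _) (fun y => norm_le fun j => ?_) hlim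
  refine h _ (fun k hk => ?_) j
  rw [coeff_sub, Pi.sub_apply, hs y k hk, hs x k hk, sub_zero]

/-- A block involves finitely many frequencies, so each term of the norm is continuous under
coefficientwise convergence. This carries Besov bounds to limits. -/
lemma tendsto_besovTerm {ι : Type*} {l : Filter ι} {c : ι → Freq → ℂ} {d : Freq → ℂ}
    (h : ∀ k, Tendsto (fun i => c i k) l (𝓝 (d k))) (j : ℕ) :
    Tendsto (fun i => besovTerm γ (c i) j) l (𝓝 (besovTerm γ d j)) := by
  rw [tendsto_iff_norm_sub_tendsto_zero]
  have hlim : Tendsto (fun i => (2 : ℝ) ^ (((j : ℝ) - 1) * γ) * ∑ k ∈ lpBox j, ‖c i k - d k‖) l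
      (𝓝 0) := by
    have := (tendsto_finsetSum (lpBox j) fun k _ => tendsto_iff_norm_sub_tendsto_zero.1
      (h k)).const_mul ((2 : ℝ) ^ (((j : ℝ) - 1) * γ))
    simpa using this
  refine squeeze_zero (fun _ => norm_nonneg _) (fun i => ?_) hlim
  have hsub : lpBlock j (c i) - lpBlock j d = lpBlock j (c i - d) := by
    rw [sub_eq_iff_eq_add, ← lpBlock_add, sub_add_cancel]
  rw [besovTerm, besovTerm, ← mul_sub, norm_mul, Real.norm_of_nonneg (by positivity)]
  gcongr
  rw [Real.norm_eq_abs]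
  refine (abs_norm_sub_norm_le _ _).trans ?_
  rw [hsub]
  exact norm_lpBlock_le_sum_lpBox j (c i - d)

/-- The limit is built coefficient by coefficient; letting m → ∞ in each Besov term of x_n - x_m,
uniformly in the block index, gives both its membership and the convergence in norm. -/
lemma exists_tendsto_of_cauchySeq {x : ℕ → Besov γ} (hx : CauchySeq x) :
    ∃ y, Tendsto x atTop (𝓝 y) := by
  have hlim : ∀ k, ∃ z, Tendsto (fun n => (x n).coeff k) atTop (𝓝 z) := by
    intro k
    exact cauchySeq_tendsto_of_complete
      ((exists_lipschitzWith_coeff k).choose_spec.uniformContinuous.comp_cauchySeq hx)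
  choose c hc using hlim
  have hreal : ∀ k, c (-k) = star (c k) := fun k =>
    tendsto_nhds_unique (hc (-k)) (by
      simp_rw [coeff_neg_freq]
      exact (hc k).star)
  have hest : ∀ ε > 0, ∃ N, ∀ n ≥ N, ∀ j, besovTerm γ ((x n).coeff - c) j ≤ ε := by
    intro ε hε
    obtain ⟨N, hN⟩ := Metric.cauchySeq_iff.1 hx ε hε
    refine ⟨N, fun n hn j => ?_⟩
    refine le_of_tendsto (tendsto_besovTerm (γ := γ) (c := fun m => (x n).coeff - (x m).coeff)
      (fun k => tendsto_const_nhds.sub (hc k)) j) ?_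
    filter_upwards [eventually_ge_atTop N] with m hm
    have := hN n hn m hm
    rw [dist_eq_norm] at this
    exact (besovTerm_le_norm (x n - x m) j).trans this.le
  have hbdd : BddAbove (Set.range (besovTerm γ c)) := by
    obtain ⟨N, hN⟩ := hest 1 one_pos
    refine ⟨‖x N‖ + 1, ?_⟩
    rintro _ ⟨j, rfl⟩
    have h1 : c = (x N).coeff + (-1 : ℝ) • ((x N).coeff - c) := by
      rw [neg_one_smul]; abel
    rw [h1]
    refine (besovTerm_add_le γ _ _ j).trans (add_le_add (besovTerm_le_norm _ j) ?_)
    rw [besovTerm_smul]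
    simpa using hN N le_rfl j
  refine ⟨ofCoeff c hreal hbdd, Metric.tendsto_atTop.2 fun ε hε => ?_⟩
  obtain ⟨N, hN⟩ := hest (ε / 2) (half_pos hε)
  refine ⟨N, fun n hn => ?_⟩
  rw [dist_eq_norm]
  refine (norm_le fun j => ?_).trans_lt (half_lt_self hε)
  rw [coeff_sub, coeff_ofCoeff]
  exact hN n hn j

instance : CompleteSpace (Besov γ) :=
  Metric.complete_of_cauchySeq_tendsto fun _ hx => exists_tendsto_of_cauchySeq hx

/-- Trigonometric polynomials are a countable union, over frequency boxes, of continuous images of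
sets of coefficient families in a second countable product space. -/
lemma isSeparable_trigPoly : TopologicalSpace.IsSeparable (trigPoly γ : Set (Besov γ)) := by
  let A : ℕ → Set (Freq → ℂ) := fun N =>
    {c | (∀ k ∉ lpBox N, c k = 0) ∧ ∀ k, c (-k) = star (c k)}
  have hb : ∀ N (c : A N), BddAbove (Set.range (besovTerm γ c.1)) := by
    intro N c
    obtain ⟨C, -, h⟩ := exists_besovTerm_le_sum γ (lpBox N)
    refine ⟨C * ∑ k ∈ lpBox N, ‖c.1 k‖, ?_⟩
    rintro _ ⟨j, rfl⟩
    exact h c.1 c.2.1 j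
  let Φ : ∀ N, A N → Besov γ := fun N c => ofCoeff c.1 c.2.2 (hb N c)
  have hΦ : ∀ N, Continuous (Φ N) := fun N =>
    continuous_of_coeff (lpBox N) (fun c k hk => c.2.1 k hk)
      fun k => (continuous_apply k).comp continuous_subtype_val
  refine (TopologicalSpace.IsSeparable.iUnion fun N =>
    TopologicalSpace.isSeparable_range (hΦ N)).mono fun x hx => ?_
  obtain ⟨J, hJ⟩ := exists_lowPass_eq hx
  refine Set.mem_iUnion.2 ⟨J, ⟨x.coeff, fun k hk => ?_, x.coeff_neg_freq⟩, ext_coeff rfl⟩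
  rw [← hJ J le_rfl]
  exact lowPass_apply_eq_zero _ hk

end Besov

/-! ### Topology of C^γ and uniform approximation on compact sets -/

namespace Holder

variable {γ : ℝ}

instance : SecondCountableTopology (Holder γ) := by
  have h : TopologicalSpace.IsSeparable ((Besov.trigPoly γ).topologicalClosure : Set (Besov γ)) :=
    Besov.isSeparable_trigPoly.closure
  have : TopologicalSpace.SeparableSpace (Holder γ) := h.separableSpace
  exact UniformSpace.secondCountable_of_separable _

instance : CompleteSpace (Holder γ) :=
  (Submodule.isClosed_topologicalClosure (Besov.trigPoly γ)).completeSpace_coe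

lemma ext_coeff {x y : Holder γ} (h : x.coeff = y.coeff) : x = y :=
  Subtype.ext (Besov.ext_coeff h)

lemma coeff_add (x y : Holder γ) : (x + y).coeff = x.coeff + y.coeff := rfl

lemma coeff_smul (a : ℝ) (x : Holder γ) : (a • x).coeff = a • x.coeff := rfl

lemma coeff_neg_freq (x : Holder γ) (k : Freq) : x.coeff (-k) = star (x.coeff k) :=
  x.1.coeff_neg_freq k

lemma besovTerm_le_norm (x : Holder γ) (j : ℕ) : besovTerm γ x.coeff j ≤ ‖x‖ :=
  x.1.besovTerm_le_norm j

lemma norm_le {x : Holder γ} {B : ℝ} (h : ∀ j, besovTerm γ x.coeff j ≤ B) : ‖x‖ ≤ B :=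
  Besov.norm_le h

lemma continuous_coeff (k : Freq) : Continuous fun x : Holder γ => x.coeff k :=
  (Besov.continuous_coeff k).comp continuous_subtype_val

/-- On a compact subset of `C^γ` the low-pass filters converge uniformly. -/
lemma exists_besovTerm_sub_lowPass_le {K : Set (Holder γ)} (hK : IsCompact K) {ε : ℝ}
    (hε : 0 < ε) :
    ∃ J, ∀ x ∈ K, ∀ j, besovTerm γ (x.coeff - lowPass J x.coeff) j ≤ ε := by
  set M := multNorm bumpSchwartz
  have hM : 0 ≤ M := multNorm_nonneg _
  -- The distance from x to a nearby polynomial is paid twice: once directly, once through the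
  -- filter with norm at most M.
  have hδ : 0 < ε / (1 + M) := by positivity
  let U : Besov.trigPoly γ → Set (Holder γ) := fun y => {x | ‖(x : Besov γ) - y‖ < ε / (1 + M)}
  have hU : ∀ y, IsOpen (U y) := fun y =>
    isOpen_lt (by fun_prop) continuous_const
  have hcov : K ⊆ ⋃ y, U y := by
    intro x _
    have hx : (x : Besov γ) ∈ closure (Besov.trigPoly γ : Set (Besov γ)) := x.2
    obtain ⟨y, hy, hxy⟩ := Metric.mem_closure_iff.1 hx _ hδ
    rw [dist_eq_norm] at hxy
    exact Set.mem_iUnion.2 ⟨⟨y, hy⟩, hxy⟩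
  obtain ⟨s, hs⟩ := hK.elim_finite_subcover U hU hcov
  choose J₀ hJ₀ using fun y : Besov.trigPoly γ => exists_lowPass_eq y.2
  refine ⟨s.sup J₀, fun x hx j => ?_⟩
  obtain ⟨y, hys, hxy⟩ := Set.mem_iUnion₂.1 (hs hx)
  have hJ := hJ₀ y (s.sup J₀) (Finset.le_sup hys)
  set J := s.sup J₀
  have h1 : x.coeff - lowPass J x.coeff =
      ((x : Besov γ) - y).coeff + (-1 : ℝ) • lowPass J ((x : Besov γ) - y).coeff := by
    have h2 : lowPass J ((x : Besov γ) - y).coeff =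
        lowPass J x.coeff - lowPass J (y : Besov γ).coeff := by
      funext k
      simp only [lowPass, Besov.coeff_sub, Pi.sub_apply, mul_sub]
      rfl
    rw [h2, hJ, Besov.coeff_sub, neg_one_smul]
    change x.coeff - _ = x.coeff - _ + _
    abel
  have h3 := ((x : Besov γ) - y).besovTerm_le_norm j
  have h4 : ‖(x : Besov γ) - y‖ < ε / (1 + M) := hxy
  rw [h1]
  calc _ ≤ besovTerm γ ((x : Besov γ) - y).coeff j +
        besovTerm γ ((-1 : ℝ) • lowPass J ((x : Besov γ) - y).coeff) j := besovTerm_add_le _ _ _ _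
    _ ≤ ε / (1 + M) + M * (ε / (1 + M)) := by
      refine add_le_add (h3.trans h4.le) ?_
      rw [besovTerm_smul, abs_neg, abs_one, one_mul]
      exact (besovTerm_lowPass_le _ _ _ _).trans (by gcongr; exact h3.trans h4.le)
    _ = ε := by field_simp

end Holder

/-- A family of coefficients that is continuous in time and uniformly approximated by its low-pass
filters is a path in `C^γ`. -/
lemma exists_path_coeff_eq {T γ : ℝ} (c : Set.Icc (0 : ℝ) T → Freq → ℂ)
    (hreal : ∀ t k, c t (-k) = star (c t k)) (hcont : ∀ k, Continuous fun t => c t k)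
    (happ : ∀ ε > 0, ∃ J, ∀ t j, besovTerm γ (c t - lowPass J (c t)) j ≤ ε) :
    ∃ v : PathSpace T γ, ∀ t, (v t).coeff = c t := by
  have hlow : ∀ J t, BddAbove (Set.range (besovTerm γ (lowPass J (c t)))) := by
    intro J t
    obtain ⟨C, -, h⟩ := exists_besovTerm_le_sum γ (lpBox J)
    refine ⟨C * ∑ k ∈ lpBox J, ‖lowPass J (c t) k‖, ?_⟩
    rintro _ ⟨j, rfl⟩
    exact h _ (fun k hk => lowPass_apply_eq_zero _ hk) j
  -- The filtered paths have uniformly finite spectrum, so continuity of coefficients makes them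
  -- continuous in norm; the path itself is their uniform limit.
  let w : ℕ → Set.Icc (0 : ℝ) T → Besov γ := fun J t =>
    Besov.ofCoeff (lowPass J (c t)) (lowPass_neg (hreal t) J) (hlow J t)
  have hw : ∀ J, Continuous (w J) := fun J =>
    Besov.continuous_of_coeff (lpBox J) (fun t k hk => lowPass_apply_eq_zero _ hk)
      fun k => continuous_const.mul (hcont k)
  have hbdd : ∀ t, BddAbove (Set.range (besovTerm γ (c t))) := by
    intro t
    obtain ⟨J, hJ⟩ := happ 1 one_pos
    obtain ⟨C, hC⟩ := hlow J t
    refine ⟨1 + C, ?_⟩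
    rintro _ ⟨j, rfl⟩
    rw [← sub_add_cancel (c t) (lowPass J (c t))]
    exact (besovTerm_add_le _ _ _ _).trans (add_le_add (hJ t j) (hC ⟨j, rfl⟩))
  let x : Set.Icc (0 : ℝ) T → Besov γ := fun t => Besov.ofCoeff (c t) (hreal t) (hbdd t)
  have hxw : ∀ ε > 0, ∃ J, ∀ t, ‖x t - w J t‖ ≤ ε := by
    intro ε hε
    obtain ⟨J, hJ⟩ := happ ε hε
    exact ⟨J, fun t => Besov.norm_le (hJ t)⟩
  have hx : Continuous x := by
    refine continuous_of_uniform_approx_of_continuous fun u hu => ?_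
    obtain ⟨ε, hε, hεu⟩ := Metric.mem_uniformity_dist.1 hu
    obtain ⟨J, hJ⟩ := hxw (ε / 2) (half_pos hε)
    refine ⟨w J, hw J, fun t => hεu ?_⟩
    rw [dist_eq_norm]
    exact (hJ t).trans_lt (half_lt_self hε)
  have hmem : ∀ t, x t ∈ (Besov.trigPoly γ).topologicalClosure := by
    intro t
    refine Metric.mem_closure_iff.2 fun ε hε => ?_
    obtain ⟨J, hJ⟩ := hxw (ε / 2) (half_pos hε)
    refine ⟨w J t, ?_, ?_⟩
    · refine (lpBox J).finite_toSet.subset fun k hk => ?_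
      by_contra hkJ
      exact hk (lowPass_apply_eq_zero _ hkJ)
    · rw [dist_eq_norm]
      exact (hJ t).trans_lt (half_lt_self hε)
  exact ⟨⟨fun t => ⟨x t, hmem t⟩, hx.subtype_mk hmem⟩, fun t => rfl⟩

/-! ### Integrals over an initial segment -/

/-- Lebesgue measure on the time interval. -/
abbrev timeMeasure (T : ℝ) : Measure (Set.Icc (0 : ℝ) T) :=
  volume.comap ((↑) : Set.Icc (0 : ℝ) T → ℝ)

instance (T : ℝ) : IsFiniteMeasure (timeMeasure T) := by
  refine ⟨?_⟩
  rw [timeMeasure, comap_subtype_coe_apply measurableSet_Icc, Set.image_univ,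
    Subtype.range_coe, Real.volume_Icc]
  exact ENNReal.ofReal_lt_top

lemma setIntegral_Iic_timeMeasure {E : Type*} [NormedAddCommGroup E] [NormedSpace ℝ E] {T : ℝ}
    (φ : ℝ → E) (t : Set.Icc (0 : ℝ) T) :
    ∫ s in Set.Iic t, φ s ∂timeMeasure T = ∫ s in (0 : ℝ)..t, φ s := by
  have hpre : Set.Iic t = ((↑) : Set.Icc (0 : ℝ) T → ℝ) ⁻¹' Set.Iic (t : ℝ) := by
    ext s; simp
  rw [hpre, ← (MeasurableEmbedding.subtype_coe measurableSet_Icc).setIntegral_map,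
    map_comap_subtype_coe measurableSet_Icc, Measure.restrict_restrict measurableSet_Iic,
    intervalIntegral.integral_of_le t.2.1, ← integral_Icc_eq_integral_Ioc]
  congr 2
  ext s
  simp only [Set.mem_inter_iff, Set.mem_Iic, Set.mem_Icc]
  exact ⟨fun h => ⟨h.2.1, h.1⟩, fun h => ⟨h.2, h.1, h.2.trans t.2.2⟩⟩

lemma integrable_timeMeasure {E : Type*} [NormedAddCommGroup E] {T : ℝ}
    {φ : Set.Icc (0 : ℝ) T → E} (hφ : Continuous φ) : Integrable φ (timeMeasure T) := by
  obtain ⟨C, hC⟩ := isCompact_univ.exists_bound_of_continuousOn hφ.continuousOn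
  exact Integrable.of_bound
    (hφ.stronglyMeasurable_of_hasCompactSupport (isCompact_univ.of_isClosed_subset
      (isClosed_tsupport φ) (Set.subset_univ _))).aestronglyMeasurable C
    (Eventually.of_forall fun s => hC s (Set.mem_univ s))

lemma continuous_setIntegral_Iic {T : ℝ} {φ : Set.Icc (0 : ℝ) T → ℂ} (hφ : Continuous φ) :
    Continuous fun t => ∫ s in Set.Iic t, φ s ∂timeMeasure T := by
  rcases isEmpty_or_nonempty (Set.Icc (0 : ℝ) T) with h | ⟨⟨t₀⟩⟩
  · exact continuous_of_discreteTopology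
  have hT : 0 ≤ T := t₀.2.1.trans t₀.2.2
  have h1 : ∀ t : Set.Icc (0 : ℝ) T, ∫ s in Set.Iic t, φ s ∂timeMeasure T =
      ∫ s in (0 : ℝ)..t, Set.IccExtend hT φ s := by
    intro t
    rw [← setIntegral_Iic_timeMeasure]
    simp_rw [Set.IccExtend_val]
  simp_rw [h1]
  exact (intervalIntegral.continuous_primitive
    (fun a b => (hφ.Icc_extend' (h := hT)).intervalIntegrable a b) 0).comp continuous_subtype_val

lemma integral_inv_sq_le {a t : ℝ} (ha : 0 < a) (ht : 0 ≤ t) :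
    ∫ r in (0 : ℝ)..t, ((1 + a * r) ^ 2)⁻¹ ≤ a⁻¹ := by
  have hpos : ∀ r ∈ Set.uIcc 0 t, 1 + a * r ≠ 0 := by
    intro r hr
    rw [Set.uIcc_of_le ht] at hr
    have := mul_nonneg ha.le hr.1
    positivity
  have hd : ∀ r ∈ Set.uIcc 0 t,
      HasDerivAt (fun r => -(a⁻¹ * (1 + a * r)⁻¹)) (((1 + a * r) ^ 2)⁻¹) r := by
    intro r hr
    have h1 : HasDerivAt (fun r => 1 + a * r) a r := by
      simpa using ((hasDerivAt_id r).const_mul a).const_add 1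
    refine (((h1.inv (hpos r hr)).const_mul a⁻¹).neg).congr_deriv ?_
    have := hpos r hr
    field_simp
  rw [intervalIntegral.integral_eq_sub_of_hasDerivAt hd]
  · have : 0 ≤ a⁻¹ * (1 + a * t)⁻¹ := by positivity
    simp only [mul_zero, add_zero, inv_one, mul_one]
    linarith
  · refine ContinuousOn.intervalIntegrable ?_
    exact ContinuousOn.inv₀ (by fun_prop) fun r hr => pow_ne_zero 2 (hpos r hr)

lemma integral_exp_neg_le {l t : ℝ} (hl : 0 < l) :
    ∫ r in (0 : ℝ)..t, Real.exp (-(l * r)) ≤ l⁻¹ := by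
  have hd : ∀ r ∈ Set.uIcc 0 t,
      HasDerivAt (fun r => -(l⁻¹ * Real.exp (-(l * r)))) (Real.exp (-(l * r))) r := by
    intro r _
    have h1 : HasDerivAt (fun r => -(l * r)) (-l) r := by
      simpa using (hasDerivAt_id' r).const_mul (-l)
    refine (((h1.exp).const_mul l⁻¹).neg).congr_deriv ?_
    field_simp
  rw [intervalIntegral.integral_eq_sub_of_hasDerivAt hd]
  · have : 0 ≤ l⁻¹ * Real.exp (-(l * t)) := by positivity
    simp only [mul_zero, neg_zero, Real.exp_zero, mul_one]
    linarith
  · exact Continuous.intervalIntegrable (by fun_prop) _ _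

/-- Dropping one factor of the integrand bounds the integral by a⁻¹, dropping the other bounds it by
l⁻¹; a geometric mean of the two remains. With a = 4^j, this trades part of the two derivatives
gained for a power of the rate l. -/
lemma integral_kernel_mul_exp_le {a l t δ : ℝ} (ha : 0 < a) (hl : 0 < l) (ht : 0 ≤ t)
    (hδ : 0 ≤ δ) (hδ' : δ ≤ 1) :
    ∫ r in (0 : ℝ)..t, ((1 + a * r) ^ 2)⁻¹ * Real.exp (-(l * r)) ≤
      a⁻¹ ^ (1 - δ) * l⁻¹ ^ δ := by
  have hne : ∀ r ∈ Set.Icc 0 t, (1 + a * r) ^ 2 ≠ 0 := by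
    intro r hr
    have := mul_nonneg ha.le hr.1
    positivity
  have hc1 : ContinuousOn (fun r : ℝ => ((1 + a * r) ^ 2)⁻¹) (Set.Icc 0 t) :=
    ContinuousOn.inv₀ (by fun_prop) hne
  have hc2 : ContinuousOn (fun r : ℝ => Real.exp (-(l * r))) (Set.Icc 0 t) := by fun_prop
  have hI : ∀ {φ : ℝ → ℝ}, ContinuousOn φ (Set.Icc 0 t) → IntervalIntegrable φ volume 0 t :=
    fun h => ContinuousOn.intervalIntegrable (by rwa [Set.uIcc_of_le ht])
  set I := ∫ r in (0 : ℝ)..t, ((1 + a * r) ^ 2)⁻¹ * Real.exp (-(l * r))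
  have hI0 : 0 ≤ I := intervalIntegral.integral_nonneg ht fun r _ => by positivity
  have hIa : I ≤ a⁻¹ := by
    refine le_trans (intervalIntegral.integral_mono_on ht (hI (hc1.mul hc2)) (hI hc1)
      fun r hr => ?_) (integral_inv_sq_le ha ht)
    refine mul_le_of_le_one_right (by positivity) (Real.exp_le_one_iff.2 ?_)
    have := mul_nonneg hl.le hr.1
    linarith
  have hIl : I ≤ l⁻¹ := by
    refine le_trans (intervalIntegral.integral_mono_on ht (hI (hc1.mul hc2)) (hI hc2)
      fun r hr => ?_) (integral_exp_neg_le (t := t) hl)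
    refine mul_le_of_le_one_left (Real.exp_pos _).le (inv_le_one_of_one_le₀ (one_le_pow₀ ?_))
    have := mul_nonneg ha.le hr.1
    linarith
  calc I = I ^ ((1 - δ) + δ) := by rw [sub_add_cancel, Real.rpow_one]
    _ = I ^ (1 - δ) * I ^ δ := Real.rpow_add_of_nonneg hI0 (by linarith) hδ
    _ ≤ _ := by gcongr

/-! ### The Duhamel operator -/

lemma heatSymbol_neg (t : ℝ) (k : Freq) : heatSymbol t (-k) = heatSymbol t k := by
  rw [heatSymbol, heatSymbol, freqSq_neg]

lemma star_heatSymbol (t : ℝ) (k : Freq) : star (heatSymbol t k) = heatSymbol t k :=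
  Complex.conj_ofReal _

lemma continuous_heatSymbol (k : Freq) : Continuous fun t => heatSymbol t k := by
  unfold heatSymbol
  fun_prop

lemma heatSymbol_sub (t s : ℝ) (k : Freq) :
    heatSymbol (t - s) k = heatSymbol t k * heatSymbol (-s) k := by
  rw [heatSymbol, heatSymbol, heatSymbol, ← Complex.ofReal_mul, ← Real.exp_add]
  congr 2
  ring

/-- The Fourier coefficients of `∫₀ᵗ P_{t-s} f_s ds`. -/
def duhamel {T : ℝ} (f : Set.Icc (0 : ℝ) T → Freq → ℂ) (t : Set.Icc (0 : ℝ) T) (k : Freq) : ℂ :=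
  ∫ s in Set.Iic t, heatSymbol (t - s) k * f s k ∂timeMeasure T

section Duhamel

variable {T : ℝ} {f : Set.Icc (0 : ℝ) T → Freq → ℂ}

lemma integrable_duhamel (hf : ∀ k, Continuous fun s => f s k) (t : Set.Icc (0 : ℝ) T) (k : Freq) :
    Integrable (fun s : Set.Icc (0 : ℝ) T => heatSymbol (t - s) k * f s k)
      ((timeMeasure T).restrict (Set.Iic t)) :=
  (integrable_timeMeasure (((continuous_heatSymbol k).comp (by fun_prop)).mul (hf k))).restrict

/-- At a single frequency the heat flow can be run backwards, so the factor depending on t leaves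
the integral and a primitive of a continuous function remains. -/
lemma continuous_duhamel (hf : ∀ k, Continuous fun s => f s k) (k : Freq) :
    Continuous fun t => duhamel f t k := by
  have h : ∀ t, duhamel f t k = heatSymbol t k *
      ∫ s in Set.Iic t, heatSymbol (-s) k * f s k ∂timeMeasure T := by
    intro t
    rw [duhamel, ← integral_const_mul]
    simp_rw [heatSymbol_sub, mul_assoc]
  simp_rw [h]
  refine ((continuous_heatSymbol k).comp continuous_subtype_val).mul
    (continuous_setIntegral_Iic (((continuous_heatSymbol k).comp ?_).mul (hf k)))
  fun_prop

lemma duhamel_neg (hf : ∀ t k, f t (-k) = star (f t k)) (t : Set.Icc (0 : ℝ) T) (k : Freq) :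
    duhamel f t (-k) = star (duhamel f t k) := by
  rw [duhamel, duhamel]
  refine Eq.trans ?_ integral_conj
  refine integral_congr_ae (Eventually.of_forall fun s => ?_)
  have : heatSymbol (t - s) (-k) * f s (-k) = star (heatSymbol (t - s) k * f s k) := by
    rw [heatSymbol_neg, hf, star_mul', star_heatSymbol]
  exact this

lemma lpBlock_duhamel_apply (hf : ∀ k, Continuous fun s => f s k) (t : Set.Icc (0 : ℝ) T) (j : ℕ)
    (x : UnitAddTorus (Fin 2)) : lpBlock j (duhamel f t) x =
      ∫ s in Set.Iic t, lpBlock j (fun k => heatSymbol (t - s) k * f s k) x ∂timeMeasure T := by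
  simp_rw [lpBlock_apply]
  rw [integral_finsetSum]
  · refine Finset.sum_congr rfl fun k _ => ?_
    rw [integral_mul_const, integral_const_mul]
    rfl
  · exact fun k _ => ((integrable_duhamel hf t k).const_mul _).mul_const _

end Duhamel

/-- The Schauder estimate for the heat equation on the torus, in norms with an exponential weight
in time. -/
lemma exists_besovTerm_duhamel_le (T α β : ℝ) {δ : ℝ} (hδ : 0 ≤ δ) (hδ' : δ ≤ 1)
    (hαβ : α - β ≤ 2 - 2 * δ) : ∃ C, 0 ≤ C ∧ ∀ l > 0, ∀ (f : Set.Icc (0 : ℝ) T → Freq → ℂ),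
      (∀ k, Continuous fun s => f s k) → ∀ N, 0 ≤ N →
      (∀ s j, besovTerm β (f s) j ≤ N * Real.exp (l * s)) →
      ∀ t j, besovTerm α (duhamel f t) j ≤ C * l⁻¹ ^ δ * (N * Real.exp (l * t)) := by
  obtain ⟨C, hC, hheat⟩ := exists_norm_lpBlock_heat_le T
  refine ⟨2 ^ |α - β| * C, by positivity, fun l hl f hf N hN hfN t j => ?_⟩
  have ht : (0 : ℝ) ≤ t := t.2.1
  set B := (2 : ℝ) ^ (-(((j : ℝ) - 1) * β)) * N with hB
  have hblock : ‖lpBlock j (duhamel f t)‖ ≤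
      C * B * Real.exp (l * t) * (((4 : ℝ) ^ j)⁻¹ ^ (1 - δ) * l⁻¹ ^ δ) := by
    refine (ContinuousMap.norm_le _ (by positivity)).2 fun x => ?_
    rw [lpBlock_duhamel_apply hf]
    let φ : ℝ → ℝ := fun s => C * ((1 + 4 ^ j * (t - s)) ^ 2)⁻¹ * (B * Real.exp (l * s))
    have hφ : Integrable (fun s : Set.Icc (0 : ℝ) T => φ s)
        ((timeMeasure T).restrict (Set.Iic t)) := by
      -- For s > t the denominator might vanish; replacing t - s by its positive part changes
      -- nothing on the domain of integration.
      have hcont : Continuous fun s : Set.Icc (0 : ℝ) T =>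
          C * ((1 + 4 ^ j * max ((t : ℝ) - s) 0) ^ 2)⁻¹ * (B * Real.exp (l * s)) := by
        refine (continuous_const.mul (Continuous.inv₀ (by fun_prop) fun s => ?_)).mul
          (by fun_prop)
        have : 0 ≤ (4 : ℝ) ^ j * max ((t : ℝ) - s) 0 := by positivity
        positivity
      refine (integrable_timeMeasure hcont).restrict.congr ?_
      filter_upwards [ae_restrict_mem measurableSet_Iic] with s hs
      have : (s : ℝ) ≤ t := hs
      rw [max_eq_left (by linarith)]
    refine (norm_integral_le_of_norm_le hφ ?_).trans ?_
    · filter_upwards [ae_restrict_mem measurableSet_Iic] with s hs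
      have hst : (s : ℝ) ≤ t := hs
      refine ((lpBlock j _).norm_coe_le_norm x).trans ((hheat (t - s) (by linarith)
        (by linarith [t.2.2, s.2.1]) j (f s)).trans ?_)
      refine mul_le_mul_of_nonneg_left ?_ (by positivity)
      rw [hB, mul_assoc]
      exact norm_lpBlock_le_of_besovTerm_le (hfN s j)
    · rw [setIntegral_Iic_timeMeasure φ t]
      -- Writing e^{ls} = e^{lt} e^{-l(t-s)} transfers the weight to the kernel, which becomes
      -- exponentially damped.
      have hsub : ∀ s, φ s = C * B * Real.exp (l * t) *
          ((fun r => ((1 + 4 ^ j * r) ^ 2)⁻¹ * Real.exp (-(l * r))) (t - s)) := by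
        intro s
        have : Real.exp (l * s) = Real.exp (l * t) * Real.exp (-(l * (t - s))) := by
          rw [← Real.exp_add]; congr 1; ring
        simp only [φ, this]
        ring
      simp_rw [hsub]
      rw [intervalIntegral.integral_const_mul, intervalIntegral.integral_comp_sub_left
        (fun r => ((1 + 4 ^ j * r) ^ 2)⁻¹ * Real.exp (-(l * r))), sub_self, sub_zero]
      exact mul_le_mul_of_nonneg_left
        (integral_kernel_mul_exp_le (by positivity) hl ht hδ hδ') (by positivity)
  have h4 : ((4 : ℝ) ^ j)⁻¹ ^ (1 - δ) = (2 : ℝ) ^ (-(2 * j * (1 - δ))) := by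
    rw [show (4 : ℝ) = 2 ^ (2 : ℝ) by norm_num, ← Real.rpow_natCast, ← Real.rpow_mul two_pos.le,
      ← Real.rpow_neg two_pos.le, ← Real.rpow_mul two_pos.le]
    congr 1
    ring
  rw [besovTerm]
  calc (2 : ℝ) ^ (((j : ℝ) - 1) * α) * ‖lpBlock j (duhamel f t)‖
      ≤ (2 : ℝ) ^ (((j : ℝ) - 1) * α) *
        (C * B * Real.exp (l * t) * (((4 : ℝ) ^ j)⁻¹ ^ (1 - δ) * l⁻¹ ^ δ)) := by gcongr
    _ = (2 : ℝ) ^ (((j : ℝ) - 1) * α + -(((j : ℝ) - 1) * β) + -(2 * j * (1 - δ))) * C * l⁻¹ ^ δ *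
        (N * Real.exp (l * t)) := by
      rw [h4, hB, Real.rpow_add two_pos, Real.rpow_add two_pos]
      ring
    _ ≤ 2 ^ |α - β| * C * l⁻¹ ^ δ * (N * Real.exp (l * t)) := by
      gcongr
      · exact one_le_two
      -- The exponent equals j(α - β - 2 + 2δ) - (α - β), whose first term is nonpositive. The
      -- constant 2^|α-β| only pays for the Littlewood-Paley index starting at -1.
      · have h1 : (j : ℝ) * (α - β - (2 - 2 * δ)) ≤ 0 :=
          mul_nonpos_of_nonneg_of_nonpos (Nat.cast_nonneg j) (by linarith)
        have h2 := neg_abs_le (α - β)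
        nlinarith

lemma sub_lowPass_apply (J : ℕ) (c : Freq → ℂ) (k : Freq) :
    (c - lowPass J c) k = (1 - (bump (((2 : ℝ) ^ J)⁻¹ • freqVec k) : ℂ)) * c k := by
  rw [Pi.sub_apply, lowPass]
  ring

lemma duhamel_const_mul {T : ℝ} (m : Freq → ℂ) (f : Set.Icc (0 : ℝ) T → Freq → ℂ)
    (t : Set.Icc (0 : ℝ) T) (k : Freq) :
    duhamel (fun s k => m k * f s k) t k = m k * duhamel f t k := by
  rw [duhamel, duhamel, ← integral_const_mul]
  simp_rw [mul_left_comm]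

/-- The Duhamel operator `f ↦ ∫₀ᵗ P_{t-s} f_s ds` from `C_T C^β` to `C_T C^α`. -/
theorem exists_duhamel_operator (T α β : ℝ) {δ : ℝ} (hδ : 0 ≤ δ) (hδ' : δ ≤ 1)
    (hαβ : α - β ≤ 2 - 2 * δ) : ∃ K : PathSpace T β →ₗ[ℝ] PathSpace T α,
      (∀ f t k, (K f t).coeff k = duhamel (fun s => (f s).coeff) t k) ∧
      ∃ C, 0 ≤ C ∧ ∀ l > 0, ∀ (f : PathSpace T β) (N : ℝ), 0 ≤ N →
        (∀ s, ‖f s‖ ≤ N * Real.exp (l * s)) →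
        ∀ t, ‖K f t‖ ≤ C * l⁻¹ ^ δ * (N * Real.exp (l * t)) := by
  obtain ⟨C, hC, hest⟩ := exists_besovTerm_duhamel_le T α β hδ hδ' hαβ
  have hcoeff : ∀ (f : PathSpace T β) k, Continuous fun s => (f s).coeff k := fun f k =>
    (Holder.continuous_coeff k).comp f.continuous
  have hex : ∀ f : PathSpace T β, ∃ v : PathSpace T α,
      ∀ t, (v t).coeff = duhamel (fun s => (f s).coeff) t := by
    intro f
    refine exists_path_coeff_eq _ (duhamel_neg fun s k => (f s).coeff_neg_freq k)
      (continuous_duhamel (hcoeff f)) fun ε hε => ?_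
    -- The constant of the weighted estimate at rate l = 1, with the weight bounded by its value at
    -- T.
    set D := C * (1 : ℝ)⁻¹ ^ δ * Real.exp (1 * T) with hD
    have hD0 : 0 ≤ D := by positivity
    obtain ⟨J, hJ⟩ := Holder.exists_besovTerm_sub_lowPass_le (isCompact_range f.continuous)
      (ε := ε / (D + 1)) (by positivity)
    refine ⟨J, fun t j => ?_⟩
    -- Fourier multipliers commute with Duhamel integration, so the tail of the output is the output
    -- of the tails, which are uniformly small on the compact range of f.
    have h1 : duhamel (fun s => (f s).coeff) t - lowPass J (duhamel (fun s => (f s).coeff) t) =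
        duhamel (fun s => (f s).coeff - lowPass J (f s).coeff) t := by
      funext k
      rw [sub_lowPass_apply]
      refine (duhamel_const_mul (fun k => 1 - (bump (((2 : ℝ) ^ J)⁻¹ • freqVec k) : ℂ)) _ t
        k).symm.trans ?_
      simp only [duhamel, sub_lowPass_apply]
    rw [h1]
    refine (hest 1 one_pos _ (fun k => ?_) (ε / (D + 1)) (by positivity) (fun s i => ?_) t j).trans
      ?_
    · simp_rw [sub_lowPass_apply]
      exact continuous_const.mul (hcoeff f k)
    · refine (hJ (f s) ⟨s, rfl⟩ i).trans (le_mul_of_one_le_right (by positivity) ?_)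
      exact Real.one_le_exp (by linarith [s.2.1])
    · calc C * (1 : ℝ)⁻¹ ^ δ * (ε / (D + 1) * Real.exp (1 * t))
          ≤ C * (1 : ℝ)⁻¹ ^ δ * (ε / (D + 1) * Real.exp (1 * T)) := by
            gcongr
            exact t.2.2
        _ = ε * (D / (D + 1)) := by rw [hD]; ring
        _ ≤ ε * 1 := by gcongr; exact (div_le_one (by positivity)).2 (by linarith)
        _ = ε := mul_one ε
  choose K hK using hex
  refine ⟨{ toFun := K, map_add' := fun f f' => ?_, map_smul' := fun a f => ?_ },
    fun f t k => congrFun (hK f t) k, C, hC, fun l hl f N hN hf t => ?_⟩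
  · ext1 t
    refine Holder.ext_coeff (funext fun k => ?_)
    rw [ContinuousMap.add_apply, Holder.coeff_add, Pi.add_apply, hK, hK, hK, duhamel, duhamel,
      duhamel, ← integral_add (integrable_duhamel (hcoeff f) t k)
        (integrable_duhamel (hcoeff f') t k)]
    refine integral_congr_ae (Eventually.of_forall fun s => ?_)
    exact mul_add _ _ _
  · ext1 t
    refine Holder.ext_coeff (funext fun k => ?_)
    rw [RingHom.id_apply, ContinuousMap.smul_apply, Holder.coeff_smul, Pi.smul_apply, hK, hK,
      duhamel, duhamel, ← integral_smul]
    refine integral_congr_ae (Eventually.of_forall fun s => ?_)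
    exact mul_smul_comm a (heatSymbol (t - s) k) ((f s).coeff k)
  · refine Holder.norm_le fun j => ?_
    change besovTerm α (K f t).coeff j ≤ _
    rw [hK]
    exact hest l hl _ (hcoeff f) N hN
      (fun s i => ((f s).besovTerm_le_norm i).trans (hf s)) t j

/-- The heat semigroup `v ↦ (P_t v)_t` from `C^α` to `C_T C^α`. -/
theorem exists_heat_operator (T α : ℝ) : ∃ H : Holder α →ₗ[ℝ] PathSpace T α,
      (∀ v t k, (H v t).coeff k = heatSymbol t k * v.coeff k) ∧
      ∃ C, 0 ≤ C ∧ ∀ v, ‖H v‖ ≤ C * ‖v‖ := by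
  set C := multNorm gaussianSchwartz
  have hC : 0 ≤ C := multNorm_nonneg _
  have hest : ∀ (t : Set.Icc (0 : ℝ) T) (c : Freq → ℂ) (j : ℕ),
      besovTerm α (fun k => heatSymbol t k * c k) j ≤ C * besovTerm α c j := by
    intro t c j
    rw [besovTerm, besovTerm, mul_left_comm]
    gcongr
    exact norm_lpBlock_heat_le t.2.1 j c
  have hex : ∀ v : Holder α, ∃ w : PathSpace T α,
      ∀ t, (w t).coeff = fun k => heatSymbol t k * v.coeff k := by
    intro v
    refine exists_path_coeff_eq _ (fun t k => ?_) (fun k => ?_) fun ε hε => ?_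
    · rw [heatSymbol_neg, v.coeff_neg_freq, star_mul', star_heatSymbol]
    · exact ((continuous_heatSymbol k).comp continuous_subtype_val).mul continuous_const
    · obtain ⟨J, hJ⟩ := Holder.exists_besovTerm_sub_lowPass_le (isCompact_singleton (x := v))
        (ε := ε / (C + 1)) (by positivity)
      refine ⟨J, fun t j => ?_⟩
      have h1 : (fun k => heatSymbol t k * v.coeff k) -
          lowPass J (fun k => heatSymbol t k * v.coeff k) =
          fun k => heatSymbol t k * (v.coeff - lowPass J v.coeff) k := by
        funext k
        rw [sub_lowPass_apply, sub_lowPass_apply, mul_left_comm]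
      rw [h1]
      refine (hest t _ j).trans ?_
      calc C * besovTerm α (v.coeff - lowPass J v.coeff) j ≤ C * (ε / (C + 1)) := by
            gcongr
            exact hJ v rfl j
        _ = ε * (C / (C + 1)) := by ring
        _ ≤ ε * 1 := by gcongr; exact (div_le_one (by positivity)).2 (by linarith)
        _ = ε := mul_one ε
  choose H hH using hex
  refine ⟨{ toFun := H, map_add' := fun v v' => ?_, map_smul' := fun a v => ?_ },
    fun v t k => congrFun (hH v t) k, C, hC, fun v => ?_⟩
  · ext1 t
    refine Holder.ext_coeff (funext fun k => ?_)
    rw [ContinuousMap.add_apply, Holder.coeff_add, Pi.add_apply, hH, hH, hH, Holder.coeff_add]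
    exact mul_add _ _ _
  · ext1 t
    refine Holder.ext_coeff (funext fun k => ?_)
    rw [RingHom.id_apply, ContinuousMap.smul_apply, Holder.coeff_smul, Pi.smul_apply, hH, hH,
      Holder.coeff_smul]
    exact mul_smul_comm a (heatSymbol t k) (v.coeff k)
  · refine (ContinuousMap.norm_le _ (by positivity)).2 fun t => Holder.norm_le fun j => ?_
    change besovTerm α (H v t).coeff j ≤ _
    rw [hH]
    exact (hest t _ j).trans (by gcongr; exact v.besovTerm_le_norm j)

/-! ### Couplings and the Wasserstein distance -/

section Coupling

variable {E : Type*} [MeasurableSpace E]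

/-- The product coupling of two finite measures of equal mass. -/
def prodCoupling (μ ν : Measure E) : Measure (E × E) := (μ Set.univ)⁻¹ • μ.prod ν

lemma map_fst_prodCoupling {μ ν : Measure E} [IsFiniteMeasure μ] [IsFiniteMeasure ν]
    (h : μ Set.univ = ν Set.univ) : (prodCoupling μ ν).map Prod.fst = μ := by
  rw [prodCoupling, Measure.map_smul, Measure.map_fst_prod, smul_smul, ← h]
  -- At zero mass the normalizing factor is ∞, but the product measure vanishes and so does the
  -- coupling.
  by_cases h0 : μ Set.univ = 0
  · rw [Measure.measure_univ_eq_zero.1 h0, smul_zero]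
  · rw [ENNReal.inv_mul_cancel h0 (measure_ne_top _ _), one_smul]

lemma map_snd_prodCoupling {μ ν : Measure E} [IsFiniteMeasure μ] [IsFiniteMeasure ν]
    (h : μ Set.univ = ν Set.univ) : (prodCoupling μ ν).map Prod.snd = ν := by
  rw [prodCoupling, Measure.map_smul, Measure.map_snd_prod, smul_smul, h]
  by_cases h0 : ν Set.univ = 0
  · rw [Measure.measure_univ_eq_zero.1 h0, smul_zero]
  · rw [ENNReal.inv_mul_cancel h0 (measure_ne_top _ _), one_smul]

lemma measure_univ_of_map_eq {α β : Type*} [MeasurableSpace α] [MeasurableSpace β]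
    {π : Measure α} {μ : Measure β} {f : α → β} (hf : Measurable f) (h : π.map f = μ) :
    π Set.univ = μ Set.univ := by
  rw [← h, Measure.map_apply hf MeasurableSet.univ, Set.preimage_univ]

lemma map_sum_measure {α β ι : Type*} [MeasurableSpace α] [MeasurableSpace β] (s : Finset ι)
    (π : ι → Measure α) {f : α → β} (hf : Measurable f) :
    (∑ i ∈ s, π i).map f = ∑ i ∈ s, (π i).map f := by
  ext t ht
  rw [Measure.map_apply hf ht, Measure.finsetSum_apply, Measure.finsetSum_apply]
  exact Finset.sum_congr rfl fun i _ => (Measure.map_apply hf ht).symm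

end Coupling

lemma edist_rpow_le {E : Type*} [NormedAddCommGroup E] {p : ℝ} (hp : 1 ≤ p) (x y : E) :
    edist x y ^ p ≤ 2 ^ (p - 1) * (‖x‖ₑ ^ p + ‖y‖ₑ ^ p) := by
  have h1 : edist x y ≤ ‖x‖ₑ + ‖y‖ₑ := by
    rw [edist_eq_enorm_sub]
    exact enorm_sub_le
  exact (ENNReal.rpow_le_rpow h1 (by linarith)).trans
    (ENNReal.rpow_add_le_mul_rpow_add_rpow _ _ hp)

section Wasserstein

variable {E : Type*} [NormedAddCommGroup E] [MeasurableSpace E] {p : ℝ}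

lemma wassersteinDist_rpow (hp : 0 < p) (μ ν : Measure E) : wassersteinDist p μ ν ^ p =
    ⨅ (π : Measure (E × E)) (_ : π.map Prod.fst = μ) (_ : π.map Prod.snd = ν),
      ∫⁻ z, edist z.1 z.2 ^ p ∂π := by
  rw [wassersteinDist, one_div, ENNReal.rpow_inv_rpow hp.ne']

lemma wassersteinDist_rpow_le (hp : 0 < p) {μ ν : Measure E} {π : Measure (E × E)}
    (h1 : π.map Prod.fst = μ) (h2 : π.map Prod.snd = ν) :
    wassersteinDist p μ ν ^ p ≤ ∫⁻ z, edist z.1 z.2 ^ p ∂π := by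
  rw [wassersteinDist_rpow hp]
  exact iInf₂_le_of_le π h1 (iInf_le _ h2)

lemma exists_coupling_of_wassersteinDist_lt (hp : 0 < p) {μ ν : Measure E} {c : ℝ≥0∞}
    (h : wassersteinDist p μ ν < c) : ∃ π : Measure (E × E), π.map Prod.fst = μ ∧
      π.map Prod.snd = ν ∧ ∫⁻ z, edist z.1 z.2 ^ p ∂π ≤ c ^ p := by
  have h' := ENNReal.rpow_lt_rpow h hp
  rw [wassersteinDist_rpow hp] at h'
  simp only [iInf_lt_iff] at h'
  obtain ⟨π, h1, h2, h3⟩ := h'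
  exact ⟨π, h1, h2, h3.le⟩

variable [BorelSpace E] [SecondCountableTopology E]

/-- An upper bound for the transport cost between two probability measures, in terms of the masses
of the cells of a partial partition into small cells. -/
lemma wassersteinDist_rpow_le_of_partition (hp : 1 ≤ p) (e μ : Measure E) [IsProbabilityMeasure e]
    [IsProbabilityMeasure μ] (s : Finset ℕ) (A : ℕ → Set E) (hA : ∀ k, MeasurableSet (A k))
    (hdisj : Pairwise (Function.onFun Disjoint A)) (ε R : ℝ≥0∞)
    (hε : ∀ k ∈ s, ∀ x ∈ A k, ∀ y ∈ A k, edist x y ≤ ε) (hR : ∀ k ∈ s, ∀ x ∈ A k, ‖x‖ₑ ≤ R) :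
    wassersteinDist p e μ ^ p ≤ ε ^ p + 2 ^ (p - 1) *
      (((∫⁻ x in (⋃ k ∈ s, A k)ᶜ, ‖x‖ₑ ^ p ∂e) + ∑ k ∈ s, (e (A k) - μ (A k)) * R ^ p) +
       ((∫⁻ x in (⋃ k ∈ s, A k)ᶜ, ‖x‖ₑ ^ p ∂μ) + ∑ k ∈ s, (μ (A k) - e (A k)) * R ^ p)) := by
  have hp0 : 0 < p := by linarith
  -- The mass that both measures have in the cell, hence the mass that can be transported without
  -- leaving it.
  let c : ℕ → ℝ≥0∞ := fun k => min (e (A k)) (μ (A k))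
  let C : Set E := (⋃ k ∈ s, A k)ᶜ
  have hU : MeasurableSet (⋃ k ∈ s, A k) := Finset.measurableSet_biUnion s fun k _ => hA k
  -- the part of a measure that is matched within the cells, and the rest
  let m : Measure E → ℕ → Measure E := fun ν k => (c k / ν (A k)) • ν.restrict (A k)
  let r : Measure E → Measure E := fun ν =>
    ν.restrict C + ∑ k ∈ s, (1 - c k / ν (A k)) • ν.restrict (A k)
  have hle : ∀ ν : Measure E, (∀ k, c k ≤ ν (A k)) → ∀ k, c k / ν (A k) ≤ 1 := fun ν h k =>
    ENNReal.div_le_of_le_mul (by rw [one_mul]; exact h k)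
  have hmass : ∀ ν : Measure E, IsProbabilityMeasure ν → (∀ k, c k ≤ ν (A k)) → ∀ k,
      m ν k Set.univ = c k := by
    intro ν _ h k
    simp only [m, Measure.smul_apply, Measure.restrict_apply_univ, smul_eq_mul]
    rcases eq_or_ne (ν (A k)) 0 with h0 | h0
    · have : c k = 0 := le_antisymm (h0 ▸ h k) zero_le
      rw [h0, this, mul_zero]
    · exact ENNReal.div_mul_cancel h0 (measure_ne_top _ _)
  have hdec : ∀ ν : Measure E, IsProbabilityMeasure ν → (∀ k, c k ≤ ν (A k)) →
      ∑ k ∈ s, m ν k + r ν = ν := by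
    intro ν _ h
    have h1 : ∑ k ∈ s, m ν k + ∑ k ∈ s, (1 - c k / ν (A k)) • ν.restrict (A k) =
        ν.restrict (⋃ k ∈ s, A k) := by
      rw [← Finset.sum_add_distrib]
      ext t ht
      rw [Measure.finsetSum_apply, Measure.restrict_apply ht, Set.inter_iUnion₂,
        measure_biUnion_finset (fun i _ j _ hij =>
          (hdisj hij).mono Set.inter_subset_right Set.inter_subset_right)
          fun k _ => ht.inter (hA k)]
      refine Finset.sum_congr rfl fun k _ => ?_
      rw [← add_smul, add_tsub_cancel_of_le (hle ν h k), one_smul, Measure.restrict_apply ht]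
    simp only [r]
    rw [add_left_comm, h1, add_comm]
    exact Measure.restrict_add_restrict_compl hU
  have hce : ∀ k, c k ≤ e (A k) := fun k => min_le_left _ _
  have hcμ : ∀ k, c k ≤ μ (A k) := fun k => min_le_right _ _
  have hfin : ∀ ν : Measure E, IsProbabilityMeasure ν → (∀ k, c k ≤ ν (A k)) →
      (∀ k ∈ s, IsFiniteMeasure (m ν k)) ∧ IsFiniteMeasure (r ν) := by
    intro ν hν h
    have h1 := hdec ν hν h
    refine ⟨fun k _ => ⟨?_⟩, ⟨?_⟩⟩
    · rw [hmass ν hν h]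
      exact (h k).trans_lt (measure_lt_top _ _)
    · refine lt_of_le_of_lt ?_ (measure_lt_top ν Set.univ)
      conv_rhs => rw [← h1]
      exact le_add_self
  obtain ⟨hme, hre⟩ := hfin e ‹_› hce
  obtain ⟨hmμ, hrμ⟩ := hfin μ ‹_› hcμ
  -- Both remainders have mass 1 - ∑ c k, so they can be coupled with each other.
  have hr : r e Set.univ = r μ Set.univ := by
    have h1 : ∀ ν : Measure E, IsProbabilityMeasure ν → (∀ k, c k ≤ ν (A k)) →
        ∑ k ∈ s, c k + r ν Set.univ = 1 := by
      intro ν hν h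
      have := congrArg (fun ρ => ρ Set.univ) (hdec ν hν h)
      simp only [Measure.add_apply, Measure.finsetSum_apply, measure_univ] at this
      rw [← this]
      congr 1
      exact Finset.sum_congr rfl fun k _ => (hmass ν hν h k).symm
    refine (ENNReal.add_right_inj (a := ∑ k ∈ s, c k) ?_).1
      ((h1 e ‹_› hce).trans (h1 μ ‹_› hcμ).symm)
    exact ((le_self_add.trans (h1 e ‹_› hce).le).trans_lt ENNReal.one_lt_top).ne
  -- Matched mass moves inside a cell at cost at most ε^p per unit; the leftover is coupled
  -- independently and costs at most a constant times its p-th moments.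
  let π : Measure (E × E) := ∑ k ∈ s, prodCoupling (m e k) (m μ k) + prodCoupling (r e) (r μ)
  have hπ1 : π.map Prod.fst = e := by
    rw [Measure.map_add _ _ measurable_fst, map_sum_measure _ _ measurable_fst,
      map_fst_prodCoupling hr]
    conv_rhs => rw [← hdec e ‹_› hce]
    congr 1
    refine Finset.sum_congr rfl fun k hk => ?_
    have := hme k hk
    have := hmμ k hk
    exact map_fst_prodCoupling ((hmass e ‹_› hce k).trans (hmass μ ‹_› hcμ k).symm)
  have hπ2 : π.map Prod.snd = μ := by
    rw [Measure.map_add _ _ measurable_snd, map_sum_measure _ _ measurable_snd,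
      map_snd_prodCoupling hr]
    conv_rhs => rw [← hdec μ ‹_› hcμ]
    congr 1
    refine Finset.sum_congr rfl fun k hk => ?_
    have := hme k hk
    have := hmμ k hk
    exact map_snd_prodCoupling ((hmass e ‹_› hce k).trans (hmass μ ‹_› hcμ k).symm)
  refine (wassersteinDist_rpow_le hp0 hπ1 hπ2).trans ?_
  rw [lintegral_add_measure, lintegral_finsetSum_measure]
  refine add_le_add ?_ ?_
  · -- the matched part
    have hk : ∀ k ∈ s, ∫⁻ z, edist z.1 z.2 ^ p ∂prodCoupling (m e k) (m μ k) ≤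
        ε ^ p * m e k Set.univ := by
      intro k hk
      have := hme k hk
      have := hmμ k hk
      have hmm := (hmass e ‹_› hce k).trans (hmass μ ‹_› hcμ k).symm
      have hin : ∀ ν : Measure E, ∀ᵐ x ∂m ν k, x ∈ A k := fun ν =>
        Measure.ae_smul_measure (ae_restrict_mem (hA k)) _
      have h1 : ∀ᵐ z ∂prodCoupling (m e k) (m μ k), z.1 ∈ A k := by
        refine ae_of_ae_map (f := Prod.fst) measurable_fst.aemeasurable (p := fun x => x ∈ A k) ?_
        rw [map_fst_prodCoupling hmm]
        exact hin e
      have h2 : ∀ᵐ z ∂prodCoupling (m e k) (m μ k), z.2 ∈ A k := by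
        refine ae_of_ae_map (f := Prod.snd) measurable_snd.aemeasurable (p := fun x => x ∈ A k) ?_
        rw [map_snd_prodCoupling hmm]
        exact hin μ
      calc _ ≤ ∫⁻ _, ε ^ p ∂prodCoupling (m e k) (m μ k) := by
            refine lintegral_mono_ae ?_
            filter_upwards [h1, h2] with z hz1 hz2
            exact ENNReal.rpow_le_rpow (hε k hk _ hz1 _ hz2) hp0.le
        _ = _ := by
          rw [lintegral_const, measure_univ_of_map_eq measurable_fst (map_fst_prodCoupling hmm)]
    refine (Finset.sum_le_sum hk).trans ?_
    rw [← Finset.mul_sum]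
    refine mul_le_of_le_one_right zero_le ?_
    rw [← Measure.finsetSum_apply, ← measure_univ (μ := e)]
    conv_rhs => rw [← hdec e ‹_› hce]
    exact le_self_add
  · -- the remainder
    have hmeas : Measurable fun x : E => ‖x‖ₑ ^ p := by fun_prop
    calc _ ≤ ∫⁻ z, 2 ^ (p - 1) * (‖z.1‖ₑ ^ p + ‖z.2‖ₑ ^ p) ∂prodCoupling (r e) (r μ) :=
          lintegral_mono fun z => edist_rpow_le hp _ _
      _ = 2 ^ (p - 1) * (∫⁻ x, ‖x‖ₑ ^ p ∂r e + ∫⁻ x, ‖x‖ₑ ^ p ∂r μ) := by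
        rw [lintegral_const_mul _ (by fun_prop), lintegral_add_left (by fun_prop)]
        congr 2
        · conv_rhs => rw [← map_fst_prodCoupling hr]
          rw [lintegral_map hmeas measurable_fst]
        · conv_rhs => rw [← map_snd_prodCoupling hr]
          rw [lintegral_map hmeas measurable_snd]
      _ ≤ _ := by
        have hrem : ∀ ν ν' : Measure E, IsProbabilityMeasure ν →
            (∀ k, c k = min (ν (A k)) (ν' (A k))) → ∫⁻ x, ‖x‖ₑ ^ p ∂r ν ≤
              (∫⁻ x in C, ‖x‖ₑ ^ p ∂ν) + ∑ k ∈ s, (ν (A k) - ν' (A k)) * R ^ p := by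
          intro ν ν' hν hc
          simp only [r]
          rw [lintegral_add_measure, lintegral_finsetSum_measure]
          gcongr with k hk
          rw [lintegral_smul_measure, smul_eq_mul]
          have h1 : ∫⁻ x in A k, ‖x‖ₑ ^ p ∂ν ≤ R ^ p * ν (A k) := by
            rw [← setLIntegral_const]
            exact setLIntegral_mono_ae' (hA k) (Eventually.of_forall fun x hx =>
              ENNReal.rpow_le_rpow (hR k hk x hx) hp0.le)
          have h2 : (1 - c k / ν (A k)) * ν (A k) = ν (A k) - ν' (A k) := by
            have hck : c k ≤ ν (A k) := by rw [hc]; exact min_le_left _ _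
            rw [ENNReal.sub_mul fun _ _ => measure_ne_top _ _, one_mul]
            have : c k / ν (A k) * ν (A k) = c k := by
              rcases eq_or_ne (ν (A k)) 0 with h0 | h0
              · have : c k = 0 := le_antisymm (h0 ▸ hck) zero_le
                rw [h0, this, mul_zero]
              · exact ENNReal.div_mul_cancel h0 (measure_ne_top _ _)
            rw [this, hc]
            rcases le_total (ν (A k)) (ν' (A k)) with h | h
            · rw [min_eq_left h, tsub_self, tsub_eq_zero_of_le h]
            · rw [min_eq_right h]
          calc _ ≤ (1 - c k / ν (A k)) * (R ^ p * ν (A k)) := by gcongr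
            _ = ((1 - c k / ν (A k)) * ν (A k)) * R ^ p := by ring
            _ = _ := by rw [h2]
        gcongr
        · exact hrem e μ ‹_› fun k => rfl
        · exact hrem μ e ‹_› fun k => min_comm _ _

end Wasserstein

/-! ### The law of large numbers in Wasserstein distance -/

section Empirical

variable {E : Type*} [MeasurableSpace E]

lemma lintegral_empiricalMeasure {n : ℕ} (x : Fin n → E) {f : E → ℝ≥0∞} (hf : Measurable f) :
    ∫⁻ y, f y ∂empiricalMeasure x = (n : ℝ≥0∞)⁻¹ * ∑ i, f (x i) := by
  rw [empiricalMeasure, lintegral_smul_measure, lintegral_finsetSum_measure, smul_eq_mul]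
  simp_rw [lintegral_dirac' _ hf]

lemma isProbabilityMeasure_empiricalMeasure {n : ℕ} (hn : n ≠ 0) (x : Fin n → E) :
    IsProbabilityMeasure (empiricalMeasure x) := by
  refine ⟨?_⟩
  rw [← lintegral_one, lintegral_empiricalMeasure _ measurable_const]
  simp only [Finset.sum_const, Finset.card_univ, Fintype.card_fin, nsmul_eq_mul, mul_one]
  exact ENNReal.inv_mul_cancel (by exact_mod_cast hn) (ENNReal.natCast_ne_top n)

variable {Ω : Type*} [MeasurableSpace Ω] {P : Measure Ω}

/-- The strong law of large numbers for integrals with respect to empirical measures. -/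
lemma ae_tendsto_lintegral_empiricalMeasure {X : ℕ → Ω → E} {μ : Measure E}
    (hX : ∀ i, Measurable (X i)) (hindep : iIndepFun X P) (hlaw : ∀ i, P.map (X i) = μ)
    {f : E → ℝ≥0∞} (hf : Measurable f) (hf' : ∀ x, f x ≠ ∞) (hfμ : ∫⁻ x, f x ∂μ ≠ ∞) :
    ∀ᵐ ω ∂P, Tendsto (fun n => ∫⁻ x, f x ∂empiricalMeasure fun i : Fin n => X i ω) atTop
      (𝓝 (∫⁻ x, f x ∂μ)) := by
  have hfr : Measurable fun x => (f x).toReal := hf.ennreal_toReal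
  have hl : ∫⁻ ω, f (X 0 ω) ∂P = ∫⁻ x, f x ∂μ := by
    rw [← hlaw 0, lintegral_map hf (hX 0)]
  have hint : Integrable (fun ω => (f (X 0 ω)).toReal) P :=
    integrable_toReal_of_lintegral_ne_top (hf.comp (hX 0)).aemeasurable (by rwa [hl])
  have hlim := strong_law_ae_real (fun i ω => (f (X i ω)).toReal) hint
    (fun i j hij => (hindep.indepFun hij).comp hfr hfr)
    (fun i => (IdentDistrib.mk (hX i).aemeasurable (hX 0).aemeasurable
      ((hlaw i).trans (hlaw 0).symm)).comp hfr)
  have hexp : ∫ ω, (f (X 0 ω)).toReal ∂P = (∫⁻ x, f x ∂μ).toReal := by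
    rw [← hl]
    exact integral_toReal (hf.comp (hX 0)).aemeasurable
      (Eventually.of_forall fun ω => (hf' _).lt_top)
  filter_upwards [hlim] with ω hω
  rw [hexp] at hω
  have h2 := (ENNReal.continuous_ofReal.tendsto _).comp hω
  rw [ENNReal.ofReal_toReal hfμ] at h2
  refine h2.congr' ?_
  filter_upwards [eventually_gt_atTop 0] with n hn
  rw [lintegral_empiricalMeasure _ hf, Function.comp_apply,
    ENNReal.ofReal_div_of_pos (by exact_mod_cast hn), ENNReal.ofReal_natCast,
    ENNReal.div_eq_inv_mul, ENNReal.ofReal_sum_of_nonneg fun _ _ => ENNReal.toReal_nonneg,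
    Finset.sum_range]
  congr 1
  exact Finset.sum_congr rfl fun i _ => ENNReal.ofReal_toReal (hf' _)

end Empirical

/-! ### Small cells and convergence of empirical measures -/

section DenseCell

variable {E : Type*} [NormedAddCommGroup E] [SecondCountableTopology E]

/-- The cells of a countable measurable partition into sets of diameter at most `2 ε`. -/
def denseCell (E : Type*) [NormedAddCommGroup E] [SecondCountableTopology E] (ε : ℝ) : ℕ → Set E :=
  disjointed fun k => Metric.ball (TopologicalSpace.denseSeq E k) ε

lemma denseCell_subset (ε : ℝ) (k : ℕ) :
    denseCell E ε k ⊆ Metric.ball (TopologicalSpace.denseSeq E k) ε :=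
  disjointed_subset _ _

lemma iUnion_denseCell {ε : ℝ} (hε : 0 < ε) : ⋃ k, denseCell E ε k = Set.univ := by
  rw [denseCell, iUnion_disjointed]
  refine Set.eq_univ_of_forall fun x => ?_
  obtain ⟨y, hy, k, rfl⟩ := Metric.dense_iff.1 (TopologicalSpace.denseRange_denseSeq E) x ε hε
  refine Set.mem_iUnion.2 ⟨k, ?_⟩
  rw [Metric.mem_ball, dist_comm]
  exact hy

variable [MeasurableSpace E] [BorelSpace E]

lemma measurableSet_denseCell (ε : ℝ) (k : ℕ) : MeasurableSet (denseCell E ε k) :=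
  MeasurableSet.disjointed (fun _ => measurableSet_ball) k

variable {Ω : Type*} [MeasurableSpace Ω] {P : Measure Ω} {p : ℝ}

/-- The strong law of large numbers in Wasserstein distance. -/
theorem ae_tendsto_wassersteinDist_empiricalMeasure (hp : 1 ≤ p) {X : ℕ → Ω → E} {μ : Measure E}
    (hX : ∀ i, Measurable (X i)) (hindep : iIndepFun X P) (hlaw : ∀ i, P.map (X i) = μ)
    (hμ : MemWasserstein p μ) :
    ∀ᵐ ω ∂P, Tendsto (fun n => wassersteinDist p (empiricalMeasure fun i : Fin n => X i ω) μ ^ p)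
      atTop (𝓝 0) := by
  have := hμ.1
  have hp0 : 0 < p := by linarith
  have hnorm : Measurable fun x : E => ‖x‖ₑ ^ p := by fun_prop
  have hε : ∀ j : ℕ, (0 : ℝ) < 1 / ((j : ℝ) + 1) := fun j => by positivity
  let A : ℕ → ℕ → Set E := fun j => denseCell E (1 / ((j : ℝ) + 1))
  have hA : ∀ j k, MeasurableSet (A j k) := fun j k => measurableSet_denseCell _ _
  let C : ℕ → ℕ → Set E := fun j m => (⋃ k ∈ Finset.range m, A j k)ᶜ
  have hC : ∀ j m, MeasurableSet (C j m) := fun j m =>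
    (Finset.measurableSet_biUnion _ fun k _ => hA j k).compl
  -- almost sure convergence of the relevant statistics
  have h1 : ∀ᵐ ω ∂P, ∀ j k, Tendsto (fun n => (empiricalMeasure fun i : Fin n => X i ω) (A j k))
      atTop (𝓝 (μ (A j k))) := by
    refine ae_all_iff.2 fun j => ae_all_iff.2 fun k => ?_
    have := ae_tendsto_lintegral_empiricalMeasure hX hindep hlaw
      (f := (A j k).indicator 1) (measurable_one.indicator (hA j k))
      (fun x => by
        by_cases h : x ∈ A j k <;> simp [h])
      (by rw [lintegral_indicator_one (hA j k)]; exact measure_ne_top _ _)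
    simpa only [lintegral_indicator_one (hA j k)] using this
  have h2 : ∀ᵐ ω ∂P, ∀ j m, Tendsto (fun n =>
      ∫⁻ x in C j m, ‖x‖ₑ ^ p ∂(empiricalMeasure fun i : Fin n => X i ω)) atTop
      (𝓝 (∫⁻ x in C j m, ‖x‖ₑ ^ p ∂μ)) := by
    refine ae_all_iff.2 fun j => ae_all_iff.2 fun m => ?_
    have := ae_tendsto_lintegral_empiricalMeasure hX hindep hlaw
      (f := (C j m).indicator fun x => ‖x‖ₑ ^ p) (hnorm.indicator (hC j m))
      (fun x => by
        by_cases h : x ∈ C j m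
        · rw [Set.indicator_of_mem h]
          exact ENNReal.rpow_ne_top_of_nonneg hp0.le enorm_ne_top
        · simp [h])
      (by
        rw [lintegral_indicator (hC j m)]
        exact ((setLIntegral_le_lintegral _ _).trans_lt hμ.2).ne)
    simpa only [lintegral_indicator (hC j m)] using this
  -- the tails of `μ` are small
  have h3 : ∀ j, Tendsto (fun m => ∫⁻ x in C j m, ‖x‖ₑ ^ p ∂μ) atTop (𝓝 0) := by
    intro j
    have hfin : IsFiniteMeasure (μ.withDensity fun x => ‖x‖ₑ ^ p) :=
      isFiniteMeasure_withDensity hμ.2.ne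
    have hmono : Antitone (C j) := fun m m' h =>
      Set.compl_subset_compl.2 (Set.biUnion_subset_biUnion_left
        fun k hk => Finset.mem_range.2 ((Finset.mem_range.1 hk).trans_le h))
    have hempty : ⋂ m, C j m = ∅ := by
      rw [← Set.compl_iUnion, Set.compl_empty_iff, ← Set.univ_subset_iff,
        ← iUnion_denseCell (hε j)]
      exact Set.iUnion_subset fun k x hx => Set.mem_iUnion.2 ⟨k + 1,
        Set.mem_biUnion (Finset.mem_range.2 (Nat.lt_succ_self k)) hx⟩
    -- Continuity from above, applied to the finite measure with density ‖x‖^p.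
    have := tendsto_measure_iInter_atTop (μ := μ.withDensity fun x => ‖x‖ₑ ^ p)
      (fun m => (hC j m).nullMeasurableSet) hmono ⟨0, measure_ne_top _ _⟩
    rw [hempty, measure_empty] at this
    exact this.congr fun m => withDensity_apply _ (hC j m)
  have h4 : Tendsto (fun j : ℕ => ENNReal.ofReal (2 * (1 / ((j : ℝ) + 1))) ^ p) atTop (𝓝 0) := by
    have h5 : Tendsto (fun j : ℕ => 2 * (1 / ((j : ℝ) + 1))) atTop (𝓝 (2 * 0)) :=
      tendsto_one_div_add_atTop_nhds_zero_nat.const_mul 2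
    have := ((ENNReal.continuous_rpow_const (y := p)).tendsto _).comp
      ((ENNReal.continuous_ofReal.tendsto _).comp h5)
    rw [mul_zero, ENNReal.ofReal_zero, ENNReal.zero_rpow_of_pos hp0] at this
    exact this
  filter_upwards [h1, h2] with ω hω1 hω2
  refine ENNReal.tendsto_nhds_zero.2 fun η hη => ?_
  -- Order of choices: the cell size j, then the number m of cells retained so that the tail of μ is
  -- small, and only then the sample size n.
  obtain ⟨j, hj⟩ := (h4.eventually_lt_const hη).exists
  have hm : Tendsto (fun m => ENNReal.ofReal (2 * (1 / ((j : ℝ) + 1))) ^ p + 2 ^ (p - 1) *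
      ((∫⁻ x in C j m, ‖x‖ₑ ^ p ∂μ) + ∫⁻ x in C j m, ‖x‖ₑ ^ p ∂μ)) atTop
      (𝓝 (ENNReal.ofReal (2 * (1 / ((j : ℝ) + 1))) ^ p + 2 ^ (p - 1) * (0 + 0))) :=
    tendsto_const_nhds.add (ENNReal.Tendsto.const_mul ((h3 j).add (h3 j))
      (Or.inr (ENNReal.rpow_ne_top_of_nonneg (by linarith) ENNReal.ofNat_ne_top)))
  rw [add_zero, mul_zero, add_zero] at hm
  obtain ⟨m, hm⟩ := (hm.eventually_lt_const hj).exists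
  -- A sum in place of a maximum: any finite bound for the norm on the first m cells suffices, since
  -- it multiplies mass differences that vanish as n grows.
  let R : ℝ≥0∞ := ∑ k ∈ Finset.range m,
    ENNReal.ofReal (‖TopologicalSpace.denseSeq E k‖ + 1 / ((j : ℝ) + 1))
  have hR : R ≠ ∞ := (ENNReal.sum_lt_top.2 fun k _ => ENNReal.ofReal_lt_top).ne
  have hsum : ∀ a b : ℕ → ℕ → ℝ≥0∞, (∀ k, ∃ z, z ≠ ∞ ∧ Tendsto (fun n => a n k) atTop (𝓝 z) ∧
      Tendsto (fun n => b n k) atTop (𝓝 z)) →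
      Tendsto (fun n => ∑ k ∈ Finset.range m, (a n k - b n k) * R ^ p) atTop (𝓝 0) := by
    intro a b h
    rw [← Finset.sum_const_zero (s := Finset.range m)]
    refine tendsto_finsetSum _ fun k _ => ?_
    obtain ⟨z, hz, ha, hb⟩ := h k
    have := ENNReal.Tendsto.mul_const (ENNReal.Tendsto.sub ha hb (Or.inl hz)) (b := R ^ p)
      (Or.inr (ENNReal.rpow_ne_top_of_nonneg hp0.le hR))
    rwa [tsub_self, zero_mul] at this
  have hlim : Tendsto (fun n => ENNReal.ofReal (2 * (1 / ((j : ℝ) + 1))) ^ p + 2 ^ (p - 1) *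
      (((∫⁻ x in C j m, ‖x‖ₑ ^ p ∂(empiricalMeasure fun i : Fin n => X i ω)) +
        ∑ k ∈ Finset.range m,
          ((empiricalMeasure fun i : Fin n => X i ω) (A j k) - μ (A j k)) * R ^ p) +
       ((∫⁻ x in C j m, ‖x‖ₑ ^ p ∂μ) + ∑ k ∈ Finset.range m,
          (μ (A j k) - (empiricalMeasure fun i : Fin n => X i ω) (A j k)) * R ^ p))) atTop
      (𝓝 (ENNReal.ofReal (2 * (1 / ((j : ℝ) + 1))) ^ p + 2 ^ (p - 1) *
        (((∫⁻ x in C j m, ‖x‖ₑ ^ p ∂μ) + 0) + ((∫⁻ x in C j m, ‖x‖ₑ ^ p ∂μ) + 0)))) := by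
    refine tendsto_const_nhds.add (ENNReal.Tendsto.const_mul (((hω2 j m).add (hsum _ _ fun k =>
      ⟨μ (A j k), measure_ne_top _ _, hω1 j k, tendsto_const_nhds⟩)).add
      (tendsto_const_nhds.add (hsum _ _ fun k =>
      ⟨μ (A j k), measure_ne_top _ _, tendsto_const_nhds, hω1 j k⟩)))
      (Or.inr (ENNReal.rpow_ne_top_of_nonneg (by linarith) ENNReal.ofNat_ne_top)))
  simp only [add_zero] at hlim
  filter_upwards [hlim.eventually_lt_const hm, eventually_gt_atTop 0] with n hn hn0
  have := isProbabilityMeasure_empiricalMeasure hn0.ne' fun i : Fin n => X i ω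
  refine (wassersteinDist_rpow_le_of_partition hp _ μ (Finset.range m) (A j) (hA j)
    (disjoint_disjointed _) _ R (fun k _ x hx y hy => ?_) (fun k hk x hx => ?_)).trans hn.le
  · have hx' := denseCell_subset _ _ hx
    have hy' := denseCell_subset _ _ hy
    rw [Metric.mem_ball] at hx' hy'
    rw [edist_dist]
    refine ENNReal.ofReal_le_ofReal ?_
    have := dist_triangle_right x y (TopologicalSpace.denseSeq E k)
    linarith
  · have hx' := denseCell_subset _ _ hx
    rw [Metric.mem_ball, dist_eq_norm] at hx'
    have h6 : ‖x‖ ≤ ‖TopologicalSpace.denseSeq E k‖ + 1 / ((j : ℝ) + 1) := by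
      have := norm_le_norm_add_norm_sub' x (TopologicalSpace.denseSeq E k)
      linarith
    rw [← ofReal_norm]
    exact (ENNReal.ofReal_le_ofReal h6).trans (Finset.single_le_sum
      (f := fun k => ENNReal.ofReal (‖TopologicalSpace.denseSeq E k‖ + 1 / ((j : ℝ) + 1)))
      (fun _ _ => zero_le) hk)

end DenseCell

/-! ### A fixed point theorem -/

/-- A self-map of a complete space that contracts a function equivalent to the distance has a fixed
point. -/
lemma exists_fixedPoint_of_equivalent_dist {X : Type*} [MetricSpace X] [CompleteSpace X]
    [Nonempty X] (Φ : X → X) (D : X → X → ℝ) {M : ℝ} (hM : 0 ≤ M) (hD1 : ∀ x y, dist x y ≤ M * D x y)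
    (hD2 : ∀ x y, D x y ≤ dist x y) (hΦ : ∀ x y, D (Φ x) (Φ y) ≤ 1 / 2 * D x y) :
    ∃ x, Φ x = x := by
  have hiter : ∀ n x y, D (Φ^[n] x) (Φ^[n] y) ≤ (1 / 2) ^ n * D x y := by
    intro n x y
    induction n with
    | zero => simp
    | succ n ih =>
      rw [Function.iterate_succ_apply', Function.iterate_succ_apply', pow_succ']
      refine (hΦ _ _).trans ?_
      rw [mul_assoc]
      gcongr
  -- After enough iterations the factor 2^{-n} beats the equivalence constant M, so an iterate
  -- contracts the true distance; its fixed point is fixed by Φ as well.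
  obtain ⟨n, hn⟩ := exists_pow_lt_of_lt_one (show (0 : ℝ) < 1 / (M + 1) by positivity)
    (show (1 / 2 : ℝ) < 1 by norm_num)
  have hK : M * (1 / 2) ^ n < 1 := by
    rw [lt_div_iff₀ (by positivity)] at hn
    have : (0 : ℝ) < (1 / 2) ^ n := by positivity
    nlinarith
  have hc : ContractingWith (M * (1 / 2) ^ n).toNNReal Φ^[n] := by
    refine ⟨by rwa [Real.toNNReal_lt_one], LipschitzWith.of_dist_le_mul fun x y => ?_⟩
    rw [Real.coe_toNNReal _ (by positivity), mul_assoc]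
    refine (hD1 _ _).trans ?_
    gcongr
    refine (hiter n x y).trans ?_
    gcongr
    exact hD2 x y
  exact ⟨_, hc.isFixedPt_fixedPoint_iterate⟩

/-! ### Exponentially weighted norms of paths -/

section Damp

variable {E : Type*} [NormedAddCommGroup E] [NormedSpace ℝ E] {T : ℝ}

/-- Multiplication of a path by `exp (-l t)`. -/
def damp (l : ℝ) : C(Set.Icc (0 : ℝ) T, E) →ₗ[ℝ] C(Set.Icc (0 : ℝ) T, E) where
  toFun v := ⟨fun t => Real.exp (-(l * t)) • v t, by fun_prop⟩
  map_add' v w := by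
    ext t
    exact smul_add _ _ _
  map_smul' a v := by
    ext t
    exact smul_comm _ _ _

lemma damp_apply (l : ℝ) (v : C(Set.Icc (0 : ℝ) T, E)) (t : Set.Icc (0 : ℝ) T) :
    damp l v t = Real.exp (-(l * t)) • v t := rfl

lemma norm_damp_apply (l : ℝ) (v : C(Set.Icc (0 : ℝ) T, E)) (t : Set.Icc (0 : ℝ) T) :
    ‖damp l v t‖ = Real.exp (-(l * t)) * ‖v t‖ := by
  rw [damp_apply, norm_smul, Real.norm_of_nonneg (Real.exp_pos _).le]

lemma norm_apply_le_damp (l : ℝ) (v : C(Set.Icc (0 : ℝ) T, E)) (t : Set.Icc (0 : ℝ) T) :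
    ‖v t‖ ≤ ‖damp l v‖ * Real.exp (l * t) := by
  have h := (damp l v).norm_coe_le_norm t
  rw [norm_damp_apply, Real.exp_neg, ← div_eq_inv_mul, div_le_iff₀ (Real.exp_pos _)] at h
  exact h

lemma norm_damp_le_of_forall {l : ℝ} {v : C(Set.Icc (0 : ℝ) T, E)} {N : ℝ} (hN : 0 ≤ N)
    (h : ∀ t : Set.Icc (0 : ℝ) T, ‖v t‖ ≤ N * Real.exp (l * t)) : ‖damp l v‖ ≤ N := by
  refine (ContinuousMap.norm_le _ hN).2 fun t => ?_
  rw [norm_damp_apply, Real.exp_neg, ← div_eq_inv_mul, div_le_iff₀ (Real.exp_pos _)]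
  exact h t

variable {l : ℝ}

lemma norm_damp_le (hl : 0 ≤ l) (v : C(Set.Icc (0 : ℝ) T, E)) : ‖damp l v‖ ≤ ‖v‖ := by
  refine norm_damp_le_of_forall (norm_nonneg _) fun t => ?_
  exact (v.norm_coe_le_norm t).trans (le_mul_of_one_le_right (norm_nonneg _)
    (Real.one_le_exp (mul_nonneg hl t.2.1)))

lemma norm_le_damp (hl : 0 ≤ l) (v : C(Set.Icc (0 : ℝ) T, E)) :
    ‖v‖ ≤ Real.exp (l * T) * ‖damp l v‖ := by
  refine (ContinuousMap.norm_le _ (by positivity)).2 fun t => ?_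
  refine (norm_apply_le_damp l v t).trans ?_
  rw [mul_comm]
  gcongr
  exact t.2.2

lemma continuous_damp (hl : 0 ≤ l) :
    Continuous (damp l : C(Set.Icc (0 : ℝ) T, E) → C(Set.Icc (0 : ℝ) T, E)) :=
  AddMonoidHomClass.continuous_of_bound (damp l) 1 fun v => by
    rw [one_mul]
    exact norm_damp_le hl v

end Damp

/-! ### Flows of measures and the drift along a path -/

section Flow

variable {E : Type*} [NormedAddCommGroup E] [MeasurableSpace E] [BorelSpace E]
  {T p : ℝ} [MeasurableSpace C(Set.Icc (0 : ℝ) T, E)] [BorelSpace C(Set.Icc (0 : ℝ) T, E)]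

/-- The flow of marginals of a measure on paths. -/
def flow (μ : Measure C(Set.Icc (0 : ℝ) T, E)) (t : Set.Icc (0 : ℝ) T) : Measure E :=
  μ.map fun v => v t

lemma measurable_eval (t : Set.Icc (0 : ℝ) T) :
    Measurable fun v : C(Set.Icc (0 : ℝ) T, E) => v t :=
  (continuous_eval_const t).measurable

variable [SecondCountableTopology E]

lemma memWasserstein_flow (hp : 0 < p) {μ : Measure C(Set.Icc (0 : ℝ) T, E)}
    (hμ : MemWasserstein p μ) (t : Set.Icc (0 : ℝ) T) : MemWasserstein p (flow μ t) := by
  have := hμ.1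
  refine ⟨Measure.isProbabilityMeasure_map (measurable_eval t).aemeasurable, ?_⟩
  rw [flow, lintegral_map (by fun_prop) (measurable_eval t)]
  refine lt_of_le_of_lt (lintegral_mono fun v => ?_) hμ.2
  refine ENNReal.rpow_le_rpow ?_ hp.le
  rw [← ofReal_norm, ← ofReal_norm]
  exact ENNReal.ofReal_le_ofReal (v.norm_coe_le_norm t)

/-- The joint law of f_s and g_t under π is an admissible coupling of the two marginals. -/
lemma wassersteinDist_flow_rpow_le (hp : 0 < p) {X : Type*} [MeasurableSpace X] (π : Measure X)
    {f g : X → C(Set.Icc (0 : ℝ) T, E)} (hf : Measurable f) (hg : Measurable g)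
    (s t : Set.Icc (0 : ℝ) T) :
    wassersteinDist p (flow (π.map f) s) (flow (π.map g) t) ^ p ≤
      ∫⁻ x, edist (f x s) (g x t) ^ p ∂π := by
  have hfs : Measurable fun x => f x s := (measurable_eval s).comp hf
  have hgt : Measurable fun x => g x t := (measurable_eval t).comp hg
  have h := wassersteinDist_rpow_le hp (π := π.map fun x => (f x s, g x t))
    (μ := flow (π.map f) s) (ν := flow (π.map g) t) ?_ ?_
  · rwa [lintegral_map (by fun_prop) (hfs.prodMk hgt)] at h
  · rw [Measure.map_map measurable_fst (hfs.prodMk hgt), flow,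
      Measure.map_map (measurable_eval s) hf]
    rfl
  · rw [Measure.map_map measurable_snd (hfs.prodMk hgt), flow,
      Measure.map_map (measurable_eval t) hg]
    rfl

/-- The flow of marginals is continuous in Wasserstein distance. -/
lemma tendsto_wassersteinDist_flow (hp : 1 ≤ p) {μ : Measure C(Set.Icc (0 : ℝ) T, E)}
    (hμ : MemWasserstein p μ) (t : Set.Icc (0 : ℝ) T) :
    Tendsto (fun s => wassersteinDist p (flow μ s) (flow μ t) ^ p) (𝓝 t) (𝓝 0) := by
  have hp0 : 0 < p := by linarith
  have hle : ∀ s, wassersteinDist p (flow μ s) (flow μ t) ^ p ≤ ∫⁻ v, edist (v s) (v t) ^ p ∂μ := by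
    intro s
    have := wassersteinDist_flow_rpow_le hp0 μ measurable_id measurable_id s t
    rwa [Measure.map_id] at this
  refine tendsto_of_tendsto_of_tendsto_of_le_of_le tendsto_const_nhds ?_ (fun _ => zero_le) hle
  have hzero : ∫⁻ v : C(Set.Icc (0 : ℝ) T, E), edist (v t) (v t) ^ p ∂μ = 0 := by
    simp [ENNReal.zero_rpow_of_pos hp0]
  rw [← hzero]
  refine tendsto_lintegral_filter_of_dominated_convergence
    (fun v => 2 ^ (p - 1) * (‖v‖ₑ ^ p + ‖v‖ₑ ^ p)) (Eventually.of_forall fun s => ?_)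
    (Eventually.of_forall fun s => Eventually.of_forall fun v => ?_) ?_
    (Eventually.of_forall fun v => ?_)
  · exact ((measurable_eval s).edist (measurable_eval t)).pow_const p
  · refine (edist_rpow_le hp _ _).trans ?_
    have h : ∀ s, ‖v s‖ₑ ≤ ‖v‖ₑ := fun s => by
      rw [← ofReal_norm, ← ofReal_norm]
      exact ENNReal.ofReal_le_ofReal (v.norm_coe_le_norm s)
    have := h s
    have := h t
    gcongr
  · rw [lintegral_const_mul _ (by fun_prop), lintegral_add_left (by fun_prop)]
    exact ENNReal.mul_ne_top (ENNReal.rpow_ne_top_of_nonneg (by linarith) ENNReal.ofNat_ne_top)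
      (ENNReal.add_ne_top.2 ⟨hμ.2.ne, hμ.2.ne⟩)
  · have : Continuous fun s => edist (v s) (v t) ^ p :=
      (ENNReal.continuous_rpow_const (y := p)).comp (by fun_prop)
    exact this.tendsto t

variable {F : Type*} [NormedAddCommGroup F]

/-- The Lipschitz condition on a drift with values in a normed space. -/
def IsLipschitzDrift (p : ℝ) (L : ℝ≥0) (g : E → Measure E → F) : Prop :=
  ∀ (v₁ v₂ : E) (ν₁ ν₂ : Measure E), MemWasserstein p ν₁ → MemWasserstein p ν₂ →
    ‖g v₁ ν₁ - g v₂ ν₂‖ₑ ^ p ≤ (L : ℝ≥0∞) ^ p * (‖v₁ - v₂‖ₑ ^ p + wassersteinDist p ν₁ ν₂ ^ p)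

/-- The Lipschitz bound reduces this to continuity of v and Wasserstein continuity of the flow. It
makes the drift a legitimate input of the Duhamel operator. -/
lemma continuous_drift {g : E → Measure E → F} {L : ℝ≥0} (hp : 1 ≤ p)
    (hg : IsLipschitzDrift p L g) {μ : Measure C(Set.Icc (0 : ℝ) T, E)} (hμ : MemWasserstein p μ)
    (v : C(Set.Icc (0 : ℝ) T, E)) : Continuous fun t => g (v t) (flow μ t) := by
  have hp0 : 0 < p := by linarith
  rw [continuous_iff_continuousAt]
  intro t
  rw [ContinuousAt, tendsto_iff_edist_tendsto_0]
  have h1 : Tendsto (fun s => (L : ℝ≥0∞) ^ p * (‖v s - v t‖ₑ ^ p +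
      wassersteinDist p (flow μ s) (flow μ t) ^ p)) (𝓝 t) (𝓝 0) := by
    have h2 : Tendsto (fun s => ‖v s - v t‖ₑ ^ p) (𝓝 t) (𝓝 0) := by
      have h3 : Continuous fun s => ‖v s - v t‖ₑ ^ p :=
        (ENNReal.continuous_rpow_const (y := p)).comp (by fun_prop)
      simpa [ENNReal.zero_rpow_of_pos hp0] using h3.tendsto t
    have := ENNReal.Tendsto.const_mul (h2.add (tendsto_wassersteinDist_flow hp hμ t))
      (a := (L : ℝ≥0∞) ^ p) (Or.inr (ENNReal.rpow_ne_top_of_nonneg hp0.le ENNReal.coe_ne_top))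
    simpa using this
  have h4 : Tendsto (fun s => (‖g (v s) (flow μ s) - g (v t) (flow μ t)‖ₑ ^ p) ^ p⁻¹) (𝓝 t)
      (𝓝 0) := by
    have h5 := tendsto_of_tendsto_of_tendsto_of_le_of_le tendsto_const_nhds h1
      (fun _ => zero_le) (fun s => hg (v s) (v t) _ _ (memWasserstein_flow hp0 hμ s)
        (memWasserstein_flow hp0 hμ t))
    have h6 := ((ENNReal.continuous_rpow_const (y := p⁻¹)).tendsto 0).comp h5
    rwa [ENNReal.zero_rpow_of_pos (inv_pos.2 hp0)] at h6
  simpa only [ENNReal.rpow_rpow_inv hp0.ne', edist_eq_enorm_sub] using h4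

open Classical in
/-- The path `t ↦ g (v_t, μ_t)`. -/
def driftPath (g : E → Measure E → F) (μ : Measure C(Set.Icc (0 : ℝ) T, E))
    (v : C(Set.Icc (0 : ℝ) T, E)) : C(Set.Icc (0 : ℝ) T, F) :=
  if h : Continuous fun t => g (v t) (flow μ t) then ⟨_, h⟩ else 0

lemma driftPath_apply {g : E → Measure E → F} {L : ℝ≥0} (hp : 1 ≤ p)
    (hg : IsLipschitzDrift p L g) {μ : Measure C(Set.Icc (0 : ℝ) T, E)} (hμ : MemWasserstein p μ)
    (v : C(Set.Icc (0 : ℝ) T, E)) (t : Set.Icc (0 : ℝ) T) :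
    driftPath g μ v t = g (v t) (flow μ t) := by
  rw [driftPath, dif_pos (continuous_drift hp hg hμ v)]
  rfl

variable [NormedSpace ℝ E] [NormedSpace ℝ F]

/-- The Lipschitz estimate for the drift in the weighted norm. -/
lemma norm_damp_driftPath_sub_le {g : E → Measure E → F} {L : ℝ≥0} (hp : 1 ≤ p)
    (hg : IsLipschitzDrift p L g) {l : ℝ} {X : Type*} [MeasurableSpace X] (π : Measure X)
    {x y : X → C(Set.Icc (0 : ℝ) T, E)} (hx : Measurable x) (hy : Measurable y)
    (hμ : MemWasserstein p (π.map x)) (hν : MemWasserstein p (π.map y)) {c : ℝ} (hc : 0 ≤ c)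
    (hπ : ∫⁻ z, ‖damp l (x z - y z)‖ₑ ^ p ∂π ≤ ENNReal.ofReal c ^ p)
    (v w : C(Set.Icc (0 : ℝ) T, E)) :
    ‖damp l (driftPath g (π.map x) v - driftPath g (π.map y) w)‖ ≤
      L * (‖damp l (v - w)‖ + c) := by
  have hp0 : 0 < p := by linarith
  refine (ContinuousMap.norm_le _ (by positivity)).2 fun t => ?_
  set e := ENNReal.ofReal (Real.exp (-(l * t))) with he
  have hdamp : ∀ {G : Type _} [NormedAddCommGroup G] [NormedSpace ℝ G]
      (u : C(Set.Icc (0 : ℝ) T, G)), ‖damp l u t‖ₑ = e * ‖u t‖ₑ := by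
    intro G _ _ u
    rw [← ofReal_norm, norm_damp_apply, ENNReal.ofReal_mul (Real.exp_pos _).le, ofReal_norm]
  have hdamp' : ∀ u : C(Set.Icc (0 : ℝ) T, E), e * ‖u t‖ₑ ≤ ‖damp l u‖ₑ := by
    intro u
    rw [he, ← ofReal_norm, ← ofReal_norm, ← ENNReal.ofReal_mul (Real.exp_pos _).le,
      ← norm_damp_apply]
    exact ENNReal.ofReal_le_ofReal ((damp l u).norm_coe_le_norm t)
  -- At time t the drift sees the path and the laws only at that same time, so one factor e^{-lt}
  -- weights both terms.
  have hkey : ‖damp l (driftPath g (π.map x) v - driftPath g (π.map y) w) t‖ₑ ^ p ≤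
      (L * (‖damp l (v - w)‖ₑ + ENNReal.ofReal c)) ^ p := by
    rw [hdamp, ContinuousMap.sub_apply, driftPath_apply hp hg hμ, driftPath_apply hp hg hν,
      ENNReal.mul_rpow_of_nonneg _ _ hp0.le, ENNReal.mul_rpow_of_nonneg _ _ hp0.le]
    calc _ ≤ e ^ p * ((L : ℝ≥0∞) ^ p * (‖v t - w t‖ₑ ^ p +
          ∫⁻ z, edist (x z t) (y z t) ^ p ∂π)) := by
          gcongr
          refine (hg _ _ _ _ (memWasserstein_flow hp0 hμ t) (memWasserstein_flow hp0 hν t)).trans ?_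
          gcongr
          exact wassersteinDist_flow_rpow_le hp0 π hx hy t t
      _ = (L : ℝ≥0∞) ^ p * ((e * ‖(v - w) t‖ₑ) ^ p +
          ∫⁻ z, (e * ‖(x z - y z) t‖ₑ) ^ p ∂π) := by
        simp_rw [ENNReal.mul_rpow_of_nonneg _ _ hp0.le]
        rw [lintegral_const_mul']
        · simp_rw [ContinuousMap.sub_apply, edist_eq_enorm_sub]
          ring
        · exact ENNReal.rpow_ne_top_of_nonneg hp0.le ENNReal.ofReal_ne_top
      _ ≤ (L : ℝ≥0∞) ^ p * (‖damp l (v - w)‖ₑ ^ p + ∫⁻ z, ‖damp l (x z - y z)‖ₑ ^ p ∂π) := by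
        have := hdamp' (v - w)
        gcongr
        exact hdamp' _
      _ ≤ (L : ℝ≥0∞) ^ p * (‖damp l (v - w)‖ₑ ^ p + ENNReal.ofReal c ^ p) := by gcongr
      _ ≤ _ := by
        gcongr
        exact ENNReal.add_rpow_le_rpow_add _ _ hp
  have h1 := (ENNReal.rpow_le_rpow_iff hp0).1 hkey
  rw [← ofReal_norm, ← ofReal_norm, ← ENNReal.ofReal_add (norm_nonneg _) hc,
    ← ENNReal.ofReal_coe_nnreal, ← ENNReal.ofReal_mul L.coe_nonneg] at h1
  exact (ENNReal.ofReal_le_ofReal_iff (by positivity)).1 h1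

end Flow

/-! ### Moments and `L^p` norms -/

section Moments

variable {X : Type*} [NormedAddCommGroup X] {Ω : Type*} [MeasurableSpace Ω] {P : Measure Ω} {p : ℝ}

lemma lintegral_enorm_rpow (hp : 0 < p) (f : Ω → X) :
    ∫⁻ ω, ‖f ω‖ₑ ^ p ∂P = eLpNorm f (ENNReal.ofReal p) P ^ p := by
  rw [eLpNorm_eq_lintegral_rpow_enorm_toReal (by simpa using hp) ENNReal.ofReal_ne_top,
    ENNReal.toReal_ofReal hp.le, one_div, ENNReal.rpow_inv_rpow hp.ne']

lemma eLpNorm_le_ofReal [IsProbabilityMeasure P] {q : ℝ≥0∞} {f : Ω → X} {r : ℝ}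
    (h : ∀ᵐ ω ∂P, ‖f ω‖ ≤ r) : eLpNorm f q P ≤ ENNReal.ofReal r := by
  simpa using eLpNorm_le_of_ae_bound (p := q) h

/-- Functions with a Lipschitz bound preserve `L^q`. -/
lemma _root_.MeasureTheory.MemLp.comp_of_norm_sub_le [IsFiniteMeasure P] {Y : Type*}
    [NormedAddCommGroup Y] {q : ℝ≥0∞} {a : Ω → X} (ha : MemLp a q P) {f : X → Y}
    (hf : AEStronglyMeasurable (fun ω => f (a ω)) P) {C : ℝ}
    (hC : ∀ x y, ‖f x - f y‖ ≤ C * ‖x - y‖) : MemLp (fun ω => f (a ω)) q P := by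
  have h1 : MemLp (fun ω => f (a ω) - f 0) q P :=
    ha.of_le_mul (hf.sub aestronglyMeasurable_const)
      (Eventually.of_forall fun ω => by simpa using hC (a ω) 0)
  have h2 := h1.add (memLp_const (f 0))
  have h3 : (fun ω => f (a ω)) = (fun ω => f (a ω) - f 0) + fun _ => f 0 :=
    funext fun ω => (sub_add_cancel _ _).symm
  rwa [h3]

variable [MeasurableSpace X] [BorelSpace X] [SecondCountableTopology X]

lemma memWasserstein_map_iff [IsProbabilityMeasure P] (hp : 0 < p) {u : Ω → X}
    (hu : Measurable u) :
    MemWasserstein p (P.map u) ↔ MemLp u (ENNReal.ofReal p) P := by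
  rw [MemWasserstein, lintegral_map (by fun_prop) hu, lintegral_enorm_rpow hp,
    ENNReal.rpow_lt_top_iff_of_pos hp]
  exact ⟨fun h => ⟨hu.aestronglyMeasurable, h.2⟩,
    fun h => ⟨Measure.isProbabilityMeasure_map hu.aemeasurable, h.2⟩⟩

end Moments

/-! ### The uniform measure on a finite set -/

/-- The uniform measure on a finite set. -/
abbrev uniformFin (n : ℕ) : Measure (Fin n) := empiricalMeasure id

lemma map_uniformFin {X : Type*} [MeasurableSpace X] {n : ℕ} (x : Fin n → X) :
    (uniformFin n).map x = empiricalMeasure x := by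
  rw [uniformFin, empiricalMeasure, empiricalMeasure, Measure.map_smul,
    map_sum_measure _ _ (measurable_of_finite x)]
  congr 1
  exact Finset.sum_congr rfl fun i _ => Measure.map_dirac' (measurable_of_finite x) _

/-- Every label has positive mass. Almost sure statements about a random label are therefore
statements about each field. -/
lemma ae_uniformFin_iff {n : ℕ} {q : Fin n → Prop} : (∀ᵐ i ∂uniformFin n, q i) ↔ ∀ i, q i := by
  refine ⟨fun hq i => ?_, fun hq => Eventually.of_forall hq⟩
  by_contra hi
  have h0 : uniformFin n {i | ¬ q i} = 0 := hq
  rw [uniformFin, empiricalMeasure, Measure.smul_apply, Measure.finsetSum_apply, smul_eq_mul,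
    mul_eq_zero, Finset.sum_eq_zero_iff] at h0
  rcases h0 with h0 | h0
  · exact ENNReal.inv_ne_zero.2 (ENNReal.natCast_ne_top n) h0
  · have := h0 i (Finset.mem_univ i)
    rw [Measure.dirac_apply' _ (Set.toFinite _).measurableSet] at this
    simp [hi] at this

lemma memLp_uniformFin {X : Type*} [NormedAddCommGroup X] {n : ℕ} (hn : n ≠ 0)
    (q : ℝ≥0∞) (f : Fin n → X) : MemLp f q (uniformFin n) := by
  have := isProbabilityMeasure_empiricalMeasure hn (id : Fin n → Fin n)
  exact MemLp.of_bound (StronglyMeasurable.of_discrete).aestronglyMeasurable (∑ i, ‖f i‖)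
    (Eventually.of_forall fun i => Finset.single_le_sum (f := fun i => ‖f i‖)
      (fun _ _ => norm_nonneg _) (Finset.mem_univ i))

lemma memWasserstein_empiricalMeasure {X : Type*} [NormedAddCommGroup X] [MeasurableSpace X]
    [BorelSpace X] [SecondCountableTopology X] {p : ℝ} (hp : 0 < p) {n : ℕ} (hn : n ≠ 0)
    (u : Fin n → X) : MemWasserstein p (empiricalMeasure u) := by
  have := isProbabilityMeasure_empiricalMeasure hn (id : Fin n → Fin n)
  rw [← map_uniformFin, memWasserstein_map_iff hp (measurable_of_finite u)]
  exact memLp_uniformFin hn _ _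

/-! ### The abstract mean field equation -/

/-- Equal laws are coupled at zero cost; this is the case c = 0 of the estimates below. -/
lemma lintegral_enorm_damp_sub_self {E : Type*} [NormedAddCommGroup E] [NormedSpace ℝ E]
    {T p l : ℝ} (hp : 0 < p) {X : Type*} [MeasurableSpace X] (π : Measure X)
    (x : X → C(Set.Icc (0 : ℝ) T, E)) :
    ∫⁻ z, ‖damp l (x z - x z)‖ₑ ^ p ∂π ≤ ENNReal.ofReal 0 ^ p := by
  have h0 : ∀ z, ‖damp l (x z - x z)‖ₑ ^ p = 0 := fun z => by
    rw [sub_self, map_zero, ← ofReal_norm, norm_zero, ENNReal.ofReal_zero,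
      ENNReal.zero_rpow_of_pos hp]
  simp only [h0, lintegral_zero, zero_le]

section MeanField

variable {E F : Type*} [NormedAddCommGroup E] [NormedSpace ℝ E] [MeasurableSpace E] [BorelSpace E]
  [SecondCountableTopology E] [NormedAddCommGroup F] [NormedSpace ℝ F] {T p l κ : ℝ} {L : ℝ≥0}
  [MeasurableSpace C(Set.Icc (0 : ℝ) T, E)] [BorelSpace C(Set.Icc (0 : ℝ) T, E)]
  {g : E → Measure E → F} {B : C(Set.Icc (0 : ℝ) T, F) →ₗ[ℝ] C(Set.Icc (0 : ℝ) T, E)}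

/-- The drift `g` composed with the linear operator `B` is a strict contraction in the weighted
norm. -/
structure IsContractiveDrift (p : ℝ) (L : ℝ≥0) (l κ : ℝ) (g : E → Measure E → F)
    (B : C(Set.Icc (0 : ℝ) T, F) →ₗ[ℝ] C(Set.Icc (0 : ℝ) T, E)) : Prop where
  one_le : 1 ≤ p
  lipschitz : IsLipschitzDrift p L g
  rate_nonneg : 0 ≤ l
  const_nonneg : 0 ≤ κ
  bound : ∀ f, ‖damp l (B f)‖ ≤ κ * ‖damp l f‖
  small : κ * L ≤ 1 / 4

namespace IsContractiveDrift

variable (h : IsContractiveDrift p L l κ g B)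
include h

/-- Here x and y realize the two laws on a common space, and c bounds their weighted L^p distance. A
constant 1/4 for each of path and law leaves room to absorb both. -/
lemma norm_damp_sub_le {X : Type*} [MeasurableSpace X] (π : Measure X)
    {x y : X → C(Set.Icc (0 : ℝ) T, E)} (hx : Measurable x) (hy : Measurable y)
    (hμ : MemWasserstein p (π.map x)) (hν : MemWasserstein p (π.map y)) {c : ℝ} (hc : 0 ≤ c)
    (hπ : ∫⁻ z, ‖damp l (x z - y z)‖ₑ ^ p ∂π ≤ ENNReal.ofReal c ^ p)
    (v w : C(Set.Icc (0 : ℝ) T, E)) :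
    ‖damp l (B (driftPath g (π.map x) v) - B (driftPath g (π.map y) w))‖ ≤
      1 / 4 * (‖damp l (v - w)‖ + c) := by
  rw [← map_sub]
  refine (h.bound _).trans ((mul_le_mul_of_nonneg_left (norm_damp_driftPath_sub_le h.one_le
    h.lipschitz π hx hy hμ hν hc hπ v w) h.const_nonneg).trans ?_)
  rw [← mul_assoc]
  exact mul_le_mul_of_nonneg_right h.small (by positivity)

/-- Stability of the equation with a given flow of measures. -/
lemma norm_damp_solution_sub_le {X : Type*} [MeasurableSpace X] (π : Measure X)
    {x y : X → C(Set.Icc (0 : ℝ) T, E)} (hx : Measurable x) (hy : Measurable y)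
    (hμ : MemWasserstein p (π.map x)) (hν : MemWasserstein p (π.map y)) {c : ℝ} (hc : 0 ≤ c)
    (hπ : ∫⁻ z, ‖damp l (x z - y z)‖ₑ ^ p ∂π ≤ ENNReal.ofReal c ^ p)
    {a b v w : C(Set.Icc (0 : ℝ) T, E)} (hv : v = a + B (driftPath g (π.map x) v))
    (hw : w = b + B (driftPath g (π.map y) w)) :
    ‖damp l (v - w)‖ ≤ 2 * ‖damp l (a - b)‖ + c / 2 := by
  have h1 := h.norm_damp_sub_le π hx hy hμ hν hc hπ v w
  have h2 : v - w = (a - b) + (B (driftPath g (π.map x) v) - B (driftPath g (π.map y) w)) := by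
    conv_lhs => rw [hv, hw]
    abel
  have h3 : ‖damp l (v - w)‖ ≤ ‖damp l (a - b)‖ +
      ‖damp l (B (driftPath g (π.map x) v) - B (driftPath g (π.map y) w))‖ := by
    conv_lhs => rw [h2, map_add]
    exact norm_add_le _ _
  -- With d the left-hand side, d ≤ ‖a - b‖ + (d + c)/4 in weighted norms; absorbing d/4 gives the
  -- factors 4/3 and 1/3, rounded up to 2 and 1/2.
  linarith [norm_nonneg (damp l (a - b))]

/-- Both equations use the same flow, so path space with the identity map is a coupling of cost
zero. The case a = b is uniqueness for the frozen equation. -/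
lemma norm_solution_sub_le {μ : Measure C(Set.Icc (0 : ℝ) T, E)} (hμ : MemWasserstein p μ)
    {a b v w : C(Set.Icc (0 : ℝ) T, E)} (hv : v = a + B (driftPath g μ v))
    (hw : w = b + B (driftPath g μ w)) : ‖v - w‖ ≤ 2 * Real.exp (l * T) * ‖a - b‖ := by
  have hp0 : 0 < p := by linarith [h.one_le]
  have hμ' : MemWasserstein p (μ.map id) := by rwa [Measure.map_id]
  have h1 := h.norm_damp_solution_sub_le μ measurable_id measurable_id hμ' hμ' le_rfl
    (lintegral_enorm_damp_sub_self hp0 μ id) (a := a) (b := b) (v := v) (w := w)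
    (by rwa [Measure.map_id]) (by rwa [Measure.map_id])
  calc ‖v - w‖ ≤ Real.exp (l * T) * ‖damp l (v - w)‖ := norm_le_damp h.rate_nonneg _
    _ ≤ Real.exp (l * T) * (2 * ‖a - b‖) := by
      gcongr
      linarith [norm_damp_le h.rate_nonneg (a - b)]
    _ = _ := by ring

/-- The equation with a given flow of measures is solvable. -/
lemma exists_solution [CompleteSpace E] {μ : Measure C(Set.Icc (0 : ℝ) T, E)}
    (hμ : MemWasserstein p μ) (a : C(Set.Icc (0 : ℝ) T, E)) :
    ∃ v, v = a + B (driftPath g μ v) := by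
  have hp0 : 0 < p := by linarith [h.one_le]
  have hμ' : MemWasserstein p (μ.map id) := by rwa [Measure.map_id]
  obtain ⟨v, hv⟩ := exists_fixedPoint_of_equivalent_dist
    (fun v => a + B (driftPath g μ v)) (fun v w => ‖damp l (v - w)‖)
    (M := Real.exp (l * T)) (by positivity)
    (fun v w => by rw [dist_eq_norm]; exact norm_le_damp h.rate_nonneg _)
    (fun v w => by rw [dist_eq_norm]; exact norm_damp_le h.rate_nonneg _)
    (fun v w => by
      have h1 := h.norm_damp_sub_le μ measurable_id measurable_id hμ' hμ' le_rfl
        (lintegral_enorm_damp_sub_self hp0 μ id) v w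
      rw [Measure.map_id] at h1
      rw [add_sub_add_left_eq_sub]
      linarith [norm_nonneg (damp l (v - w))])
  exact ⟨v, hv.symm⟩

/-- The equation with a given flow of measures has a solution map which is Lipschitz continuous. -/
lemma exists_solutionMap [CompleteSpace E] {μ : Measure C(Set.Icc (0 : ℝ) T, E)}
    (hμ : MemWasserstein p μ) :
    ∃ S : C(Set.Icc (0 : ℝ) T, E) → C(Set.Icc (0 : ℝ) T, E),
      (∀ a, S a = a + B (driftPath g μ (S a))) ∧
      ∀ a b, ‖S a - S b‖ ≤ 2 * Real.exp (l * T) * ‖a - b‖ := by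
  choose S hS using fun a => h.exists_solution hμ a
  exact ⟨S, hS, fun a b => h.norm_solution_sub_le hμ (hS a) (hS b)⟩

end IsContractiveDrift

lemma continuous_of_norm_sub_le {X Y : Type*} [NormedAddCommGroup X] [NormedAddCommGroup Y]
    {S : X → Y} {K : ℝ} (hK : 0 ≤ K) (hS : ∀ a b, ‖S a - S b‖ ≤ K * ‖a - b‖) : Continuous S :=
  (LipschitzWith.of_dist_le_mul (K := K.toNNReal) fun a b => by
    rw [dist_eq_norm, dist_eq_norm, Real.coe_toNNReal _ hK]
    exact hS a b).continuous

/-- The random path `u` solves the mean field equation with random input `a`. -/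
structure IsAbstractMeanField {Ω : Type*} [MeasurableSpace Ω] (P : Measure Ω) (p : ℝ)
    (g : E → Measure E → F) (B : C(Set.Icc (0 : ℝ) T, F) →ₗ[ℝ] C(Set.Icc (0 : ℝ) T, E))
    (a u : Ω → C(Set.Icc (0 : ℝ) T, E)) : Prop where
  measurable : Measurable u
  memWasserstein : MemWasserstein p (P.map u)
  ae_eq : ∀ᵐ ω ∂P, u ω = a ω + B (driftPath g (P.map u) (u ω))

namespace IsContractiveDrift

variable (h : IsContractiveDrift p L l κ g B) {Ω : Type*} [MeasurableSpace Ω] {P : Measure Ω}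
  [IsProbabilityMeasure P]
include h

/-- Stability of the mean field equation. -/
lemma eLpNorm_damp_sub_le {a b u v : Ω → C(Set.Icc (0 : ℝ) T, E)} (ha : Measurable a)
    (hb : Measurable b) (hu : IsAbstractMeanField P p g B a u) (hv : IsAbstractMeanField P p g B b v)
    {d : ℝ} (hd : 0 ≤ d)
    (hab : eLpNorm (fun ω => damp l (a ω - b ω)) (ENNReal.ofReal p) P ≤ ENNReal.ofReal d) :
    ∀ᵐ ω ∂P, ‖damp l (u ω - v ω)‖ ≤ 2 * ‖damp l (a ω - b ω)‖ + 2 * d := by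
  have hp0 : 0 < p := by linarith [h.one_le]
  have hp1 : 1 ≤ ENNReal.ofReal p := by simpa using h.one_le
  have hdamp := continuous_damp (E := E) (T := T) h.rate_nonneg
  have huv : MemLp (fun ω => u ω - v ω) (ENNReal.ofReal p) P :=
    ((memWasserstein_map_iff hp0 hu.measurable).1 hu.memWasserstein).sub
      ((memWasserstein_map_iff hp0 hv.measurable).1 hv.memWasserstein)
  have hfin : eLpNorm (fun ω => damp l (u ω - v ω)) (ENNReal.ofReal p) P ≠ ∞ :=
    (huv.mono (hdamp.comp_aestronglyMeasurable huv.1)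
      (Eventually.of_forall fun ω => norm_damp_le h.rate_nonneg _)).2.ne
  set c := (eLpNorm (fun ω => damp l (u ω - v ω)) (ENNReal.ofReal p) P).toReal with hc
  have hc0 : 0 ≤ c := ENNReal.toReal_nonneg
  have hae : ∀ᵐ ω ∂P, ‖damp l (u ω - v ω)‖ ≤ 2 * ‖damp l (a ω - b ω)‖ + c / 2 := by
    filter_upwards [hu.ae_eq, hv.ae_eq] with ω hω1 hω2
    refine h.norm_damp_solution_sub_le P hu.measurable hv.measurable hu.memWasserstein
      hv.memWasserstein hc0 ?_ hω1 hω2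
    rw [lintegral_enorm_rpow hp0, hc, ENNReal.ofReal_toReal hfin]
  have hmeas : AEStronglyMeasurable (fun ω => 2 * ‖damp l (a ω - b ω)‖) P :=
    (continuous_const.mul (hdamp.norm)).comp_aestronglyMeasurable (ha.sub hb).aestronglyMeasurable
  -- Taking L^p norms of the pointwise bound, which itself involves c, gives c ≤ 2d + c/2. As c is
  -- finite it can be absorbed, whence c/2 ≤ 2d.
  have hle : ENNReal.ofReal c ≤ ENNReal.ofReal (2 * d + c / 2) := by
    rw [hc, ENNReal.ofReal_toReal hfin, ← hc]
    calc _ ≤ eLpNorm (fun ω => 2 * ‖damp l (a ω - b ω)‖ + c / 2) (ENNReal.ofReal p) P :=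
          eLpNorm_mono_ae_real hae
      _ ≤ eLpNorm (fun ω => 2 * ‖damp l (a ω - b ω)‖) (ENNReal.ofReal p) P +
          eLpNorm (fun _ => c / 2) (ENNReal.ofReal p) P :=
        eLpNorm_add_le hmeas aestronglyMeasurable_const hp1
      _ ≤ ENNReal.ofReal (2 * d) + ENNReal.ofReal (c / 2) := by
        refine add_le_add ?_ (eLpNorm_le_ofReal (Eventually.of_forall fun _ => ?_))
        · have h2 := eLpNorm_const_smul (2 : ℝ) (fun ω => ‖damp l (a ω - b ω)‖)
            (ENNReal.ofReal p) P
          rw [eLpNorm_norm] at h2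
          refine (le_of_eq h2).trans ?_
          rw [ENNReal.ofReal_mul two_pos.le]
          refine mul_le_mul' ?_ hab
          rw [← ofReal_norm, Real.norm_two]
        · rw [Real.norm_of_nonneg (by positivity)]
      _ = _ := (ENNReal.ofReal_add (by positivity) (by positivity)).symm
  have hle' := (ENNReal.ofReal_le_ofReal_iff (by positivity)).1 hle
  filter_upwards [hae] with ω hω
  linarith

/-- The mean field equation has at most one solution. -/
lemma ae_eq_of_isAbstractMeanField {a u v : Ω → C(Set.Icc (0 : ℝ) T, E)} (ha : Measurable a)
    (hu : IsAbstractMeanField P p g B a u) (hv : IsAbstractMeanField P p g B a v) :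
    u =ᵐ[P] v := by
  filter_upwards [h.eLpNorm_damp_sub_le ha ha hu hv le_rfl
    (eLpNorm_le_ofReal (Eventually.of_forall fun ω => by
      rw [sub_self, map_zero, norm_zero]))] with ω hω
  simp only [sub_self, map_zero, norm_zero, mul_zero, add_zero] at hω
  have h1 := norm_le_damp h.rate_nonneg (u ω - v ω)
  have h2 : ‖u ω - v ω‖ ≤ 0 := h1.trans (mul_nonpos_of_nonneg_of_nonpos (Real.exp_pos _).le hω)
  exact sub_eq_zero.1 (norm_le_zero_iff.1 h2)

/-- The mean field equation has a solution. -/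
lemma exists_isAbstractMeanField [CompleteSpace E] {a : Ω → C(Set.Icc (0 : ℝ) T, E)}
    (ha : Measurable a) (haL : MemLp a (ENNReal.ofReal p) P) :
    ∃ u, IsAbstractMeanField P p g B a u := by
  have hp0 : 0 < p := by linarith [h.one_le]
  have : Fact (1 ≤ ENNReal.ofReal p) := ⟨by simpa using h.one_le⟩
  have hdamp := continuous_damp (E := E) (T := T) h.rate_nonneg
  let X := Lp C(Set.Icc (0 : ℝ) T, E) (ENNReal.ofReal p) P
  have hmeas : ∀ u : X, Measurable u := fun u => (Lp.stronglyMeasurable u).measurable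
  have hlaw : ∀ u : X, MemWasserstein p (P.map u) := fun u =>
    (memWasserstein_map_iff hp0 (hmeas u)).2 (Lp.memLp u)
  -- Freeze the law of u, solve the equation with that flow, and insert the input a. A fixed point
  -- of u ↦ S_u(a) in L^p reproduces its own law.
  choose S hS hSL using fun u : X => h.exists_solutionMap (hlaw u)
  have hScont : ∀ u, Continuous (S u) := fun u =>
    continuous_of_norm_sub_le (by positivity) (hSL u)
  have hSm : ∀ u, Measurable fun ω => S u (a ω) := fun u => (hScont u).measurable.comp ha
  have hSmem : ∀ u, MemLp (fun ω => S u (a ω)) (ENNReal.ofReal p) P := by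
    exact fun u => haL.comp_of_norm_sub_le (hSm u).aestronglyMeasurable (hSL u)
  let Φ : X → X := fun u => (hSmem u).toLp
  let D : X → X → ℝ := fun u v =>
    (eLpNorm (fun ω => damp l (u ω - v ω)) (ENNReal.ofReal p) P).toReal
  have hsub : ∀ u v : X, MemLp (fun ω => u ω - v ω) (ENNReal.ofReal p) P := fun u v =>
    (Lp.memLp u).sub (Lp.memLp v)
  have hDle : ∀ u v : X, eLpNorm (fun ω => damp l (u ω - v ω)) (ENNReal.ofReal p) P ≤
      eLpNorm (fun ω => u ω - v ω) (ENNReal.ofReal p) P := fun u v =>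
    eLpNorm_mono fun ω => norm_damp_le h.rate_nonneg _
  have hDfin : ∀ u v : X, eLpNorm (fun ω => damp l (u ω - v ω)) (ENNReal.ofReal p) P ≠ ∞ :=
    fun u v => ((hDle u v).trans_lt (hsub u v).2).ne
  have hdist : ∀ u v : X, dist u v =
      (eLpNorm (fun ω => u ω - v ω) (ENNReal.ofReal p) P).toReal := fun u v => Lp.dist_def u v
  obtain ⟨u, hu⟩ := exists_fixedPoint_of_equivalent_dist Φ D (M := Real.exp (l * T))
    (by positivity) (fun u v => by
      rw [hdist, ← ENNReal.toReal_ofReal (Real.exp_pos (l * T)).le, ← ENNReal.toReal_mul]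
      refine ENNReal.toReal_mono (ENNReal.mul_ne_top ENNReal.ofReal_ne_top (hDfin u v)) ?_
      exact eLpNorm_le_mul_eLpNorm_of_ae_le_mul
        (Eventually.of_forall fun ω => norm_le_damp h.rate_nonneg _) _)
    (fun u v => by
      rw [hdist]
      exact ENNReal.toReal_mono (hsub u v).2.ne (hDle u v))
    (fun u v => by
      have hD0 : 0 ≤ D u v := ENNReal.toReal_nonneg
      refine ENNReal.toReal_le_of_le_ofReal (by positivity) (eLpNorm_le_ofReal ?_)
      filter_upwards [(hSmem u).coeFn_toLp, (hSmem v).coeFn_toLp] with ω hω1 hω2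
      rw [hω1, hω2]
      have h1 := h.norm_damp_solution_sub_le P (hmeas u) (hmeas v) (hlaw u) (hlaw v) hD0
        (by rw [lintegral_enorm_rpow hp0, ENNReal.ofReal_toReal (hDfin u v)])
        (hS u (a ω)) (hS v (a ω))
      simp only [sub_self, map_zero, norm_zero, mul_zero, zero_add] at h1
      linarith)
  have hae : (fun ω => S u (a ω)) =ᵐ[P] u := by
    have := (hSmem u).coeFn_toLp
    have h2 : ((hSmem u).toLp : Ω → C(Set.Icc (0 : ℝ) T, E)) = u :=
      congrArg (fun w : X => (w : Ω → C(Set.Icc (0 : ℝ) T, E))) hu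
    rw [h2] at this
    exact this.symm
  have hmap : P.map (fun ω => S u (a ω)) = P.map u := Measure.map_congr hae
  -- This representative of the fixed point satisfies the equation for every ω, not just almost
  -- every one, and has the same law.
  refine ⟨fun ω => S u (a ω), hSm u, ?_, ?_⟩
  · rw [hmap]
    exact hlaw u
  · rw [hmap]
    exact Eventually.of_forall fun ω => hS u (a ω)

end IsContractiveDrift

/-! ### The interacting system -/

/-- The interacting system with inputs `a`. -/
def IsAbstractSystem {n : ℕ} (g : E → Measure E → F)
    (B : C(Set.Icc (0 : ℝ) T, F) →ₗ[ℝ] C(Set.Icc (0 : ℝ) T, E))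
    (a u : Fin n → C(Set.Icc (0 : ℝ) T, E)) : Prop :=
  ∀ i, u i = a i + B (driftPath g (empiricalMeasure u) (u i))

/-- The label plays the role of chance: the law of the field under a uniform label is the empirical
measure. This lets mean field results apply to the system realization by realization. -/
lemma isAbstractSystem_iff (hp : 0 < p) {n : ℕ} (hn : n ≠ 0)
    {a u : Fin n → C(Set.Icc (0 : ℝ) T, E)} :
    IsAbstractSystem g B a u ↔ IsAbstractMeanField (uniformFin n) p g B a u := by
  constructor
  · intro hu
    refine ⟨measurable_of_finite u, ?_, ?_⟩
    · rw [map_uniformFin]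
      exact memWasserstein_empiricalMeasure hp hn u
    · rw [map_uniformFin]
      exact Eventually.of_forall hu
  · intro hu
    have := ae_uniformFin_iff.1 hu.ae_eq
    rwa [map_uniformFin] at this

namespace IsContractiveDrift

variable (h : IsContractiveDrift p L l κ g B) {n : ℕ}
include h

lemma existsUnique_isAbstractSystem [CompleteSpace E] (a : Fin n → C(Set.Icc (0 : ℝ) T, E)) :
    ∃! u, IsAbstractSystem g B a u := by
  have hp0 : 0 < p := by linarith [h.one_le]
  -- Without labels the empirical measure is not a probability measure, but the system is empty.
  rcases eq_or_ne n 0 with rfl | hn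
  · exact ⟨Fin.elim0, fun i => i.elim0, fun u _ => Subsingleton.elim _ _⟩
  have := isProbabilityMeasure_empiricalMeasure hn (id : Fin n → Fin n)
  obtain ⟨u, hu⟩ := h.exists_isAbstractMeanField (P := uniformFin n) (measurable_of_finite a)
    (memLp_uniformFin hn _ a)
  refine ⟨u, (isAbstractSystem_iff hp0 hn).2 hu, fun v hv => ?_⟩
  exact funext (ae_uniformFin_iff.1 (h.ae_eq_of_isAbstractMeanField (measurable_of_finite a)
    ((isAbstractSystem_iff hp0 hn).1 hv) hu))

/-- The solution of the interacting system depends continuously on the inputs. -/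
lemma norm_system_sub_le {a b u v : Fin n → C(Set.Icc (0 : ℝ) T, E)}
    (hu : IsAbstractSystem g B a u) (hv : IsAbstractSystem g B b v) :
    ‖u - v‖ ≤ 4 * Real.exp (l * T) * ‖a - b‖ := by
  have hp0 : 0 < p := by linarith [h.one_le]
  refine (pi_norm_le_iff_of_nonneg (by positivity)).2 fun i => ?_
  have hn : n ≠ 0 := fun h0 => by subst h0; exact i.elim0
  have := isProbabilityMeasure_empiricalMeasure hn (id : Fin n → Fin n)
  have hab : ∀ i, ‖damp l (a i - b i)‖ ≤ ‖a - b‖ := fun i =>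
    (norm_damp_le h.rate_nonneg _).trans (norm_le_pi_norm (a - b) i)
  have h1 := ae_uniformFin_iff.1 (h.eLpNorm_damp_sub_le (measurable_of_finite a)
    (measurable_of_finite b) ((isAbstractSystem_iff hp0 hn).1 hu)
    ((isAbstractSystem_iff hp0 hn).1 hv) (norm_nonneg (a - b))
    (eLpNorm_le_ofReal (Eventually.of_forall hab))) i
  calc ‖u i - v i‖ ≤ Real.exp (l * T) * ‖damp l (u i - v i)‖ := norm_le_damp h.rate_nonneg _
    _ ≤ Real.exp (l * T) * (4 * ‖a - b‖) := by
      gcongr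
      linarith [hab i]
    _ = _ := by ring

/-- The distance between the interacting system and independent copies of the mean field solution
is controlled by the Wasserstein distance of the empirical measure of the latter to its law. -/
lemma norm_damp_system_sub_le {a u w : Fin n → C(Set.Icc (0 : ℝ) T, E)}
    (hu : IsAbstractSystem g B a u) {μ : Measure C(Set.Icc (0 : ℝ) T, E)}
    (hμ : MemWasserstein p μ) (hw : ∀ i, w i = a i + B (driftPath g μ (w i))) {W : ℝ} (hW : 0 ≤ W)
    (hdist : wassersteinDist p (empiricalMeasure w) μ < ENNReal.ofReal W) (i : Fin n) :
    ‖damp l (u i - w i)‖ ≤ W := by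
  have hp0 : 0 < p := by linarith [h.one_le]
  have hn : n ≠ 0 := fun h0 => by subst h0; exact i.elim0
  have := isProbabilityMeasure_empiricalMeasure hn (id : Fin n → Fin n)
  have hmem := memLp_uniformFin hn (ENNReal.ofReal p) fun i => damp l (u i - w i)
  set c := (eLpNorm (fun i => damp l (u i - w i)) (ENNReal.ofReal p) (uniformFin n)).toReal with hc
  have hc0 : 0 ≤ c := ENNReal.toReal_nonneg
  obtain ⟨π, hπ1, hπ2, hπ⟩ := exists_coupling_of_wassersteinDist_lt hp0 hdist
  have hemp : ∀ x : Fin n → C(Set.Icc (0 : ℝ) T, E),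
      MemWasserstein p ((uniformFin n).map x) := fun x => by
    rw [map_uniformFin]
    exact memWasserstein_empiricalMeasure hp0 hn x
  have hcost : ∫⁻ z, ‖damp l (z.1 - z.2)‖ₑ ^ p ∂π ≤ ENNReal.ofReal W ^ p := by
    refine (lintegral_mono fun z => ?_).trans hπ
    rw [edist_eq_enorm_sub]
    refine ENNReal.rpow_le_rpow ?_ hp0.le
    rw [← ofReal_norm, ← ofReal_norm]
    exact ENNReal.ofReal_le_ofReal (norm_damp_le h.rate_nonneg _)
  -- Insert the drift along w with the empirical measure of w. Replacing u by w costs (‖u i - w i‖ +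
  -- c)/4 in the weighted norm, by pairing equal labels; replacing that empirical measure by μ costs
  -- W/4, by the near-optimal coupling.
  have hx : ∀ i, ‖damp l (u i - w i)‖ ≤ (c + W) / 3 := by
    intro i
    have h1 := h.norm_damp_sub_le (uniformFin n) (measurable_of_finite u) (measurable_of_finite w)
      (hemp u) (hemp w) hc0 (by
        rw [lintegral_enorm_rpow hp0, hc, ENNReal.ofReal_toReal hmem.2.ne]) (u i) (w i)
    have h2 := h.norm_damp_sub_le π measurable_fst measurable_snd
      (by rw [hπ1, ← map_uniformFin]; exact hemp w) (by rwa [hπ2]) hW hcost (w i) (w i)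
    rw [map_uniformFin, map_uniformFin] at h1
    rw [hπ1, hπ2, sub_self, map_zero, norm_zero, zero_add] at h2
    have h3 : u i - w i = (B (driftPath g (empiricalMeasure u) (u i)) -
        B (driftPath g (empiricalMeasure w) (w i))) +
        (B (driftPath g (empiricalMeasure w) (w i)) - B (driftPath g μ (w i))) := by
      conv_lhs => rw [hu i, hw i]
      abel
    have h4 : ‖damp l (u i - w i)‖ ≤ ‖damp l (B (driftPath g (empiricalMeasure u) (u i)) -
        B (driftPath g (empiricalMeasure w) (w i)))‖ +
        ‖damp l (B (driftPath g (empiricalMeasure w) (w i)) - B (driftPath g μ (w i)))‖ := by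
      conv_lhs => rw [h3, map_add]
      exact norm_add_le _ _
    linarith
  -- Averaging the previous bound over labels closes the estimate: c ≤ W/2, hence each difference is
  -- at most W/2.
  have hcle : c ≤ (c + W) / 3 := ENNReal.toReal_le_of_le_ofReal (by positivity)
    (eLpNorm_le_ofReal (Eventually.of_forall hx))
  linarith [hx i]

end IsContractiveDrift

end MeanField

/-! ### Propagation of chaos for the abstract system -/

section Chaos

variable {E F : Type*} [NormedAddCommGroup E] [NormedSpace ℝ E] [MeasurableSpace E] [BorelSpace E]
  [SecondCountableTopology E] [NormedAddCommGroup F] [NormedSpace ℝ F]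
  {T p l κ : ℝ} {L : ℝ≥0}
  [MeasurableSpace C(Set.Icc (0 : ℝ) T, E)] [BorelSpace C(Set.Icc (0 : ℝ) T, E)]
  {g : E → Measure E → F} {B : C(Set.Icc (0 : ℝ) T, F) →ₗ[ℝ] C(Set.Icc (0 : ℝ) T, E)}
  {Ω Ω₀ : Type*} [MeasurableSpace Ω] [MeasurableSpace Ω₀]

namespace IsContractiveDrift

/-- The solution of the interacting system is a measurable function of the inputs. -/
lemma measurable_system [CompleteSpace E] (h : IsContractiveDrift p L l κ g B) {n : ℕ}
    {a U : Fin n → Ω → C(Set.Icc (0 : ℝ) T, E)} (ha : ∀ i, Measurable (a i))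
    (hU : ∀ ω, IsAbstractSystem g B (fun i => a i ω) (fun i => U i ω)) (i : Fin n) :
    Measurable (U i) := by
  choose S hS hS' using fun a : Fin n → C(Set.Icc (0 : ℝ) T, E) => h.existsUnique_isAbstractSystem a
  have hcont : Continuous S := continuous_of_norm_sub_le (by positivity)
    fun a b => h.norm_system_sub_le (hS a) (hS b)
  have heq : U i = fun ω => S (fun j => a j ω) i := funext fun ω =>
    congrFun (hS' _ _ (hU ω)) i
  rw [heq]
  exact ((measurable_pi_apply i).comp hcont.measurable).comp (measurable_pi_lambda _ ha)

/-- The fields of the interacting system converge to independent copies of the mean field solution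
when the empirical measures of the latter converge. -/
lemma tendsto_system (h : IsContractiveDrift p L l κ g B)
    {a w : ℕ → C(Set.Icc (0 : ℝ) T, E)} {U : (n : ℕ) → Fin n → C(Set.Icc (0 : ℝ) T, E)}
    (hU : ∀ n, IsAbstractSystem g B (fun i : Fin n => a i) (U n))
    {μ : Measure C(Set.Icc (0 : ℝ) T, E)} (hμ : MemWasserstein p μ)
    (hw : ∀ i, w i = a i + B (driftPath g μ (w i)))
    (hdist : Tendsto (fun n => wassersteinDist p (empiricalMeasure fun i : Fin n => w i) μ ^ p) atTop
      (𝓝 0)) {k : ℕ} (j : Fin k) :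
    Tendsto (fun m => U (k + m) (Fin.castAdd m j)) atTop (𝓝 (w j)) := by
  have hp0 : 0 < p := by linarith [h.one_le]
  rw [Metric.tendsto_nhds]
  intro ε hε
  -- The exponential undoes the weight; the factor 2 makes the final inequality strict.
  have hW : 0 < ε / (2 * Real.exp (l * T)) := by positivity
  have hpos : 0 < ENNReal.ofReal (ε / (2 * Real.exp (l * T))) ^ p :=
    ENNReal.rpow_pos (ENNReal.ofReal_pos.2 hW) ENNReal.ofReal_ne_top
  -- Taking n = k + m guarantees that the first k labels exist; `Fin.castAdd` embeds them.
  have hshift : Tendsto (fun m : ℕ => k + m) atTop atTop :=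
    tendsto_atTop_mono (fun m => Nat.le_add_left m k) tendsto_id
  filter_upwards [hshift.eventually (hdist.eventually_lt_const hpos)] with m hm
  have h1 := h.norm_damp_system_sub_le (hU (k + m)) hμ (w := fun i => w i) (fun i => hw i) hW.le
    ((ENNReal.rpow_lt_rpow_iff hp0).1 hm) (Fin.castAdd m j)
  rw [dist_eq_norm]
  calc _ ≤ Real.exp (l * T) * ‖damp l (U (k + m) (Fin.castAdd m j) - w j)‖ :=
        norm_le_damp h.rate_nonneg _
    _ ≤ Real.exp (l * T) * (ε / (2 * Real.exp (l * T))) := by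
        gcongr
        exact h1
    _ = ε / 2 := by field_simp
    _ < ε := by linarith

/-- Propagation of chaos. -/
lemma tendsto_integral_system [CompleteSpace E] (h : IsContractiveDrift p L l κ g B)
    {P : Measure Ω} [IsProbabilityMeasure P] {P₀ : Measure Ω₀} {a : ℕ → Ω → C(Set.Icc (0 : ℝ) T, E)}
    (ha : ∀ i, Measurable (a i)) (hindep : iIndepFun a P) {b u : Ω₀ → C(Set.Icc (0 : ℝ) T, E)}
    (hb : Measurable b) (hab : ∀ i, P.map (a i) = P₀.map b)
    (hu : IsAbstractMeanField P₀ p g B b u) {U : (n : ℕ) → Fin n → Ω → C(Set.Icc (0 : ℝ) T, E)}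
    (hU : ∀ n ω, IsAbstractSystem g B (fun i : Fin n => a i ω) (fun i => U n i ω)) (k : ℕ)
    (φ : BoundedContinuousFunction (Fin k → C(Set.Icc (0 : ℝ) T, E)) ℝ) :
    Tendsto (fun m : ℕ => ∫ ω, φ (fun j => U (k + m) (Fin.castAdd m j) ω) ∂P) atTop
      (𝓝 (∫ x, φ x ∂(Measure.pi fun _ : Fin k => P₀.map u))) := by
  -- Freezing the law of u makes the solution a deterministic function of the input. Applied to the
  -- inputs on Ω, it gives independent copies of u, although u itself lives on Ω₀.
  obtain ⟨S, hS, hSL⟩ := h.exists_solutionMap hu.memWasserstein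
  have hSm : Measurable S := (continuous_of_norm_sub_le (by positivity) hSL).measurable
  have hSb : (fun ω => S (b ω)) =ᵐ[P₀] u := by
    filter_upwards [hu.ae_eq] with ω hω
    have h1 := h.norm_solution_sub_le hu.memWasserstein (hS (b ω)) hω
    rw [sub_self, norm_zero, mul_zero] at h1
    exact sub_eq_zero.1 (norm_le_zero_iff.1 h1)
  have hwm : ∀ i, Measurable fun ω => S (a i ω) := fun i => hSm.comp (ha i)
  have hwi : iIndepFun (fun i ω => S (a i ω)) P := hindep.comp (fun _ => S) fun _ => hSm
  have hwlaw : ∀ i, P.map (fun ω => S (a i ω)) = P₀.map u := fun i => by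
    rw [← Measure.map_congr hSb]
    change P.map (S ∘ a i) = P₀.map (S ∘ b)
    rw [← Measure.map_map hSm (ha i), hab, Measure.map_map hSm hb]
  have hUm : ∀ n i, Measurable (U n i) := fun n =>
    h.measurable_system (fun i : Fin n => ha i) (hU n)
  -- The limit is now an expectation over these copies on Ω, so almost sure convergence of the
  -- fields suffices.
  have hpi : P.map (fun ω (j : Fin k) => S (a j ω)) = Measure.pi fun _ : Fin k => P₀.map u := by
    rw [(iIndepFun_iff_map_fun_eq_pi_map fun j : Fin k => (hwm j).aemeasurable).1
      (hwi.precomp Fin.val_injective)]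
    simp only [hwlaw]
  rw [← hpi, integral_map (measurable_pi_lambda _ fun j : Fin k => hwm j).aemeasurable
    φ.continuous.aestronglyMeasurable]
  refine tendsto_integral_of_dominated_convergence (fun _ => ‖φ‖)
    (fun m => (φ.continuous.measurable.comp
      (measurable_pi_lambda _ fun j => hUm _ _)).aestronglyMeasurable)
    (integrable_const _) (fun m => Eventually.of_forall fun ω => φ.norm_coe_le_norm _) ?_
  filter_upwards [ae_tendsto_wassersteinDist_empiricalMeasure h.one_le hwm hwi hwlaw
    hu.memWasserstein] with ω hω
  exact (φ.continuous.tendsto _).comp (tendsto_pi_nhds.2 fun j =>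
    h.tendsto_system (fun n => hU n ω) hu.memWasserstein (fun i => hS (a i ω)) hω j)

end IsContractiveDrift

end Chaos

/-! ### The stochastic heat equations -/

section Equation

variable {α γ T p : ℝ} {L : ℝ≥0} {g : Holder α → Measure (Holder α) → Holder γ}

/-- The Duhamel operator is contractive for a weighted norm with a large rate. -/
lemma exists_isContractiveDrift (T : ℝ) (hγ : α - 2 < γ) (hp : 1 ≤ p)
    (hg : IsLipschitzDrift p L g) :
    ∃ (B : PathSpace T γ →ₗ[ℝ] PathSpace T α) (l κ : ℝ),
      (∀ f t k, (B f t).coeff k = duhamel (fun s => (f s).coeff) t k) ∧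
        IsContractiveDrift p L l κ g B := by
  -- Half of the regularity left over after the gain of two derivatives, capped at 1 for the
  -- interpolation. It is positive because γ > α - 2, so the weighted constant tends to 0 with
  -- growing rate.
  set δ := min 1 ((γ - α + 2) / 2) with hδ
  have hδ0 : 0 < δ := lt_min one_pos (by linarith)
  have hδ2 : δ ≤ (γ - α + 2) / 2 := min_le_right _ _
  obtain ⟨B, hB, C, hC, hbound⟩ := exists_duhamel_operator T α γ hδ0.le (min_le_left _ _)
    (by linarith)
  have hlim : Tendsto (fun l : ℝ => C * l⁻¹ ^ δ * L) atTop (𝓝 0) := by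
    have h1 := (tendsto_inv_atTop_zero (𝕜 := ℝ)).rpow_const (p := δ) (Or.inr hδ0.le)
    rw [Real.zero_rpow hδ0.ne'] at h1
    simpa using (h1.const_mul C).mul_const (L : ℝ)
  obtain ⟨l, hl, hl0⟩ := ((hlim.eventually_le_const (by norm_num : (0 : ℝ) < 1 / 4)).and
    (eventually_gt_atTop 0)).exists
  refine ⟨B, l, C * l⁻¹ ^ δ, hB, hp, hg, hl0.le, by positivity, fun f => ?_, hl⟩
  refine norm_damp_le_of_forall (by positivity) fun t => ?_
  rw [mul_assoc]
  exact hbound l hl0 f _ (norm_nonneg _) (norm_apply_le_damp l f) t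

/-- The solution of the linear heat equation depends continuously on the noise and the initial
condition. -/
lemma exists_heatSolution (T α : ℝ) :
    ∃ A : (PathSpace T (α - 2) × Holder α) →L[ℝ] PathSpace T α, ∀ z t k,
      (A z t).coeff k = heatSymbol t k * z.2.coeff k + duhamel (fun s => (z.1 s).coeff) t k := by
  -- The endpoint δ = 0 gains exactly two derivatives and no smallness; none is needed, since the
  -- noise is only an input.
  obtain ⟨K, hK, C, hC, hbound⟩ := exists_duhamel_operator T α (α - 2) le_rfl zero_le_one
    (by linarith)
  obtain ⟨H, hH, D, hD, hHbound⟩ := exists_heat_operator T α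
  have hKbound : ∀ f, ‖K f‖ ≤ C * Real.exp T * ‖f‖ := fun f => by
    refine (ContinuousMap.norm_le _ (by positivity)).2 fun t => ?_
    have h1 := hbound 1 one_pos f ‖f‖ (norm_nonneg _) (fun s => (f.norm_coe_le_norm s).trans
      (le_mul_of_one_le_right (norm_nonneg _) (Real.one_le_exp (by simpa using s.2.1)))) t
    rw [Real.rpow_zero, mul_one, one_mul] at h1
    calc _ ≤ C * (‖f‖ * Real.exp t) := h1
      _ ≤ C * (‖f‖ * Real.exp T) := by
        gcongr
        exact t.2.2
      _ = _ := by ring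
  have hbd : ∀ z, ‖(H.comp (LinearMap.snd ℝ (PathSpace T (α - 2)) (Holder α)) +
      K.comp (LinearMap.fst ℝ (PathSpace T (α - 2)) (Holder α))) z‖ ≤
        (D + C * Real.exp T) * ‖z‖ := fun z => by
    calc ‖H z.2 + K z.1‖ ≤ D * ‖z.2‖ + C * Real.exp T * ‖z.1‖ :=
          (norm_add_le _ _).trans (add_le_add (hHbound _) (hKbound _))
      _ ≤ D * ‖z‖ + C * Real.exp T * ‖z‖ := by
        gcongr
        · exact norm_snd_le z
        · exact norm_fst_le z
      _ = _ := by ring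
  refine ⟨LinearMap.mkContinuous _ _ hbd, fun z t k => ?_⟩
  rw [← hH, ← hK]
  rfl

/-- The heat equation with a given flow of measures, as a fixed point equation in the path space. -/
lemma isSolution_iff (hp : 1 ≤ p) (hg : IsLipschitzDrift p L g)
    {B : PathSpace T γ →ₗ[ℝ] PathSpace T α}
    (hB : ∀ f t k, (B f t).coeff k = duhamel (fun s => (f s).coeff) t k)
    {A : (PathSpace T (α - 2) × Holder α) →L[ℝ] PathSpace T α}
    (hA : ∀ z t k,
      (A z t).coeff k = heatSymbol t k * z.2.coeff k + duhamel (fun s => (z.1 s).coeff) t k)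
    {μ : Measure (PathSpace T α)} (hμ : MemWasserstein p μ) {ζ : PathSpace T (α - 2)}
    {u₀ : Holder α} {u : PathSpace T α} :
    IsSolution g ζ u₀ (flow μ) u ↔ u = A (ζ, u₀) + B (driftPath g μ u) := by
  have key : ∀ t k, (A (ζ, u₀) t + B (driftPath g μ u) t).coeff k =
      heatSymbol t k * u₀.coeff k + ∫ s in Set.Iic t,
        heatSymbol (t - s) k * ((ζ s).coeff k + (g (u s) (flow μ s)).coeff k) ∂timeMeasure T := by
    intro t k
    have h1 : ∀ k, Continuous fun s => (ζ s).coeff k := fun k =>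
      (Holder.continuous_coeff k).comp ζ.continuous
    have h2 : ∀ k, Continuous fun s => (driftPath g μ u s).coeff k := fun k =>
      (Holder.continuous_coeff k).comp (driftPath g μ u).continuous
    rw [Holder.coeff_add, Pi.add_apply, hA, hB, add_assoc]
    unfold duhamel
    rw [← integral_add (integrable_duhamel h1 t k) (integrable_duhamel h2 t k)]
    simp only [driftPath_apply hp hg hμ, mul_add]
  constructor
  · intro h
    ext1 t
    refine Holder.ext_coeff (funext fun k => ?_)
    exact (h t k).trans (key t k).symm
  · intro h t k
    rw [← key]
    exact congrArg (fun v : PathSpace T α => (v t).coeff k) h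

/-- Reconciles the empirical measure on path space, used in the abstract system, with the one taken
at each time in the equations. -/
lemma flow_empiricalMeasure {n : ℕ} (u : Fin n → PathSpace T α) :
    flow (empiricalMeasure u) = fun t => empiricalMeasure fun j => u j t := by
  funext t
  rw [flow, ← map_uniformFin, Measure.map_map (measurable_eval t) (measurable_of_finite u),
    ← map_uniformFin]
  rfl

end Equation

end MeanFieldSPDE

end

/-! ### Propagation of chaos for the stochastic heat equations -/

open MeanFieldSPDE in
theorem mainTheorem5
    (α : ℝ) (hα : 2 / 3 < α) (hα' : α < 1) (γ : ℝ) (hγ : α - 2 < γ)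
    (T : ℝ) (hT : 0 < T) (p : ℝ) (hp : 1 ≤ p)
    (g : Holder α → Measure (Holder α) → Holder γ) (L : ℝ≥0) (hg : LipschitzDrift p L g)
    {Ω₀ : Type*} [MeasurableSpace Ω₀] (P₀ : Measure Ω₀) [IsProbabilityMeasure P₀]
    (ζ : Ω₀ → PathSpace T (α - 2)) (u₀ : Ω₀ → Holder α)
    (hζ : Measurable ζ) (hu₀ : Measurable u₀)
    (hLp : MemLp (fun ω => (ζ ω, u₀ ω)) (ENNReal.ofReal p) P₀)
    {Ω : Type*} [MeasurableSpace Ω] (P : Measure Ω) [IsProbabilityMeasure P]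
    (Z : ℕ → Ω → PathSpace T (α - 2)) (V₀ : ℕ → Ω → Holder α)
    (hZ : ∀ i, Measurable (Z i)) (hV₀ : ∀ i, Measurable (V₀ i))
    (hindep : iIndepFun (fun i ω => (Z i ω, V₀ i ω)) P)
    (hident : ∀ i, IdentDistrib (fun ω => (Z i ω, V₀ i ω)) (fun ω => (ζ ω, u₀ ω)) P P₀) :
    -- the mean field equation has a solution, which is almost surely unique
    (∃ u, IsMeanFieldSolution P₀ p g ζ u₀ u) ∧
    (∀ u u', IsMeanFieldSolution P₀ p g ζ u₀ u → IsMeanFieldSolution P₀ p g ζ u₀ u' →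
      u =ᵐ[P₀] u') ∧
    -- for each realization, the interacting system has a unique solution
    (∀ (n : ℕ) (ω : Ω), ∃! v : Fin n → PathSpace T α,
      IsSystemSolution g (fun i => Z i ω) (fun i => V₀ i ω) v) ∧
    -- the law of the first `k` of `n` fields converges weakly to `𝓛(u)^{⊗ k}` as `n → ∞`
    (∀ (u : Ω₀ → PathSpace T α) (U : (n : ℕ) → Fin n → Ω → PathSpace T α),
      IsMeanFieldSolution P₀ p g ζ u₀ u →
      (∀ (n : ℕ) (ω : Ω),
        IsSystemSolution g (fun i : Fin n => Z i ω) (fun i => V₀ i ω) (fun i => U n i ω)) →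
      (∀ (n : ℕ) (i : Fin n), Measurable (U n i)) ∧
      ∀ (k : ℕ) (φ : BoundedContinuousFunction (Fin k → PathSpace T α) ℝ),
        Tendsto (fun m : ℕ => ∫ ω, φ (fun j => U (k + m) (Fin.castAdd m j) ω) ∂P) atTop
          (𝓝 (∫ x, φ x ∂(Measure.pi fun _ : Fin k => P₀.map u)))) := by
  obtain ⟨B, l, κ, hB, h⟩ := exists_isContractiveDrift T hγ hp hg
  obtain ⟨A, hA⟩ := exists_heatSolution T α
  have hp0 : 0 < p := by linarith
  have hmf : ∀ u, IsMeanFieldSolution P₀ p g ζ u₀ u ↔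
      IsAbstractMeanField P₀ p g B (fun ω => A (ζ ω, u₀ ω)) u := fun u =>
    ⟨fun hu => ⟨hu.1, hu.2.1, hu.2.2.mono fun ω hω => (isSolution_iff hp hg hB hA hu.2.1).1 hω⟩,
      fun hu => ⟨hu.measurable, hu.memWasserstein,
        hu.ae_eq.mono fun ω hω => (isSolution_iff hp hg hB hA hu.memWasserstein).2 hω⟩⟩
  have hsys : ∀ (n : ℕ) (z : Fin n → PathSpace T (α - 2)) (v₀ : Fin n → Holder α) v,
      IsSystemSolution g z v₀ v ↔ IsAbstractSystem g B (fun i => A (z i, v₀ i)) v := by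
    intro n z v₀ v
    refine forall_congr' fun i => ?_
    have hn : n ≠ 0 := fun h0 => by subst h0; exact i.elim0
    rw [← flow_empiricalMeasure]
    exact isSolution_iff hp hg hB hA (memWasserstein_empiricalMeasure hp0 hn v)
  have hb : Measurable fun ω => A (ζ ω, u₀ ω) := A.continuous.measurable.comp (hζ.prodMk hu₀)
  have ha : ∀ i, Measurable fun ω => A (Z i ω, V₀ i ω) := fun i =>
    A.continuous.measurable.comp ((hZ i).prodMk (hV₀ i))
  refine ⟨?_, fun u u' hu hu' => ?_, fun n ω => ?_, fun u U hu hU => ⟨fun n i => ?_, ?_⟩⟩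
  · obtain ⟨u, hu⟩ := h.exists_isAbstractMeanField hb (A.comp_memLp' hLp)
    exact ⟨u, (hmf u).2 hu⟩
  · exact h.ae_eq_of_isAbstractMeanField hb ((hmf u).1 hu) ((hmf u').1 hu')
  · simp only [hsys]
    exact h.existsUnique_isAbstractSystem _
  · exact h.measurable_system (fun i : Fin n => ha i) (fun ω => (hsys n _ _ _).1 (hU n ω)) i
  · exact h.tendsto_integral_system ha
      (hindep.comp (fun _ => A) fun _ => A.continuous.measurable) hb
      (fun i => ((hident i).comp A.continuous.measurable).map_eq) ((hmf u).1 hu)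
      (fun n ω => (hsys n _ _ _).1 (hU n ω))
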